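/- Let $k$ be an algebraically closed field of characteristic $0$. **Filtered side.** A *triple* $(V,F_0,F_1,F_2)$ is a finite-dimensional $k$-vector space with three decreasing filtrations $F_i=(F_i^p)_{p\in\mathbf Z}$ that are exhaustive (each takes both values $0$ and $V$). A *compatible* map $f:(V,F_i)\to(W,G_i)$ is a linear map with $f(F_i^p)\subset G_i^p$; it is *strict* if $f(F_i^p)=f(V)\cap G_i^p$ for all $i,p$. A triple is *split* if $V=\bigoplus_{m\in\mathbf Z^3}V^m$ with $F_i^p=\bigoplus_{m_i\ge p}V^m$ for all $i,p$; it is *opposed* if $Gr_{F_1}^pGr_{F_2}^qGr_{F_0}^nV=0$ whenever $p+q+n\ne 0$. **Geometric side.** Let $\mathbf P^2=\operatorname{Proj}k[u_0,u_1,u_2]$ with the translation action of $\mathbf T=\mathbf G_m^3/\Delta$, $\Delta$ the diagonal. Let $P_0,P_1,P_2$ be the coordinate points $(1:0:0),(0:1:0),(0:0:1)$, and $\mathbf P^1_0=\{u_0=0\}$ with inclusion $j$ into $\mathbf P^2$. A $\mathbf T$-equivariant vector bundle $\xi$ is *$\mathbf P^1_0$-semistable* if $\mu(\mathcal E)\le\mu(j^*\xi)$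 for every nonzero coherent subsheaf $\mathcal E\subset j^*\xi$, where $\mu=\deg/\mathrm{rank}$ (and $\mu=0$ in rank $0$). For $Z\subset\{P_0,P_1,P_2\}$, a morphism *has cokernel singular only in $Z$* if its cokernel sheaf is free at every point of $\mathbf P^2\setminus Z$. **Functors.** The Rees functor $\Phi_R$ sends $(V,F_i)$ to the $\mathbf T$-equivariant sheaf whose sections on the chart $\{u_l\neq0\}$, $\{i,j,l\}=\{0,1,2\}$, are $\sum_{p,q}(u_i/u_l)^{-p}(u_j/u_l)^{-q}(F_i^p\cap F_j^q)$, with gluing and $\mathbf T$-action induced from $\mathcal O\otimes V$ on the open orbit. The functor $\Phi_I$ sends $\xi$ to its fibre at $(1:1:1)$, with $v\in F_i^p$ iff the $\mathbf T$-invariant section $s$ over the open orbit through $v$ is such that $u^m s$ ($m\in\mathbf Z^3$, $\sum_j m_j=0$, $m_i=-p$) extends to $\{u_j\ne0\ \text{for all } j\ne i\}$. **Theorem.** $\Phi_R$ takes triples to $\mathbf T$-equivariant vector bundles on $\mathbf P^2$, $\Phi_I$ takes these bundles to triples, and the two functors are quasi-inverse equivalences between triples with compatible maps and $\mathbf T$-equivariant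 vector bundles with equivariant morphisms. This equivalence restricts, in the sense that $\Phi_R$ and $\Phi_I$ preserve the indicated objects, identify the indicated morphisms, and the unit and counit isomorphisms are among these morphisms, to equivalences between: (a) all triples, with strict maps, and all $\mathbf T$-equivariant vector bundles on $\mathbf P^2$, with equivariant morphisms whose cokernel is singular only in $\{P_0,P_1,P_2\}$; (b) split triples, with strict maps, and direct sums of $\mathbf T$-equivariant line bundles, with equivariant morphisms whose cokernel is singular only in $\{P_0,P_1,P_2\}$; (c) opposed triples, with strict maps, and $\mathbf T$-equivariant vector bundles that are $\mathbf P^1_0$-semistable of slope $0$, with equivariant morphisms whose cokernel is singular only in $\{P_0\}$; in this case both classes of morphisms contain the identities and are closed under composition. -/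

import Mathlib

open CategoryTheory
open scoped TensorProduct

universe u

noncomputable section

namespace TriRees

/-! ## Vector spaces with three filtrations -/

/-- A `k`-vector space with three families of subspaces indexed by `ℤ`. -/
structure MultiFil (k : Type u) [Field k] where
  V : Type u
  [addCommGroup : AddCommGroup V]
  [module : Module k V]
  /-- `F i p` is the step `F_i^p`. -/
  F : Fin 3 → ℤ → Submodule k V

attribute [instance] MultiFil.addCommGroup MultiFil.module

variable {k : Type u} [Field k]

/-- Linear maps compatible with the three families. -/
@[ext]
structure MultiFil.Hom (V W : MultiFil k) where
  lin : V.V →ₗ[k] W.V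
  map_le : ∀ i p, (V.F i p).map lin ≤ W.F i p

instance : Category (MultiFil k) where
  Hom := MultiFil.Hom
  id V := ⟨LinearMap.id, fun _ _ => by simp⟩
  comp f g := ⟨g.lin ∘ₗ f.lin, fun i p => by
    rw [Submodule.map_comp]
    exact (Submodule.map_mono (f.map_le i p)).trans (g.map_le i p)⟩

/-- `V` is finite-dimensional and the three families are decreasing exhaustive filtrations
(each one reaches both `0` and `V`). -/
def isTriFil (k : Type u) [Field k] : ObjectProperty (MultiFil k) := fun V =>
  FiniteDimensional k V.V ∧
    ∀ i, Antitone (V.F i) ∧ (∃ p, V.F i p = ⊥) ∧ (∃ q, V.F i q = ⊤)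

/-- Finite-dimensional vector spaces with three decreasing exhaustive filtrations and
(all) compatible linear maps. -/
abbrev TriFil (k : Type u) [Field k] := (isTriFil k).FullSubcategory

/-- Strict compatibility with each of the three filtrations: `f (F_i^p V) = Im f ∩ F_i^p W`. -/
def strict (k : Type u) [Field k] : MorphismProperty (TriFil k) := fun V W f =>
  ∀ i p, (V.obj.F i p).map f.hom.lin = LinearMap.range f.hom.lin ⊓ W.obj.F i p

/-- The three filtrations are simultaneously split: there is a trigrading of `V` with
`F_i^p = ⨁_{m i ≥ p} V^m`. -/
def isSplit (k : Type u) [Field k] : ObjectProperty (TriFil k) := fun V =>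
  ∃ D : (Fin 3 → ℤ) → Submodule k V.obj.V, DirectSum.IsInternal D ∧
    ∀ i p, V.obj.F i p = ⨆ (m : Fin 3 → ℤ) (_ : p ≤ m i), D m

/-- `Gr_F^n V = F^n / F^{n+1}`. -/
abbrev Gr {V : Type u} [AddCommGroup V] [Module k V] (F : ℤ → Submodule k V) (n : ℤ) : Type u :=
  ↥(F n) ⧸ (F (n + 1)).submoduleOf (F n)

/-- The filtration induced by `G` on the subquotient `Gr_F^n V`. -/
def Gr.induced {V : Type u} [AddCommGroup V] [Module k V] (F : ℤ → Submodule k V) (n : ℤ)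
    (G : ℤ → Submodule k V) (q : ℤ) : Submodule k (Gr F n) :=
  ((G q).submoduleOf (F n)).map ((F (n + 1)).submoduleOf (F n)).mkQ

/-- Opposed filtrations: `Gr_{F_1}^p Gr_{F_2}^q Gr_{F_0}^n V = 0` whenever `p + q + n ≠ 0`. -/
def isOpposed (k : Type u) [Field k] : ObjectProperty (TriFil k) := fun V =>
  ∀ p q n : ℤ, p + q + n ≠ 0 →
    Subsingleton (Gr (Gr.induced (Gr.induced (V.obj.F 0) n (V.obj.F 2)) q
      (Gr.induced (V.obj.F 0) n (V.obj.F 1))) p)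

/-! ## The projective plane with its torus action

`P² = Proj k[u₀, u₁, u₂]` is covered by the `U_i = {u_i ≠ 0}`. For a nonempty set `S` of indices,
`U_S = ⋂_{i ∈ S} U_i` is affine with coordinate ring the span of the monomials `u^m` of total
degree `0` with `m i ≥ 0` for `i ∉ S`. The torus `T = G_m³ / Δ` has as characters the `m ∈ ℤ³` with
`∑ m i = 0`, and acts by `u^m ↦ t^m ⊗ u^m`. -/

/-- The character lattice of `T = G_m³ / Δ`. -/
def charLattice : AddSubgroup (Fin 3 → ℤ) where
  carrier := {m | m 0 + m 1 + m 2 = 0}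
  zero_mem' := by simp
  add_mem' := by
    intro a b ha hb
    simp only [Set.mem_ofPred_eq, Pi.add_apply] at *
    omega
  neg_mem' := by
    intro a ha
    simp only [Set.mem_ofPred_eq, Pi.neg_apply] at *
    omega

/-- `k[T]`, the Hopf algebra of functions on `T`; also the ring of functions on the open orbit
`U_{0,1,2}` of `P²`. -/
abbrev TorusRing (k : Type u) [Field k] := AddMonoidAlgebra k charLattice

/-- The character `u^m`. -/
def chi (m : charLattice) : TorusRing k := AddMonoidAlgebra.single m 1

/-- The exponent of `u_j / u_i`. -/
def ratio (i j : Fin 3) : charLattice :=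
  ⟨Pi.single j 1 - Pi.single i 1, by
    change _ + _ + _ = (0 : ℤ)
    fin_cases i <;> fin_cases j <;> decide⟩

/-- Nonempty sets of indices: they index the opens `U_S`, and `S ≤ S'` means `U_{S'} ⊆ U_S`. -/
abbrev Idx := {S : Finset (Fin 3) // S.Nonempty}

/-- The chart `U_i`. -/
def chart (i : Fin 3) : Idx := ⟨{i}, Finset.singleton_nonempty i⟩

/-- The overlap `U_i ∩ U_j`. -/
def overlap (i j : Fin 3) : Idx := ⟨{i, j}, Finset.insert_nonempty i {j}⟩

/-- The open orbit `U_0 ∩ U_1 ∩ U_2`. -/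
def orbit : Idx := ⟨Finset.univ, Finset.univ_nonempty⟩

/-- The open `⋂_{j ≠ i} U_j`, on which only the coordinate `u_i` may vanish. -/
def awayFrom (i : Fin 3) : Idx := ⟨{i}ᶜ, ⟨i + 1, by fin_cases i <;> decide⟩⟩

theorem chart_le_left (i j : Fin 3) : chart i ≤ overlap i j :=
  fun _ h => Finset.mem_insert.2 (Or.inl (Finset.mem_singleton.1 h))

theorem chart_le_right (i j : Fin 3) : chart j ≤ overlap i j :=
  fun _ h => Finset.mem_insert.2 (Or.inr h)

theorem le_orbit (S : Idx) : S ≤ orbit := fun _ _ => Finset.mem_univ _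

/-- The exponents `m` of the monomials `u^m` that are regular on `U_S`. -/
def cone (S : Idx) : AddSubmonoid charLattice where
  carrier := {m | ∀ i ∉ S.1, 0 ≤ m.1 i}
  zero_mem' := fun _ _ => le_rfl
  add_mem' := fun ha hb i hi => add_nonneg (ha i hi) (hb i hi)

theorem cone_mono {S S' : Idx} (h : S ≤ S') : cone S ≤ cone S' :=
  fun _ hm i hi => hm i fun hS => hi (h hS)

/-- The ring `Γ(U_S, 𝒪)`. -/
abbrev chartRing (k : Type u) [Field k] (S : Idx) := AddMonoidAlgebra k (cone S)

/-- The monomial `u^m` as a function on `U_S`. -/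
def mono {S : Idx} (m : cone S) : chartRing k S := AddMonoidAlgebra.single m 1

/-- Restriction of functions from `U_S` to `U_{S'}`. -/
def restr (k : Type u) [Field k] {S S' : Idx} (h : S ≤ S') : chartRing k S →+* chartRing k S' :=
  AddMonoidAlgebra.mapDomainRingHom k (AddSubmonoid.inclusion (cone_mono h))

/-- Restriction of functions from `U_S` to the open orbit. -/
def toTorus (k : Type u) [Field k] (S : Idx) : chartRing k S →+* TorusRing k :=
  AddMonoidAlgebra.mapDomainRingHom k (cone S).subtype

/-! ## `T`-equivariant sheaves and vector bundles on `P²` -/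

/-- A `T`-equivariant presheaf of modules on the affine opens `U_S` of `P²`: sections, restriction
maps, and a `T`-linearization given on each `U_S` by a coaction of `k[T]` which is semilinear over
the coaction `u^m ↦ t^m ⊗ u^m` on functions. -/
structure EqSheaf (k : Type u) [Field k] where
  sec : Idx → Type u
  [addCommGroup : ∀ S, AddCommGroup (sec S)]
  [moduleBase : ∀ S, Module k (sec S)]
  [module : ∀ S, Module (chartRing k S) (sec S)]
  [tower : ∀ S, IsScalarTower k (chartRing k S) (sec S)]
  res : ∀ {S S' : Idx}, S ≤ S' → sec S →ₗ[k] sec S'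
  res_smul : ∀ {S S' : Idx} (h : S ≤ S') (a : chartRing k S) (x : sec S),
    res h (a • x) = restr k h a • res h x
  res_refl : ∀ (S : Idx) (x : sec S), res (le_refl S) x = x
  res_trans : ∀ {S S' S'' : Idx} (h : S ≤ S') (h' : S' ≤ S'') (x : sec S),
    res (h.trans h') x = res h' (res h x)
  coact : ∀ S, sec S →ₗ[k] TorusRing k ⊗[k] sec S
  coact_smul : ∀ (S : Idx) (m : cone S) (x : sec S), coact S (mono (k := k) m • x) =
    TensorProduct.map (LinearMap.mulLeft k (chi m.1))
      (Algebra.lsmul k k (sec S) (mono (k := k) m)) (coact S x)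
  counit_coact : ∀ (S : Idx) (x : sec S),
    (Coalgebra.counit (R := k) (A := TorusRing k)).rTensor (sec S) (coact S x) = 1 ⊗ₜ[k] x
  coassoc : ∀ (S : Idx) (x : sec S),
    TensorProduct.assoc k (TorusRing k) (TorusRing k) (sec S)
      ((Coalgebra.comul (R := k) (A := TorusRing k)).rTensor (sec S) (coact S x)) =
    (coact S).lTensor (TorusRing k) (coact S x)
  coact_res : ∀ {S S' : Idx} (h : S ≤ S') (x : sec S),
    coact S' (res h x) = (res h).lTensor (TorusRing k) (coact S x)

attribute [instance] EqSheaf.addCommGroup EqSheaf.moduleBase EqSheaf.module EqSheaf.tower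

/-- Equivariant morphisms. -/
@[ext]
structure EqSheaf.Hom (ξ η : EqSheaf k) where
  app : ∀ S, ξ.sec S →ₗ[chartRing k S] η.sec S
  app_res : ∀ {S S' : Idx} (h : S ≤ S') (x : ξ.sec S), app S' (ξ.res h x) = η.res h (app S x)
  app_coact : ∀ (S : Idx) (x : ξ.sec S),
    η.coact S (app S x) = ((app S).restrictScalars k).lTensor (TorusRing k) (ξ.coact S x)

instance : Category (EqSheaf k) where
  Hom := EqSheaf.Hom
  id ξ := ⟨fun _ => LinearMap.id, fun _ _ => rfl, fun S x => by
    have : (LinearMap.id : ξ.sec S →ₗ[chartRing k S] ξ.sec S).restrictScalars k =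
      LinearMap.id := rfl
    rw [this, LinearMap.lTensor_id]; rfl⟩
  comp f g := ⟨fun S => g.app S ∘ₗ f.app S,
    fun h x => by simp [f.app_res, g.app_res],
    fun S x => by
      have : (g.app S ∘ₗ f.app S).restrictScalars k =
        (g.app S).restrictScalars k ∘ₗ (f.app S).restrictScalars k := rfl
      rw [this, LinearMap.lTensor_comp, LinearMap.comp_apply, LinearMap.comp_apply,
        g.app_coact, f.app_coact]⟩

/-- Quasi-coherence: for `U_{S'} ⊆ U_S`, the sections over `U_{S'}` are the localization of the
sections over `U_S` at the functions on `U_S` that are invertible on `U_{S'}`. -/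
def EqSheaf.IsQuasiCoherent (ξ : EqSheaf k) : Prop :=
  ∀ (S S' : Idx) (h : S ≤ S'),
    (∀ x : ξ.sec S, ξ.res h x = 0 → ∃ a : chartRing k S, IsUnit (restr k h a) ∧ a • x = 0) ∧
    (∀ y : ξ.sec S', ∃ (a : chartRing k S) (x : ξ.sec S),
      IsUnit (restr k h a) ∧ restr k h a • y = ξ.res h x)

/-- `T`-equivariant vector bundles: quasi-coherent, with finitely generated projective modules
of sections on the affine opens `U_S`. -/
def isVectorBundle (k : Type u) [Field k] : ObjectProperty (EqSheaf k) := fun ξ =>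
  ξ.IsQuasiCoherent ∧
    ∀ S, Module.Finite (chartRing k S) (ξ.sec S) ∧ Module.Projective (chartRing k S) (ξ.sec S)

/-- `T`-equivariant vector bundles on `P²` and (all) equivariant morphisms. -/
abbrev Fib (k : Type u) [Field k] := (isVectorBundle k).FullSubcategory

/-- The ideal of the coordinate point of the chart `U_i` (the point where `u_j = 0` for `j ≠ i`). -/
def pointIdeal (k : Type u) [Field k] (i : Fin 3) : Ideal (chartRing k (chart i)) :=
  Ideal.span {a | ∃ m : cone (chart i), m ≠ 0 ∧ a = mono m}

/-- The cokernel sheaf of `f` is free at every point of `P²` except possibly at the `i`-th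
coordinate points with `i ∈ Z`. Points of `P²` are primes of the rings of the charts `U_i`; the
only coordinate point in `U_i` is the `i`-th one. -/
def cokerFreeOutside (k : Type u) [Field k] (Z : Set (Fin 3)) : MorphismProperty (Fib k) :=
  fun _ η f => ∀ (i : Fin 3) (x : PrimeSpectrum (chartRing k (chart i))),
    (i ∈ Z → x.asIdeal ≠ pointIdeal k i) →
      Module.Free (Localization.AtPrime x.asIdeal)
        (LocalizedModule x.asIdeal.primeCompl
          (η.obj.sec (chart i) ⧸ LinearMap.range (f.hom.app (chart i))))

/-- `ξ` is the direct sum of finitely many `T`-equivariant line bundles. -/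
def isSumOfLineBundles (k : Type u) [Field k] : ObjectProperty (Fib k) := fun ξ =>
  ∃ (n : ℕ) (L : Fin n → Fib k) (inj : ∀ j, L j ⟶ ξ),
    (∀ j S, Module.Invertible (chartRing k S) ((L j).obj.sec S)) ∧
    ∀ (S : Idx), Function.Bijective
      (fun y : ∀ j, (L j).obj.sec S => ∑ j, (inj j).hom.app S (y j))

/-! ## Degree, slope and semistability along the line `P¹₀ = {u₀ = 0}` -/

/-- `ξ` has rank `r` and degree `d` on `P²`: the determinant of the transition matrix between
bases over `U_i` and `U_j` is a nonzero constant times `(u_j / u_i)^d`, that is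
`det ξ ≅ 𝒪(d)`. -/
def HasRankDegree (ξ : EqSheaf k) (r : ℕ) (d : ℤ) : Prop :=
  ∃ b : ∀ i, Module.Basis (Fin r) (chartRing k (chart i)) (ξ.sec (chart i)),
    ∀ i j, ∃ (P : Matrix (Fin r) (Fin r) (chartRing k (overlap i j))) (c : k), c ≠ 0 ∧
      (∀ t, ξ.res (chart_le_right i j) (b j t) =
        ∑ s, P s t • ξ.res (chart_le_left i j) (b i s)) ∧
      toTorus k _ P.det = AddMonoidAlgebra.single (d • ratio i j) c

/-- The slope `μ = deg / rank` of `ξ` on `P²` is `μ` (with value `0` in rank `0`). -/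
def HasSlope (ξ : EqSheaf k) (μ : ℚ) : Prop :=
  ∃ (r : ℕ) (d : ℤ), HasRankDegree ξ r d ∧ (d : ℚ) / r = μ

/-- The ideal of `P¹₀ ∩ U_S` in `Γ(U_S, 𝒪)` (the unit ideal if `0 ∈ S`). -/
def lineIdeal (k : Type u) [Field k] (S : Idx) : Ideal (chartRing k S) :=
  Ideal.span {a | ∃ m : cone S, 0 < m.1.1 0 ∧ a = mono m}

/-- The ring `Γ(P¹₀ ∩ U_S, 𝒪)`. -/
abbrev lineRing (k : Type u) [Field k] (S : Idx) : Type u := chartRing k S ⧸ lineIdeal k S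

/-- The sections over `P¹₀ ∩ U_S` of the restriction of `ξ` to `P¹₀`. -/
abbrev lineSec (ξ : EqSheaf k) (S : Idx) : Type u :=
  ξ.sec S ⧸ (lineIdeal k S • (⊤ : Submodule (chartRing k S) (ξ.sec S)))

/-- The restriction maps of `ξ` as semilinear maps. -/
def EqSheaf.resSemilinear (ξ : EqSheaf k) {S S' : Idx} (h : S ≤ S') :
    ξ.sec S →ₛₗ[restr k h] ξ.sec S' where
  toFun := ξ.res h
  map_add' := map_add _
  map_smul' := ξ.res_smul h

theorem lineIdeal_le {S S' : Idx} (h : S ≤ S') :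
    lineIdeal k S ≤ (lineIdeal k S').comap (restr k h) := by
  refine Ideal.span_le.2 ?_
  rintro _ ⟨m, hm, rfl⟩
  refine Ideal.subset_span ⟨AddSubmonoid.inclusion (cone_mono h) m, hm, ?_⟩
  simp [restr, mono]

theorem lineIdeal_smul_le (ξ : EqSheaf k) {S S' : Idx} (h : S ≤ S') :
    lineIdeal k S • (⊤ : Submodule (chartRing k S) (ξ.sec S)) ≤
      (lineIdeal k S' • (⊤ : Submodule (chartRing k S') (ξ.sec S'))).comap
        (ξ.resSemilinear h) := by
  refine Submodule.smul_le.2 fun a ha x _ => ?_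
  rw [Submodule.mem_comap, LinearMap.map_smulₛₗ]
  exact Submodule.smul_mem_smul (lineIdeal_le h ha) Submodule.mem_top

/-- The restriction maps of the restriction of `ξ` to `P¹₀`. -/
def lineRes (ξ : EqSheaf k) {S S' : Idx} (h : S ≤ S') :
    lineSec ξ S →ₛₗ[restr k h] lineSec ξ S' :=
  Submodule.mapQ _ _ (ξ.resSemilinear h) (lineIdeal_smul_le ξ h)

/-- The families `N` form a (quasi-)coherent subsheaf of the restriction of `ξ` to `P¹₀`. -/
def IsLineSubsheaf (ξ : EqSheaf k) (N : ∀ S, Submodule (lineRing k S) (lineSec ξ S)) : Prop :=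
  ∀ (S S' : Idx) (h : S ≤ S'),
    N S' = Submodule.span (lineRing k S') (lineRes ξ h '' (N S : Set (lineSec ξ S)))

/-- A subsheaf `N` of the restriction of `ξ` to `P¹₀` has rank `r` and degree `d`: the determinant
of the transition matrix between bases over `P¹₀ ∩ U_1` and `P¹₀ ∩ U_2` is a nonzero constant
times `(u_2 / u_1)^d`, that is `det N ≅ 𝒪(d)`. -/
def LineHasRankDegree (ξ : EqSheaf k) (N : ∀ S, Submodule (lineRing k S) (lineSec ξ S))
    (r : ℕ) (d : ℤ) : Prop :=
  ∃ (b₁ : Module.Basis (Fin r) (lineRing k (chart 1)) (N (chart 1)))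
    (b₂ : Module.Basis (Fin r) (lineRing k (chart 2)) (N (chart 2)))
    (P : Matrix (Fin r) (Fin r) (lineRing k (overlap 1 2)))
    (c : k) (a : chartRing k (overlap 1 2)), c ≠ 0 ∧
      (∀ t, lineRes ξ (chart_le_right 1 2) (b₂ t : lineSec ξ (chart 2)) =
        ∑ s, P s t • lineRes ξ (chart_le_left 1 2) (b₁ s : lineSec ξ (chart 1))) ∧
      toTorus k _ a = AddMonoidAlgebra.single (d • ratio 1 2) c ∧
      P.det = Ideal.Quotient.mk (lineIdeal k (overlap 1 2)) a

/-- `P¹₀`-semistability: nonzero coherent subsheaves of the restriction of `ξ` to `P¹₀` have slope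
at most that of the restriction. -/
def IsLineSemistable (ξ : EqSheaf k) : Prop :=
  ∀ N : ∀ S, Submodule (lineRing k S) (lineSec ξ S), IsLineSubsheaf ξ N →
    ∀ (r r' : ℕ) (d d' : ℤ), 0 < r → LineHasRankDegree ξ N r d →
      LineHasRankDegree ξ (fun _ => ⊤) r' d' → (d : ℚ) / r ≤ (d' : ℚ) / r'

/-- `P¹₀`-semistable of slope `0`. -/
def isSemistableSlopeZero (k : Type u) [Field k] : ObjectProperty (Fib k) := fun ξ =>
  IsLineSemistable ξ.obj ∧ HasSlope ξ.obj 0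

/-! ## The Rees bundle functor -/

/-- `k[T] ⊗ W`, the sections of the trivial bundle with fibre `W` over the open orbit, regarded as a
module over `Γ(U_S, 𝒪)`. -/
def OrbitSec (k : Type u) [Field k] (_S : Idx) (W : Type u) [AddCommGroup W] [Module k W] :
    Type u :=
  TorusRing k ⊗[k] W

section OrbitSec

variable {W : Type u} [AddCommGroup W] [Module k W] {S : Idx}

instance : AddCommGroup (OrbitSec k S W) := inferInstanceAs (AddCommGroup (TorusRing k ⊗[k] W))

instance : Module k (OrbitSec k S W) := inferInstanceAs (Module k (TorusRing k ⊗[k] W))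

instance : Module (TorusRing k) (OrbitSec k S W) :=
  inferInstanceAs (Module (TorusRing k) (TorusRing k ⊗[k] W))

instance : Module (chartRing k S) (OrbitSec k S W) :=
  Module.compHom (OrbitSec k S W) (toTorus k S)

theorem chartRing_smul_def (a : chartRing k S) (x : OrbitSec k S W) :
    a • x = (toTorus k S a • x : OrbitSec k S W) := rfl

instance : IsScalarTower k (TorusRing k) (OrbitSec k S W) :=
  inferInstanceAs (IsScalarTower k (TorusRing k) (TorusRing k ⊗[k] W))

theorem toTorus_smul (c : k) (a : chartRing k S) : toTorus k S (c • a) = c • toTorus k S a := by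
  induction a using AddMonoidAlgebra.induction_linear with
  | zero => simp
  | add f g hf hg => simp [hf, hg]
  | single m c => simp [toTorus]

instance : IsScalarTower k (chartRing k S) (OrbitSec k S W) where
  smul_assoc c a x := by
    rw [chartRing_smul_def, chartRing_smul_def, toTorus_smul, smul_assoc]

end OrbitSec

theorem toTorus_restr {S S' : Idx} (h : S ≤ S') (a : chartRing k S) :
    toTorus k S' (restr k h a) = toTorus k S a := by
  induction a using AddMonoidAlgebra.induction_linear with
  | zero => simp
  | add f g hf hg => simp [hf, hg]
  | single m c => simp [restr, toTorus]

/-- The sections over `U_S` of the Rees bundle of `(V, F₀, F₁, F₂)`: the submodule of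
`k[u₀^±, u₁^±, u₂^±]_0 ⊗ V` generated by the `u^m ⊗ w` with `w ∈ F_i^{-m i}` for all `i ∉ S`. On the
chart `U_l` this is the Rees module of the two filtrations `F_i, F_j` with `{i, j, l} = {0, 1, 2}`. -/
def reesSec (V : MultiFil k) (S : Idx) : Submodule (chartRing k S) (OrbitSec k S V.V) :=
  Submodule.span _ {x | ∃ (m : charLattice) (w : V.V),
    (∀ i ∉ S.1, w ∈ V.F i (-m.1 i)) ∧ x = (chi m ⊗ₜ[k] w : TorusRing k ⊗[k] V.V)}

/-- The inclusion of the sections of the Rees bundle into `k[T] ⊗ V`. -/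
def reesIncl (V : MultiFil k) (S : Idx) : reesSec V S →ₗ[k] TorusRing k ⊗[k] V.V :=
  ((reesSec V S).restrictScalars k).subtype

theorem reesIncl_injective (V : MultiFil k) (S : Idx) : Function.Injective (reesIncl V S) :=
  Subtype.val_injective

theorem reesIncl_smul (V : MultiFil k) (S : Idx) (a : chartRing k S) (x : reesSec V S) :
    reesIncl V S (a • x) = toTorus k S a • reesIncl V S x := rfl

theorem reesSec_mono (V : MultiFil k) {S S' : Idx} (h : S ≤ S')
    (x : TorusRing k ⊗[k] V.V) (hx : x ∈ (reesSec V S : Set (OrbitSec k S V.V))) :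
    x ∈ (reesSec V S' : Set (OrbitSec k S' V.V)) := by
  change (x : OrbitSec k S V.V) ∈ reesSec V S at hx
  change (x : OrbitSec k S' V.V) ∈ reesSec V S'
  induction hx using Submodule.span_induction with
  | mem x hx =>
    obtain ⟨m, w, hw, rfl⟩ := hx
    exact Submodule.subset_span ⟨m, w, fun i hi => hw i fun hS => hi (h hS), rfl⟩
  | zero => exact Submodule.zero_mem _
  | add x y _ _ hx hy => exact Submodule.add_mem _ hx hy
  | smul a x _ hx =>
    have h1 : (toTorus k S' (restr k h a) • x : TorusRing k ⊗[k] V.V) = toTorus k S a • x := by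
      rw [toTorus_restr]
    have h2 : (toTorus k S' (restr k h a) • x : TorusRing k ⊗[k] V.V) ∈
      (reesSec V S' : Set (OrbitSec k S' V.V)) := (reesSec V S').smul_mem (restr k h a) hx
    rw [h1] at h2
    exact h2

/-- Restriction of sections of the Rees bundle: inclusion inside `k[T] ⊗ V`. -/
def reesRes (V : MultiFil k) {S S' : Idx} (h : S ≤ S') : reesSec V S →ₗ[k] reesSec V S' where
  toFun x := ⟨x.1, reesSec_mono V h _ x.2⟩
  map_add' _ _ := rfl
  map_smul' _ _ := rfl

/-- The coaction of `k[T]` on `k[T] ⊗ W`, with `u^m ⊗ w ↦ t^m ⊗ (u^m ⊗ w)`. -/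
def orbitCoact (k : Type u) [Field k] (W : Type u) [AddCommGroup W] [Module k W] :
    TorusRing k ⊗[k] W →ₗ[k] TorusRing k ⊗[k] (TorusRing k ⊗[k] W) :=
  (TensorProduct.assoc k (TorusRing k) (TorusRing k) W).toLinearMap ∘ₗ
    (Coalgebra.comul (R := k) (A := TorusRing k)).rTensor W

theorem orbitCoact_single {W : Type u} [AddCommGroup W] [Module k W] (m : charLattice) (c : k)
    (w : W) : orbitCoact k W (AddMonoidAlgebra.single m c ⊗ₜ w) =
      chi m ⊗ₜ (AddMonoidAlgebra.single m c ⊗ₜ w) := by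
  simp [orbitCoact, chi]

theorem orbit_induction {W : Type u} [AddCommGroup W] [Module k W]
    {p : TorusRing k ⊗[k] W → Prop} (h0 : p 0) (hadd : ∀ x y, p x → p y → p (x + y))
    (h : ∀ (m : charLattice) (c : k) (w : W), p (AddMonoidAlgebra.single m c ⊗ₜ w)) (x) : p x := by
  induction x with
  | zero => exact h0
  | add x y hx hy => exact hadd x y hx hy
  | tmul f w =>
    induction f using AddMonoidAlgebra.induction_linear with
    | zero => simpa using h0
    | add f g hf hg => rw [TensorProduct.add_tmul]; exact hadd _ _ hf hg
    | single m c => exact h m c w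

theorem orbitCoact_chi_smul {W : Type u} [AddCommGroup W] [Module k W] (m : charLattice) (c : k)
    (x : TorusRing k ⊗[k] W) :
    orbitCoact k W ((AddMonoidAlgebra.single m c : TorusRing k) • x) =
      TensorProduct.map (LinearMap.mulLeft k (chi m))
        (Algebra.lsmul k k (TorusRing k ⊗[k] W) (AddMonoidAlgebra.single m c : TorusRing k))
        (orbitCoact k W x) := by
  induction x using orbit_induction with
  | h0 => simp
  | hadd x y hx hy => rw [smul_add, map_add, map_add, map_add, hx, hy]
  | h n d w =>
    rw [TensorProduct.smul_tmul', smul_eq_mul, AddMonoidAlgebra.single_mul_single,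
      orbitCoact_single, orbitCoact_single, TensorProduct.map_tmul]
    simp [chi, AddMonoidAlgebra.single_mul_single, TensorProduct.smul_tmul']

theorem reesIncl_lTensor_injective (V : MultiFil k) (S : Idx) :
    Function.Injective ((reesIncl V S).lTensor (TorusRing k)) :=
  Module.Flat.lTensor_preserves_injective_linearMap _ (reesIncl_injective V S)

theorem orbitCoact_mem (V : MultiFil k) (S : Idx) (x : reesSec V S) :
    orbitCoact k V.V (reesIncl V S x) ∈
      LinearMap.range ((reesIncl V S).lTensor (TorusRing k)) := by
  obtain ⟨x, hx⟩ := x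
  change orbitCoact k V.V x ∈ _
  induction hx using Submodule.span_induction with
  | mem x hx =>
    obtain ⟨m, w, hw, rfl⟩ := hx
    refine ⟨chi m ⊗ₜ ⟨_, Submodule.subset_span ⟨m, w, hw, rfl⟩⟩, ?_⟩
    rw [LinearMap.lTensor_tmul]
    exact (orbitCoact_single m 1 w).symm
  | zero => exact (map_zero (orbitCoact k V.V)).symm ▸ Submodule.zero_mem _
  | add x y _ _ hx hy => exact (map_add (orbitCoact k V.V) x y).symm ▸ Submodule.add_mem _ hx hy
  | smul a x _ hx =>
    induction a using AddMonoidAlgebra.induction_linear with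
    | zero =>
      rw [zero_smul]; exact (map_zero (orbitCoact k V.V)).symm ▸ Submodule.zero_mem _
    | add f g hf hg =>
      rw [add_smul]; exact (map_add (orbitCoact k V.V) _ _).symm ▸ Submodule.add_mem _ hf hg
    | single m c =>
      obtain ⟨y, hy⟩ := hx
      have h1 : toTorus k S (AddMonoidAlgebra.single m c) = AddMonoidAlgebra.single m.1 c := by
        simp [toTorus]
      rw [chartRing_smul_def, h1]
      refine ⟨TensorProduct.map (LinearMap.mulLeft k (chi m.1))
        (Algebra.lsmul k k (reesSec V S) (AddMonoidAlgebra.single m c : chartRing k S)) y, ?_⟩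
      refine Eq.trans ?_ (orbitCoact_chi_smul m.1 c x).symm
      rw [← hy]
      simp only [LinearMap.lTensor, ← LinearMap.comp_apply, ← TensorProduct.map_comp]
      congr 2
      ext z
      change reesIncl V S ((AddMonoidAlgebra.single m c : chartRing k S) • z) = _
      rw [reesIncl_smul, h1]
      rfl

/-- The coaction on the sections of the Rees bundle, induced by the one on `k[T] ⊗ V`. -/
def reesCoact (V : MultiFil k) (S : Idx) : reesSec V S →ₗ[k] TorusRing k ⊗[k] reesSec V S :=
  (LinearEquiv.ofInjective _ (reesIncl_lTensor_injective V S)).symm.toLinearMap ∘ₗ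
    (orbitCoact k V.V ∘ₗ reesIncl V S).codRestrict _ (orbitCoact_mem V S)

theorem reesCoact_spec (V : MultiFil k) (S : Idx) (x : reesSec V S) :
    (reesIncl V S).lTensor (TorusRing k) (reesCoact V S x) =
      orbitCoact k V.V (reesIncl V S x) := by
  have := LinearEquiv.apply_symm_apply
    (LinearEquiv.ofInjective _ (reesIncl_lTensor_injective V S))
    ((orbitCoact k V.V ∘ₗ reesIncl V S).codRestrict _ (orbitCoact_mem V S) x)
  exact congrArg Subtype.val this

theorem toTorus_mono {S : Idx} (m : cone S) :
    toTorus k S (mono m) = AddMonoidAlgebra.single m.1 1 := by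
  simp [toTorus, mono]

theorem reesRes_smul (V : MultiFil k) {S S' : Idx} (h : S ≤ S') (a : chartRing k S)
    (x : reesSec V S) : reesRes V h (a • x) = restr k h a • reesRes V h x := by
  apply reesIncl_injective
  rw [reesIncl_smul, toTorus_restr]
  rfl

theorem reesCoact_smul (V : MultiFil k) (S : Idx) (m : cone S) (x : reesSec V S) :
    reesCoact V S (mono (k := k) m • x) =
      TensorProduct.map (LinearMap.mulLeft k (chi m.1))
        (Algebra.lsmul k k (reesSec V S) (mono (k := k) m)) (reesCoact V S x) := by
  apply reesIncl_lTensor_injective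
  rw [reesCoact_spec, reesIncl_smul, toTorus_mono, orbitCoact_chi_smul, ← reesCoact_spec]
  generalize reesCoact V S x = y
  induction y with
  | zero => simp only [map_zero]
  | add x y hx hy => simp only [map_add, hx, hy]
  | tmul f w =>
    simp only [LinearMap.lTensor_tmul, TensorProduct.map_tmul, Algebra.lsmul_coe,
      reesIncl_smul, toTorus_mono]

theorem reesCoact_counit (V : MultiFil k) (S : Idx) (x : reesSec V S) :
    (Coalgebra.counit (R := k) (A := TorusRing k)).rTensor (reesSec V S) (reesCoact V S x) =
      1 ⊗ₜ[k] x := by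
  apply Module.Flat.lTensor_preserves_injective_linearMap (M := k) _ (reesIncl_injective V S)
  rw [← LinearMap.comp_apply, LinearMap.lTensor_comp_rTensor, ← LinearMap.rTensor_comp_lTensor,
    LinearMap.comp_apply, reesCoact_spec, LinearMap.lTensor_tmul]
  generalize reesIncl V S x = y
  induction y using orbit_induction with
  | h0 => simp
  | hadd x y hx hy => rw [map_add, map_add, hx, hy, TensorProduct.tmul_add]
  | h m c w => simp [orbitCoact_single, chi]

theorem reesCoact_coassoc (V : MultiFil k) (S : Idx) (x : reesSec V S) :
    TensorProduct.assoc k (TorusRing k) (TorusRing k) (reesSec V S)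
      ((Coalgebra.comul (R := k) (A := TorusRing k)).rTensor (reesSec V S) (reesCoact V S x)) =
    (reesCoact V S).lTensor (TorusRing k) (reesCoact V S x) := by
  apply Module.Flat.lTensor_preserves_injective_linearMap (M := TorusRing k) _
    (reesIncl_lTensor_injective V S)
  have h1 : ∀ z : TorusRing k ⊗[k] reesSec V S,
      ((reesIncl V S).lTensor (TorusRing k)).lTensor (TorusRing k)
        (TensorProduct.assoc k (TorusRing k) (TorusRing k) (reesSec V S)
          ((Coalgebra.comul (R := k) (A := TorusRing k)).rTensor (reesSec V S) z)) =
      orbitCoact k (TorusRing k ⊗[k] V.V) ((reesIncl V S).lTensor (TorusRing k) z) := by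
    intro z
    induction z using orbit_induction with
    | h0 => simp
    | hadd x y hx hy => simp only [map_add, hx, hy]
    | h m c w => simp [orbitCoact]
  have h2 : ∀ z : TorusRing k ⊗[k] reesSec V S,
      ((reesIncl V S).lTensor (TorusRing k)).lTensor (TorusRing k)
        ((reesCoact V S).lTensor (TorusRing k) z) =
      (orbitCoact k V.V).lTensor (TorusRing k) ((reesIncl V S).lTensor (TorusRing k) z) := by
    intro z
    rw [← LinearMap.lTensor_comp_apply, ← LinearMap.lTensor_comp_apply]
    congr 2
    ext y
    exact reesCoact_spec V S y
  rw [h1, h2, reesCoact_spec]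
  generalize reesIncl V S x = y
  induction y using orbit_induction with
  | h0 => simp
  | hadd x y hx hy => simp only [map_add, hx, hy]
  | h m c w =>
    rw [orbitCoact_single, LinearMap.lTensor_tmul, orbitCoact_single]
    exact orbitCoact_single m 1 _

theorem reesCoact_res (V : MultiFil k) {S S' : Idx} (h : S ≤ S') (x : reesSec V S) :
    reesCoact V S' (reesRes V h x) = (reesRes V h).lTensor (TorusRing k) (reesCoact V S x) := by
  apply reesIncl_lTensor_injective
  rw [reesCoact_spec, ← LinearMap.lTensor_comp_apply]
  exact (reesCoact_spec V S x).symm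

/-- The Rees bundle of `(V, F₀, F₁, F₂)` on `P²`. -/
def reesObj (V : MultiFil k) : EqSheaf k where
  sec S := reesSec V S
  res h := reesRes V h
  res_smul := reesRes_smul V
  res_refl _ _ := rfl
  res_trans _ _ _ := rfl
  coact S := reesCoact V S
  coact_smul := reesCoact_smul V
  counit_coact := reesCoact_counit V
  coassoc := reesCoact_coassoc V
  coact_res := reesCoact_res V

theorem lTensor_torus_smul {V W : Type u} [AddCommGroup V] [Module k V] [AddCommGroup W]
    [Module k W] (f : V →ₗ[k] W) (a : TorusRing k) (x : TorusRing k ⊗[k] V) :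
    f.lTensor (TorusRing k) (a • x) = a • f.lTensor (TorusRing k) x :=
  map_smul (TensorProduct.AlgebraTensorModule.map
    (LinearMap.id : TorusRing k →ₗ[TorusRing k] TorusRing k) f) a x

theorem reesSec_map {V W : MultiFil k} (f : V ⟶ W) (S : Idx) (x : TorusRing k ⊗[k] V.V)
    (hx : x ∈ (reesSec V S : Set (OrbitSec k S V.V))) :
    f.lin.lTensor (TorusRing k) x ∈ (reesSec W S : Set (OrbitSec k S W.V)) := by
  change (x : OrbitSec k S V.V) ∈ reesSec V S at hx
  induction hx using Submodule.span_induction with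
  | mem x hx =>
    obtain ⟨m, w, hw, rfl⟩ := hx
    rw [LinearMap.lTensor_tmul]
    exact Submodule.subset_span (M := OrbitSec k S W.V) ⟨m, f.lin w,
      fun i hi => f.map_le i _ (Submodule.mem_map_of_mem (hw i hi)), rfl⟩
  | zero => rw [map_zero]; exact Submodule.zero_mem (reesSec W S)
  | add x y _ _ hx hy => rw [map_add]; exact Submodule.add_mem (reesSec W S) hx hy
  | smul a x _ hx =>
    have h2 : (toTorus k S a • f.lin.lTensor (TorusRing k) x : TorusRing k ⊗[k] W.V) ∈
      (reesSec W S : Set (OrbitSec k S W.V)) :=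
      @Submodule.smul_mem (chartRing k S) (OrbitSec k S W.V) _ _ _ (reesSec W S) _ a hx
    rw [← lTensor_torus_smul] at h2
    exact h2

/-- The map induced by `u^m ⊗ w ↦ u^m ⊗ f w` on sections of Rees bundles. -/
def reesMap {V W : MultiFil k} (f : V ⟶ W) (S : Idx) :
    reesSec V S →ₗ[chartRing k S] reesSec W S where
  toFun x := ⟨f.lin.lTensor (TorusRing k) x.1, reesSec_map f S _ x.2⟩
  map_add' _ _ := Subtype.ext (map_add (f.lin.lTensor (TorusRing k)) _ _)
  map_smul' _ _ := Subtype.ext (lTensor_torus_smul f.lin _ _)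

theorem reesMap_coact {V W : MultiFil k} (f : V ⟶ W) (S : Idx) (x : reesSec V S) :
    reesCoact W S (reesMap f S x) =
      ((reesMap f S).restrictScalars k).lTensor (TorusRing k) (reesCoact V S x) := by
  apply reesIncl_lTensor_injective
  rw [reesCoact_spec, ← LinearMap.lTensor_comp_apply]
  have h1 : ∀ y, orbitCoact k W.V (f.lin.lTensor (TorusRing k) y) =
      (f.lin.lTensor (TorusRing k)).lTensor (TorusRing k) (orbitCoact k V.V y) := by
    intro y
    induction y using orbit_induction with
    | h0 => simp
    | hadd x y hx hy => simp only [map_add, hx, hy]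
    | h m c w => simp [orbitCoact_single]
  refine (h1 (reesIncl V S x)).trans ?_
  rw [← reesCoact_spec, ← LinearMap.lTensor_comp_apply]
  rfl

/-- The Rees bundle functor `Φ_R`. -/
def reesFunctor (k : Type u) [Field k] : MultiFil k ⥤ EqSheaf k where
  obj := reesObj
  map f :=
    { app := reesMap f
      app_res := fun _ _ => rfl
      app_coact := reesMap_coact f }
  map_id V := by
    refine EqSheaf.Hom.ext (funext fun S => LinearMap.ext fun x => Subtype.ext ?_)
    exact LinearMap.congr_fun (LinearMap.lTensor_id (TorusRing k) V.V) x.1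
  map_comp f g := by
    refine EqSheaf.Hom.ext (funext fun S => LinearMap.ext fun x => Subtype.ext ?_)
    exact LinearMap.congr_fun (LinearMap.lTensor_comp (TorusRing k) g.lin f.lin) x.1

/-! ## The inverse construction -/

/-- The ideal of the point `(1:1:1)` in the ring of functions on the open orbit. -/
def unitIdeal (k : Type u) [Field k] : Ideal (chartRing k orbit) :=
  Ideal.span {a | ∃ m : cone orbit, a = mono m - 1}

/-- The fibre of `ξ` at `(1:1:1)`. -/
def unitFibre (ξ : EqSheaf k) : Type u :=
  ξ.sec orbit ⧸ (unitIdeal k • (⊤ : Submodule (chartRing k orbit) (ξ.sec orbit)))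

instance (ξ : EqSheaf k) : AddCommGroup (unitFibre ξ) :=
  inferInstanceAs (AddCommGroup
    (ξ.sec orbit ⧸ (unitIdeal k • (⊤ : Submodule (chartRing k orbit) (ξ.sec orbit)))))

instance (ξ : EqSheaf k) : Module k (unitFibre ξ) :=
  inferInstanceAs (Module k
    (ξ.sec orbit ⧸ (unitIdeal k • (⊤ : Submodule (chartRing k orbit) (ξ.sec orbit)))))

/-- Evaluation at `(1:1:1)` of sections over the open orbit. -/
def unitEval (ξ : EqSheaf k) : ξ.sec orbit →ₗ[k] unitFibre ξ :=
  (Submodule.mkQ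
    (unitIdeal k • (⊤ : Submodule (chartRing k orbit) (ξ.sec orbit)))).restrictScalars k

/-- The `T`-invariant sections `x` over the open orbit with a pole of order at most `p` along
`{u_i = 0}`: `u^m x` extends to `⋂_{j ≠ i} U_j` whenever `m i = -p`. -/
def poleSec (ξ : EqSheaf k) (i : Fin 3) (p : ℤ) : Submodule k (ξ.sec orbit) where
  carrier := {x | ξ.coact orbit x = 1 ⊗ₜ x ∧ ∀ m : cone orbit, m.1.1 i = -p →
    mono (k := k) m • x ∈ LinearMap.range (ξ.res (le_orbit (awayFrom i)))}
  zero_mem' := ⟨by simp, fun m _ => by simp⟩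
  add_mem' := by
    rintro x y ⟨hx, hx'⟩ ⟨hy, hy'⟩
    refine ⟨by rw [map_add, hx, hy, TensorProduct.tmul_add], fun m hm => ?_⟩
    rw [smul_add]
    exact Submodule.add_mem _ (hx' m hm) (hy' m hm)
  smul_mem' := by
    rintro c x ⟨hx, hx'⟩
    refine ⟨by rw [map_smul, hx, TensorProduct.tmul_smul], fun m hm => ?_⟩
    rw [smul_comm]
    exact Submodule.smul_mem _ c (hx' m hm)

/-- The map on fibres at `(1:1:1)` induced by an equivariant morphism. -/
def unitMap {ξ η : EqSheaf k} (f : ξ ⟶ η) : unitFibre ξ →ₗ[k] unitFibre η :=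
  (Submodule.mapQ (unitIdeal k • (⊤ : Submodule (chartRing k orbit) (ξ.sec orbit)))
    (unitIdeal k • (⊤ : Submodule (chartRing k orbit) (η.sec orbit))) (f.app orbit) (by
      refine Submodule.smul_le.2 fun a ha x _ => ?_
      rw [Submodule.mem_comap, map_smul]
      exact Submodule.smul_mem_smul ha Submodule.mem_top)).restrictScalars k

theorem unitMap_unitEval {ξ η : EqSheaf k} (f : ξ ⟶ η) (x : ξ.sec orbit) :
    unitMap f (unitEval ξ x) = unitEval η (f.app orbit x) := rfl

theorem unitEval_surjective (ξ : EqSheaf k) : Function.Surjective (unitEval ξ) :=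
  fun y => Submodule.Quotient.mk_surjective
    (unitIdeal k • (⊤ : Submodule (chartRing k orbit) (ξ.sec orbit))) y

theorem poleSec_map {ξ η : EqSheaf k} (f : ξ ⟶ η) (i : Fin 3) (p : ℤ) (x : ξ.sec orbit)
    (hx : x ∈ poleSec ξ i p) : f.app orbit x ∈ poleSec η i p := by
  refine ⟨?_, fun m hm => ?_⟩
  · rw [f.app_coact, hx.1, LinearMap.lTensor_tmul]
    rfl
  · obtain ⟨y, hy⟩ := hx.2 m hm
    refine ⟨f.app _ y, ?_⟩
    rw [← f.app_res, hy, map_smul]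

/-- The fibre at `(1:1:1)` with its three filtrations: `v ∈ F_i^p` when the `T`-invariant section
`x` through `v` is such that `u^m x`, `m i = -p`, is regular along `{u_i = 0}`. -/
def fibreObj (ξ : EqSheaf k) : MultiFil k where
  V := unitFibre ξ
  F i p := (poleSec ξ i p).map (unitEval ξ)

/-- The map of filtered spaces induced on fibres at `(1:1:1)`. -/
def fibreMap {ξ η : EqSheaf k} (f : ξ ⟶ η) : fibreObj ξ ⟶ fibreObj η :=
  MultiFil.Hom.mk (V := fibreObj ξ) (W := fibreObj η) (unitMap f) (by
    rintro i p _ ⟨_, ⟨x, hx, rfl⟩, rfl⟩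
    exact ⟨f.app orbit x, poleSec_map f i p x hx, (unitMap_unitEval f x).symm⟩)

theorem unitMap_id (ξ : EqSheaf k) : unitMap (𝟙 ξ) = LinearMap.id := by
  refine LinearMap.ext fun y => ?_
  obtain ⟨x, rfl⟩ := unitEval_surjective ξ y
  exact unitMap_unitEval (𝟙 ξ) x

theorem unitMap_comp {ξ η ζ : EqSheaf k} (f : ξ ⟶ η) (g : η ⟶ ζ) :
    unitMap (f ≫ g) = unitMap g ∘ₗ unitMap f := by
  refine LinearMap.ext fun y => ?_
  obtain ⟨x, rfl⟩ := unitEval_surjective ξ y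
  rw [LinearMap.comp_apply, unitMap_unitEval, unitMap_unitEval, unitMap_unitEval]
  rfl

/-- The functor `Φ_I`. -/
def fibreFunctor (k : Type u) [Field k] : EqSheaf k ⥤ MultiFil k where
  obj := fibreObj
  map := fibreMap
  map_id ξ := MultiFil.Hom.ext (unitMap_id ξ)
  map_comp f g := MultiFil.Hom.ext (unitMap_comp f g)

/-! ## Equivalences between classes of objects and morphisms -/

/-- The equivalence `e` restricts to an equivalence between the objects of `C` in `P` with the
morphisms in `W`, and the objects of `D` in `Q` with the morphisms in `W'`: both functors preserve
the objects, they induce bijections between the morphisms in `W` and in `W'`, and the unit and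
counit isomorphisms consist of morphisms in `W` and `W'`. (Closure of `W` and `W'` under
composition is not part of this notion.) -/
structure RestrictsToEquivalence {C D : Type*} [Category C] [Category D] (e : C ≌ D)
    (P : ObjectProperty C) (W : MorphismProperty C) (Q : ObjectProperty D)
    (W' : MorphismProperty D) : Prop where
  obj : ∀ X, P X → Q (e.functor.obj X)
  inv_obj : ∀ Y, Q Y → P (e.inverse.obj Y)
  map : ∀ {X X'} (f : X ⟶ X'), P X → P X' → (W' (e.functor.map f) ↔ W f)
  inv_map : ∀ {Y Y'} (g : Y ⟶ Y'), Q Y → Q Y' → (W (e.inverse.map g) ↔ W' g)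
  unit : ∀ X, P X → W (e.unitIso.hom.app X) ∧ W (e.unitIso.inv.app X)
  counit : ∀ Y, Q Y → W' (e.counitIso.hom.app Y) ∧ W' (e.counitIso.inv.app Y)

end TriRees

end

/-! The torus action turns sheaves into graded objects. The coaction splits sections into weights,
monomials shift weights, and over the open orbit multiplying by a suitable monomial makes a
homogeneous section invariant; invariant sections are the same as vectors of the fibre at (1:1:1). A
homogeneous section over `U_S` is thus a vector of the fibre together with an exponent. For a vector
bundle, the pairs that occur are decided one divisor at a time, because a section extending across
each u_i = 0, i ∉ S, extends to `U_S` (`mem_range_res`). This says exactly that the canonical map to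
the Rees bundle of the fibre is bijective (`toReesApp_bijective`). Conversely a chart involves only
two filtrations, two filtrations have a common adapted basis, and such a basis gives a monomial
basis of the Rees module (`reesBasis`), so Rees bundles are vector bundles; `toFibre_bijective` and
`mem_of_toFibre_mem` recover the triple.

For (a), a failure of strictness for F_i is a nonzero torsion class of the cokernel at the generic
point of u_i = 0 (`strict_of_free_coker`). Conversely, at a point of a chart other than its
coordinate point one of the two coordinates is invertible, so one filtration becomes irrelevant, and
strictness for the other one gives a basis of the cokernel (`free_coker_of_strict`). For (b), a
basis adapted to all three filtrations decomposes the bundle into rank one pieces; in the other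
direction the equivalence turns line bundles into one-dimensional triples, whose filtrations jump
once.

For (c), `exists_adapted` supplies a basis e adapted to F_0 and F_1 and a basis e' adapted to F_0
and F_2 with the same classes in Gr_{F_0}. If a_s, b_s, c_s are the degrees, the restriction of the
Rees bundle to the line u_0 = 0 is the sum of the O(a_s + b_s + c_s) (`lineRes_basisTwo`).
Opposedness means that all these sums vanish (`opposed_iff_degree`), and so does semistability of
slope 0 (`isSemistableSlopeZero_iff`).

For morphisms in (c), an opposed triple has a bigrading built from sums and intersections of
filtration steps, as for mixed Hodge structures. It splits F_0 and F_2 (`inf_eq_iSup_bigrading`,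
`bigrading_sum_eq_zero`) and is preserved by every compatible map. Images are therefore graded,
every compatible map is strict for intersections of two filtrations (`OppositePair.bistrict`), and
the cokernel is free on all of U_1 and U_2. Both classes of morphisms in (c) thus consist of all
morphisms between the objects concerned, whence closure under composition. -/

noncomputable section

namespace TriRees

variable {k : Type u} [Field k]

/-! ## Bases adapted to filtrations -/

section Adapted

variable {V : Type u} [AddCommGroup V] [Module k V] {ι : Type*}

/-- The basis `e` splits the filtration `F`, with `e s` in degree `a s`. -/
def Adapted (e : Module.Basis ι k V) (F : ℤ → Submodule k V) (a : ι → ℤ) : Prop :=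
  ∀ p w, w ∈ F p ↔ ∀ s, e.repr w s ≠ 0 → p ≤ a s

theorem Adapted.mem_self {e : Module.Basis ι k V} {F : ℤ → Submodule k V} {a : ι → ℤ}
    (h : Adapted e F a) (s : ι) : e s ∈ F (a s) := by
  classical
  refine (h _ _).2 fun t ht => ?_
  rw [e.repr_self, Finsupp.single_apply] at ht
  split_ifs at ht with hst
  · exact hst ▸ le_rfl
  · exact absurd rfl ht

theorem Adapted.repr_eq_zero {e : Module.Basis ι k V} {F : ℤ → Submodule k V} {a : ι → ℤ}
    (h : Adapted e F a) {p : ℤ} {w : V} (hw : w ∈ F p) {s : ι} (hs : a s < p) :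
    e.repr w s = 0 := by
  by_contra h0
  exact absurd ((h p w).1 hw s h0) (not_le.2 hs)

theorem Adapted.antitone {e : Module.Basis ι k V} {F : ℤ → Submodule k V} {a : ι → ℤ}
    (h : Adapted e F a) : Antitone F := fun _ _ hpq w hw =>
  (h _ w).2 fun s hs => hpq.trans ((h _ w).1 hw s hs)

theorem Adapted.mem_of_le {e : Module.Basis ι k V} {F : ℤ → Submodule k V} {a : ι → ℤ}
    (h : Adapted e F a) {s : ι} {p : ℤ} (hp : p ≤ a s) : e s ∈ F p :=
  h.antitone hp (h.mem_self s)

/-- Two bases adapted to the same filtration have the same total degree. -/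
theorem Adapted.sum_eq [Fintype ι] {e e' : Module.Basis ι k V}
    {F : ℤ → Submodule k V} {a b : ι → ℤ}
    (h : Adapted e F a) (h' : Adapted e' F b) : ∑ s, a s = ∑ s, b s := by
  classical
  -- The dimension of a step counts the basis vectors of degree at least `p`, whichever adapted
  -- basis is used.
  have key : ∀ {κ : Type _} [Fintype κ] (c : Module.Basis κ k V) (d : κ → ℤ), Adapted c F d →
      ∀ p, Module.finrank k (F p) = (Finset.univ.filter fun s => p ≤ d s).card := by
    intro κ _ c d hc p
    have : F p = Submodule.span k (Set.range fun s : {s // p ≤ d s} => c s) := by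
      have h1 : (Set.range fun s : {s // p ≤ d s} => c s) = c '' {s | p ≤ d s} := by
        ext x; simp
      ext w
      rw [h1, c.mem_span_image, hc p w]
      simp [Set.subset_def]
    rw [this, finrank_span_eq_card, Fintype.card_subtype]
    exact c.linearIndependent.comp _ Subtype.val_injective
  -- Not only the sums but the multisets of degrees agree: the multiplicity of `p` is dim F^p - dim
  -- F^{p+1}.
  have hcount : Multiset.map a Finset.univ.val = Multiset.map b Finset.univ.val := by
    refine Multiset.ext.2 fun p => ?_
    have aux : ∀ {κ : Type _} [Fintype κ] (d : κ → ℤ),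
        Multiset.count p (Multiset.map d Finset.univ.val) +
          (Finset.univ.filter fun s => p + 1 ≤ d s).card =
          (Finset.univ.filter fun s => p ≤ d s).card := by
      intro κ _ d
      rw [Multiset.count_map, ← Finset.filter_val, Finset.card_val,
        ← Finset.card_union_of_disjoint]
      · congr 1
        ext s
        simp only [Finset.mem_union, Finset.mem_filter, Finset.mem_univ, true_and]
        omega
      · rw [Finset.disjoint_filter]
        intro s _ h1
        omega
    have h1 := aux a
    have h2 := aux b
    rw [← key e a h, ← key e a h] at h1
    rw [← key e' b h', ← key e' b h'] at h2
    omega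
  exact congrArg Multiset.sum hcount

/-- Extending an adapted basis of a hyperplane. -/
theorem Adapted.cons {n : ℕ} {H : Submodule k V} {v : V} {e : Module.Basis (Fin n) k H}
    {F : ℤ → Submodule k V} {a : Fin n → ℤ}
    (h : Adapted e (fun p => (F p).submoduleOf H) a)
    {hli : ∀ (c : k), ∀ x ∈ H, c • v + x = 0 → c = 0} {hsp : ∀ z : V, ∃ c : k, z + c • v ∈ H}
    {c : ℤ} (h1 : ∀ p ≤ c, v ∈ F p) (h2 : ∀ p, c < p → F p ≤ H) :
    Adapted (Module.Basis.mkFinCons v e hli hsp) F (Fin.cons c a) := by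
  intro p w
  obtain ⟨d, x, rfl⟩ : ∃ (d : k) (x : H), w = d • v + x := by
    obtain ⟨d, hd⟩ := hsp w
    exact ⟨-d, ⟨_, hd⟩, by simp⟩
  have hr : ∀ s, (Module.Basis.mkFinCons v e hli hsp).repr (d • v + x) s =
      (Fin.cons d (e.repr x) : Fin (n + 1) → k) s := by
    intro s
    have hx : d • v + (x : V) = ∑ s, (Fin.cons d (e.repr x) : Fin (n + 1) → k) s •
        Module.Basis.mkFinCons v e hli hsp s := by
      rw [Fin.sum_univ_succ]
      simp only [Module.Basis.coe_mkFinCons, Fin.cons_zero, Fin.cons_succ, Function.comp]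
      conv_lhs => rw [← e.sum_repr x]
      simp only [Submodule.coe_sum, Submodule.coe_smul]
    rw [hx, Module.Basis.repr_sum_self]
  simp only [hr, Fin.forall_fin_succ, Fin.cons_zero, Fin.cons_succ]
  have hH : (x : V) ∈ F p ↔ ∀ s, e.repr x s ≠ 0 → p ≤ a s := by
    exact h p x
  rw [← hH]
  by_cases hp : p ≤ c
  · simp only [hp, implies_true, true_and]
    exact Submodule.add_mem_iff_right _ (Submodule.smul_mem _ _ (h1 p hp))
  · simp only [hp, imp_false, not_not]
    constructor
    · intro hw
      -- Beyond degree `c` the step is contained in the hyperplane, so `v` cannot contribute.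
      have hd : d = 0 := by
        have h3 := h2 p (not_le.1 hp) hw
        refine hli d (- (d • v)) ?_ (by simp)
        exact H.neg_mem ((Submodule.add_mem_iff_left _ x.2).1 h3)
      subst hd
      simpa using hw
    · rintro ⟨rfl, hx⟩
      simpa using hx

theorem exists_greatest {P : ℤ → Prop} (h1 : ∃ p, P p) (h2 : ∃ q, ¬ P q)
    (hP : ∀ p q, p ≤ q → P q → P p) : ∃ p, P p ∧ ¬ P (p + 1) := by
  obtain ⟨q, hq⟩ := h2
  obtain ⟨m, hm, hmax⟩ := Int.exists_greatest_of_bdd (P := P)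
    ⟨q, fun z hz => by by_contra h; exact hq (hP _ _ (by omega) hz)⟩ h1
  exact ⟨m, hm, fun h => by have := hmax _ h; omega⟩

/-- Given three filtrations, there are a basis `e` splitting `F` and `G` and a basis `e'` splitting
`F` and `H` which agree on the graded space of `F`. -/
theorem exists_adapted (n : ℕ) : ∀ {V : Type u} [AddCommGroup V] [Module k V]
    [FiniteDimensional k V] (_ : Module.finrank k V = n) (F G H : ℤ → Submodule k V)
    (_ : Antitone F ∧ (∃ p, F p = ⊥) ∧ ∃ q, F q = ⊤)
    (_ : Antitone G ∧ (∃ p, G p = ⊥) ∧ ∃ q, G q = ⊤)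
    (_ : Antitone H ∧ (∃ p, H p = ⊥) ∧ ∃ q, H q = ⊤),
    ∃ (e e' : Module.Basis (Fin n) k V) (a b c : Fin n → ℤ),
      Adapted e F a ∧ Adapted e G b ∧ Adapted e' F a ∧ Adapted e' H c ∧
      ∀ s, e s - e' s ∈ F (a s + 1) := by
  induction n with
  | zero =>
    intro V _ _ _ hV F G H _ _ _
    have : Subsingleton V := Module.finrank_zero_iff.1 hV
    have hA : ∀ F : ℤ → Submodule k V,
        Adapted (Module.Basis.empty V : Module.Basis (Fin 0) k V) F (fun _ => 0) := by
      intro F p w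
      simp [Subsingleton.elim w 0]
    exact ⟨Module.Basis.empty V, Module.Basis.empty V, fun _ => 0, fun _ => 0, fun _ => 0,
      hA F, hA G, hA F, hA H, fun s => s.elim0⟩
  | succ n ih =>
    intro V _ _ _ hV F G H hF hG hH
    have hbt : (⊥ : Submodule k V) ≠ ⊤ := by
      have : Nontrivial V := Module.finrank_pos_iff.1 (by omega : 0 < Module.finrank k V)
      exact bot_ne_top
    -- The indices `c`, `p`, `q` are the last ones at which F^c, then F^{c+1} + G^p, then F^{c+1} +
    -- G^{p+1} + H^q is the whole space. They will be the degrees of the vectors that are split off.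
    obtain ⟨c, hc, hc'⟩ := exists_greatest (P := fun p => F p = ⊤) hF.2.2
      (hF.2.1.imp fun p hp => by rw [hp]; exact hbt)
      (fun p q hpq hq => top_le_iff.1 (hq ▸ hF.1 hpq))
    obtain ⟨p, hp, hp'⟩ := exists_greatest (P := fun p => F (c + 1) ⊔ G p = ⊤)
      (hG.2.2.imp fun p hp => by rw [hp, sup_top_eq])
      (hG.2.1.imp fun p hp => by rw [hp, sup_bot_eq]; exact hc')
      (fun p q hpq hq => top_le_iff.1 (hq ▸ sup_le_sup_left (hG.1 hpq) _))
    obtain ⟨q, hq, hq'⟩ := exists_greatest (P := fun q => F (c + 1) ⊔ G (p + 1) ⊔ H q = ⊤)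
      (hH.2.2.imp fun p hp => by rw [hp, sup_top_eq])
      (hH.2.1.imp fun q hq => by rw [hq, sup_bot_eq]; exact hp')
      (fun p q hpq hq => top_le_iff.1 (hq ▸ sup_le_sup_left (hH.1 hpq) _))
    -- The hyperplane of the induction: it contains the next step of all three filtrations, as
    -- `Adapted.cons` requires.
    obtain ⟨f, hf0, hf⟩ := Submodule.exists_le_ker_of_lt_top _ (lt_top_iff_ne_top.2 hq')
    have hfF : F (c + 1) ≤ LinearMap.ker f := (le_sup_left.trans le_sup_left).trans hf
    have hfG : G (p + 1) ≤ LinearMap.ker f := (le_sup_right.trans le_sup_left).trans hf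
    have hfH : H (q + 1) ≤ LinearMap.ker f := le_sup_right.trans hf
    obtain ⟨v', hv', hfv'⟩ : ∃ v' ∈ H q, f v' ≠ 0 := by
      by_contra! hcon
      refine hf0 (LinearMap.ker_eq_top.1 (top_le_iff.1 (hq ▸ sup_le (sup_le hfF hfG) ?_)))
      exact fun x hx => hcon x hx
    -- The vector `v` for G and the vector `v'` for H differ by `z` in F^{c+1}. Hence they have the
    -- same class in Gr_F^c and, since `f` kills `z`, both lie off the hyperplane.
    obtain ⟨z, hz, v, hv, hzv⟩ := Submodule.mem_sup.1
      (hp ▸ Submodule.mem_top : v' ∈ F (c + 1) ⊔ G p)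
    have hfv : f v ≠ 0 := by
      rw [← hzv, map_add, LinearMap.mem_ker.1 (hfF hz), zero_add] at hfv'
      exact hfv'
    have hfin : Module.finrank k (LinearMap.ker f) = n := by
      have h1 := f.finrank_range_add_finrank_ker
      have h2 : LinearMap.range f = ⊤ := LinearMap.range_eq_top.2
        (LinearMap.surjective (by rintro rfl; exact hf0 rfl))
      rw [h2, finrank_top, Module.finrank_self] at h1
      omega
    have hres : ∀ F : ℤ → Submodule k V, (Antitone F ∧ (∃ p, F p = ⊥) ∧ ∃ q, F q = ⊤) →
        (Antitone (fun p => (F p).submoduleOf (LinearMap.ker f)) ∧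
          (∃ p, (F p).submoduleOf (LinearMap.ker f) = ⊥) ∧
          ∃ q, (F q).submoduleOf (LinearMap.ker f) = ⊤) := by
      rintro F ⟨h1, ⟨p, hp⟩, ⟨q, hq⟩⟩
      refine ⟨fun a b hab => Submodule.comap_mono (h1 hab), ⟨p, ?_⟩, ⟨q, ?_⟩⟩
      · rw [hp, Submodule.submoduleOf, Submodule.comap_bot, Submodule.ker_subtype]
      · rw [hq, Submodule.submoduleOf, Submodule.comap_top]
    obtain ⟨e, e', a, b, d, h1, h2, h3, h4, h5⟩ :=
      ih hfin _ _ _ (hres F hF) (hres G hG) (hres H hH)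
    have hli : ∀ v, f v ≠ 0 → ∀ (c : k), ∀ x ∈ LinearMap.ker f, c • v + x = 0 → c = 0 := by
      intro v hv c x hx h
      have := congrArg f h
      rw [map_add, LinearMap.mem_ker.1 hx, map_smul, add_zero, map_zero, smul_eq_mul] at this
      exact (mul_eq_zero.1 this).resolve_right hv
    have hsp : ∀ v, f v ≠ 0 → ∀ z : V, ∃ c : k, z + c • v ∈ LinearMap.ker f := by
      intro v hv z
      refine ⟨-(f z / f v), ?_⟩
      rw [LinearMap.mem_ker, map_add, map_smul, smul_eq_mul, neg_mul, div_mul_cancel₀ _ hv,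
        add_neg_cancel]
    have hFc : ∀ p ≤ c, F p = ⊤ := fun p hp => top_le_iff.1 (hc ▸ hF.1 hp)
    refine ⟨Module.Basis.mkFinCons v e (hli v hfv) (hsp v hfv),
      Module.Basis.mkFinCons v' e' (hli v' hfv') (hsp v' hfv'),
      Fin.cons c a, Fin.cons p b, Fin.cons q d, h1.cons ?_ ?_, h2.cons ?_ ?_, h3.cons ?_ ?_,
      h4.cons ?_ ?_, ?_⟩
    · exact fun p hp => (hFc p hp).symm ▸ Submodule.mem_top
    · exact fun p hp => (hF.1 hp).trans hfF
    · exact fun r hr => hG.1 hr hv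
    · exact fun p hp => (hG.1 hp).trans hfG
    · exact fun p hp => (hFc p hp).symm ▸ Submodule.mem_top
    · exact fun p hp => (hF.1 hp).trans hfF
    · exact fun r hr => hH.1 hr hv'
    · exact fun p hp => (hH.1 hp).trans hfH
    · intro s
      rw [Module.Basis.coe_mkFinCons, Module.Basis.coe_mkFinCons]
      refine Fin.cases ?_ (fun s => ?_) s
      · simp only [Fin.cons_zero]
        rw [← hzv, sub_add_cancel_right]
        exact Submodule.neg_mem _ hz
      · simp only [Fin.cons_succ]
        exact h5 s

end Adapted

/-! ## Opposed filtrations -/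

section Opposed

variable {V : Type u} [AddCommGroup V] [Module k V]

theorem subsingleton_gr_iff (F : ℤ → Submodule k V) (n : ℤ) :
    Subsingleton (Gr F n) ↔ F n ≤ F (n + 1) := by
  rw [Submodule.Quotient.subsingleton_iff, Submodule.submoduleOf,
    Submodule.comap_subtype_eq_top]

theorem mk_mem_induced {F G : ℤ → Submodule k V} {n q : ℤ} (x : F n) :
    ((F (n + 1)).submoduleOf (F n)).mkQ x ∈ Gr.induced F n G q ↔
      ∃ y ∈ F n, y ∈ G q ∧ (x : V) - y ∈ F (n + 1) := by
  constructor
  · rintro ⟨y, hy, hxy⟩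
    refine ⟨y, y.2, hy, ?_⟩
    have := (Submodule.Quotient.eq _).1 hxy.symm
    exact this
  · rintro ⟨y, hy, hyG, hxy⟩
    exact ⟨⟨y, hy⟩, hyG, ((Submodule.Quotient.eq _).2 (show x - ⟨y, hy⟩ ∈ _ from hxy)).symm⟩

theorem subsingleton_gr_gr_iff (F G : ℤ → Submodule k V) (p q : ℤ) :
    Subsingleton (Gr (Gr.induced G q F) p) ↔
      ∀ x ∈ F p, x ∈ G q → ∃ y ∈ F (p + 1), y ∈ G q ∧ x - y ∈ G (q + 1) := by
  rw [subsingleton_gr_iff]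
  constructor
  · intro h x hx hxq
    obtain ⟨y, hy, hy', hxy⟩ := (mk_mem_induced (⟨x, hxq⟩ : G q)).1
      (h ((mk_mem_induced (⟨x, hxq⟩ : G q)).2 ⟨x, hxq, hx, by simp⟩))
    exact ⟨y, hy', hy, hxy⟩
  · rintro h _ ⟨x, hx, rfl⟩
    obtain ⟨y, hy, hy', hxy⟩ := h x hx x.2
    exact (mk_mem_induced x).2 ⟨y, hy', hy, hxy⟩

/-- A class of Gr_F^n lying in both induced filtrations has one representative `x` in G^p and
another `y` in H^q, congruent modulo F^{n+1}. Working with such pairs removes the nested quotients.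
-/
theorem subsingleton_gr_gr_gr_iff (F G H : ℤ → Submodule k V) (p q n : ℤ) :
    Subsingleton (Gr (Gr.induced (Gr.induced F n H) q (Gr.induced F n G)) p) ↔
      ∀ x ∈ F n, x ∈ G p → ∀ y ∈ F n, y ∈ H q → x - y ∈ F (n + 1) →
        ∃ z ∈ F n, z ∈ G (p + 1) ∧ (∃ w ∈ F n, w ∈ H q ∧ z - w ∈ F (n + 1)) ∧
          ∃ t ∈ F n, t ∈ H (q + 1) ∧ x - z - t ∈ F (n + 1) := by
  rw [subsingleton_gr_gr_iff]
  constructor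
  · intro h x hx hxG y hy hyH hxy
    obtain ⟨z', hz1, hz2, hz3⟩ := h _ ((mk_mem_induced (⟨x, hx⟩ : F n)).2 ⟨x, hx, hxG, by simp⟩)
      ((mk_mem_induced (⟨x, hx⟩ : F n)).2 ⟨y, hy, hyH, hxy⟩)
    obtain ⟨z, hz, rfl⟩ := hz1
    rw [← map_sub] at hz3
    obtain ⟨t, ht, ht', htx⟩ := (mk_mem_induced _).1 hz3
    exact ⟨z, z.2, hz, (mk_mem_induced z).1 hz2, t, ht, ht', htx⟩
  · rintro h _ ⟨x, hx, rfl⟩ hx'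
    obtain ⟨y, hy, hyH, hxy⟩ := (mk_mem_induced x).1 hx'
    obtain ⟨z, hz, hzG, hzw, t, ht⟩ := h x x.2 hx y hy hyH hxy
    refine ⟨((F (n + 1)).submoduleOf (F n)).mkQ ⟨z, hz⟩, ?_, ?_, ?_⟩
    · exact (mk_mem_induced (⟨z, hz⟩ : F n)).2 ⟨z, hz, hzG, by simp⟩
    · exact (mk_mem_induced (⟨z, hz⟩ : F n)).2 hzw
    · rw [← map_sub]
      exact (mk_mem_induced _).2 ⟨t, ht⟩

variable {ι : Type*} [Fintype ι]

/-- The part of `w` in degree `n` with respect to a basis `e` with degrees `a`, selecting the basis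
elements satisfying `P` and putting them on the vectors `v`. -/
def basisPart (e : Module.Basis ι k V) (v : ι → V) (P : ι → Prop) [DecidablePred P] (w : V) : V :=
  ∑ s, if P s then e.repr w s • v s else 0

theorem basisPart_mem (e e' : Module.Basis ι k V) {F : ℤ → Submodule k V} {a : ι → ℤ}
    (he : Adapted e' F a) (P : ι → Prop) [DecidablePred P] (w : V) {p : ℤ}
    (h : ∀ s, P s → e.repr w s ≠ 0 → p ≤ a s) : basisPart e e' P w ∈ F p := by
  refine Submodule.sum_mem _ fun s _ => ?_
  split_ifs with hs
  · by_cases h0 : e.repr w s = 0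
    · rw [h0, zero_smul]; exact zero_mem _
    · exact Submodule.smul_mem _ _ (he.mem_of_le (h s hs h0))
  · exact zero_mem _

/-- Exchanging one family for a congruent one changes each term by something one step deeper. This
is how vectors are moved from `e` to `e'` without changing their class in Gr_F^n. -/
theorem basisPart_sub_mem (e : Module.Basis ι k V) (v v' : ι → V) {F : ℤ → Submodule k V}
    (hF : Antitone F) {a : ι → ℤ} (hv : ∀ s, v s - v' s ∈ F (a s + 1))
    (P : ι → Prop) [DecidablePred P] (w : V) {n : ℤ}
    (h : ∀ s, P s → e.repr w s ≠ 0 → n ≤ a s) :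
    basisPart e v P w - basisPart e v' P w ∈ F (n + 1) := by
  rw [basisPart, basisPart, ← Finset.sum_sub_distrib]
  refine Submodule.sum_mem _ fun s _ => ?_
  split_ifs with hs
  · rw [← smul_sub]
    by_cases h0 : e.repr w s = 0
    · rw [h0, zero_smul]; exact zero_mem _
    · exact Submodule.smul_mem _ _ (hF (by have := h s hs h0; omega) (hv s))
  · rw [sub_zero]; exact zero_mem _

theorem repr_basisPart (e : Module.Basis ι k V) (P : ι → Prop) [DecidablePred P] (w : V) (s : ι) :
    e.repr (basisPart e e P w) s = if P s then e.repr w s else 0 := by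
  classical
  rw [basisPart, map_sum, Finset.sum_apply']
  rw [Finset.sum_eq_single s]
  · split_ifs <;> simp
  · intro t _ hts
    split_ifs <;> simp [hts]
  · simp

/-- The two bases have the same leading coordinates. -/
theorem repr_eq_of_sub_mem {e e' : Module.Basis ι k V} {F : ℤ → Submodule k V} {a : ι → ℤ}
    (he : Adapted e F a) (he' : Adapted e' F a) (hee : ∀ s, e s - e' s ∈ F (a s + 1))
    {n : ℤ} {x y : V} (hy : y ∈ F n) (hxy : x - y ∈ F (n + 1)) {s : ι} (hs : a s = n) :
    e.repr x s = e'.repr y s := by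
  classical
  -- Placing the `e'`-coordinates of `y` on `e` changes `y` only within F^{n+1}, where
  -- `e`-coordinates of degree `n` vanish.
  have h1 : y = basisPart e' e' (fun _ => True) y := by simp [basisPart, e'.sum_repr]
  have h2 : x - basisPart e' e (fun _ => True) y ∈ F (n + 1) := by
    have h3 := basisPart_sub_mem e' e e' he.antitone hee (fun _ => True) y (n := n)
      (fun s _ h => (he' n y).1 hy s h)
    rw [← h1] at h3
    have := sub_mem hxy h3
    rwa [sub_sub_sub_cancel_right] at this
  have h4 := he.repr_eq_zero h2 (s := s) (by omega)
  rw [map_sub, Finsupp.sub_apply, sub_eq_zero] at h4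
  rw [h4, basisPart, map_sum, Finset.sum_apply', Finset.sum_eq_single s]
  · simp
  · intro t _ hts
    simp [hts]
  · simp

/-- A filtration `W` and two filtrations `G`, `H` inducing on the graded pieces `Gr_W^n` complementary
subspaces `G^p`, `H^q` for `n + p + q = 1`. -/
structure OppositePair (W G H : ℤ → Submodule k V) : Prop where
  separated : ∀ {n p q : ℤ}, n + p + q = 1 → ∀ {x y}, x ∈ W n → x ∈ G p → y ∈ W n → y ∈ H q →
    x - y ∈ W (n + 1) → x ∈ W (n + 1)
  spanning : ∀ {n p q : ℤ}, n + p + q = 1 → ∀ {z}, z ∈ W n → ∃ x ∈ W n, x ∈ G p ∧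
    ∃ y ∈ W n, y ∈ H q ∧ z - x - y ∈ W (n + 1)

variable {e e' : Module.Basis ι k V} {W G H : ℤ → Submodule k V} {a b c : ι → ℤ}

theorem OppositePair.swap (h : OppositePair W G H) : OppositePair W H G where
  separated hn x y hx hx' hy hy' hxy := by
    have h1 := h.separated (by omega) hy hy' hx hx' (by rw [← neg_sub]; exact neg_mem hxy)
    simpa using add_mem hxy h1
  spanning hn z hz := by
    obtain ⟨x, h1, h2, y, h3, h4, h5⟩ := h.spanning (by rwa [add_right_comm]) hz
    exact ⟨y, h3, h4, x, h1, h2, by rwa [sub_right_comm]⟩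

/-- For bases as in `exists_adapted`, opposedness means that all total degrees vanish. -/
theorem opposed_iff_degree (heW : Adapted e W a) (heG : Adapted e G b) (heW' : Adapted e' W a)
    (heH : Adapted e' H c) (hee : ∀ s, e s - e' s ∈ W (a s + 1)) :
    (∀ p q n : ℤ, p + q + n ≠ 0 →
      Subsingleton (Gr (Gr.induced (Gr.induced W n H) q (Gr.induced W n G)) p)) ↔
    ∀ s, a s + b s + c s = 0 := by
  classical
  simp only [subsingleton_gr_gr_gr_iff]
  constructor
  · intro h s
    by_contra hs
    -- If the total degree of `s` were nonzero, the class of `e s`, which is also that of `e' s`,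
    -- would have to go one step deeper in G or H, contradicting its `s`-th coordinate.
    obtain ⟨z, hz, hzG, -, t, ht, htH, hzt⟩ := h (b s) (c s) (a s) (by omega) (e s) (heW.mem_self s)
      (heG.mem_self s) (e' s) (heW'.mem_self s) (heH.mem_self s) (hee s)
    have h1 := repr_eq_of_sub_mem heW heW' hee ht hzt rfl
    rw [heH.repr_eq_zero htH (by omega), map_sub, Finsupp.sub_apply,
      heG.repr_eq_zero hzG (by omega)] at h1
    simp at h1
  · intro h p q n hpqn x hx hxG y hy hyH hxy
    have hr : ∀ s, a s = n → e.repr x s = e'.repr y s :=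
      fun s hs => repr_eq_of_sub_mem heW heW' hee hy hxy hs
    have hW := (heW n x).1 hx
    have hG := (heG p x).1 hxG
    have hH := (heH q y).1 hyH
    -- The degree `n` part of `x` is split by its G-degree. The part of degree greater than `p`
    -- already lies in G^{p+1}. The part of degree `p`, moved to `e'`, has H-degree -n - p, which is
    -- at least `q` and different from it.
    refine ⟨basisPart e e (fun s => a s = n ∧ p < b s) x, ?_, ?_,
      ⟨basisPart e e' (fun s => a s = n ∧ p < b s) x, ?_, ?_, ?_⟩,
      basisPart e e' (fun s => a s = n ∧ b s = p) x, ?_, ?_, ?_⟩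
    · exact basisPart_mem e e heW _ _ fun s hs _ => hs.1.ge
    · exact basisPart_mem e e heG _ _ fun s hs _ => hs.2
    · exact basisPart_mem e e' heW' _ _ fun s hs _ => hs.1.ge
    · exact basisPart_mem e e' heH _ _ fun s hs h0 => hH s (by rwa [← hr s hs.1])
    · exact basisPart_sub_mem e e e' heW.antitone hee _ _ fun s hs _ => hs.1.ge
    · exact basisPart_mem e e' heW' _ _ fun s hs _ => hs.1.ge
    · refine basisPart_mem e e' heH _ _ fun s hs h0 => ?_
      have := hH s (by rwa [← hr s hs.1])
      have := h s
      omega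
    · have h1 := basisPart_sub_mem e e e' heW.antitone hee (fun s => a s = n ∧ b s = p) x
        (n := n) fun s hs _ => hs.1.ge
      have h2 : x - basisPart e e (fun s => a s = n ∧ p < b s) x -
          basisPart e e (fun s => a s = n ∧ b s = p) x ∈ W (n + 1) := by
        refine (heW _ _).2 fun s hs => ?_
        rw [map_sub, map_sub, Finsupp.sub_apply, Finsupp.sub_apply, repr_basisPart,
          repr_basisPart] at hs
        by_contra hlt
        by_cases h0 : e.repr x s = 0
        · simp [h0] at hs
        · have h3 := hW s h0
          have h4 := hG s h0
          have h5 : a s = n := by omega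
          rcases h4.lt_or_eq with h6 | h6
          · simp [h5, h6, h6.ne'] at hs
          · simp [h5, h6] at hs
      have := add_mem h2 h1
      rwa [sub_add_sub_cancel] at this

/-- On Gr_W^n both bases give the same basis; G^p is spanned by the elements with b ≥ p, and H^q by
those with c ≥ q. As c = -n - b and n + p + q = 1, the latter means b ≤ p - 1, so the two index sets
are complementary. -/
theorem OppositePair.of_degree (heW : Adapted e W a) (heG : Adapted e G b) (heW' : Adapted e' W a)
    (heH : Adapted e' H c) (hee : ∀ s, e s - e' s ∈ W (a s + 1))
    (h : ∀ s, a s + b s + c s = 0) : OppositePair W G H where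
  separated := by
    intro n p q hn x y hx hxG hy hyH hxy
    refine (heW _ _).2 fun s hs => ?_
    have h3 := (heW n x).1 hx s hs
    by_contra hlt
    have h5 : a s = n := by omega
    have h4 := (heG p x).1 hxG s hs
    rw [repr_eq_of_sub_mem heW heW' hee hy hxy h5] at hs
    have := (heH q y).1 hyH s hs
    have := h s
    omega
  spanning := by
    classical
    intro n p q hn z hz
    have hW := (heW n z).1 hz
    refine ⟨basisPart e e (fun s => p ≤ b s) z, ?_, ?_,
      basisPart e e' (fun s => ¬ p ≤ b s ∧ a s = n) z, ?_, ?_, ?_⟩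
    · exact basisPart_mem e e heW _ _ fun s hs h0 => hW s h0
    · exact basisPart_mem e e heG _ _ fun s hs _ => hs
    · exact basisPart_mem e e' heW' _ _ fun s hs _ => hs.2.ge
    · refine basisPart_mem e e' heH _ _ fun s hs _ => ?_
      have := h s
      omega
    · have h1 := basisPart_sub_mem e e e' heW.antitone hee (fun s => ¬ p ≤ b s ∧ a s = n) z
        (n := n) fun s hs _ => hs.2.ge
      have h2 : z - basisPart e e (fun s => p ≤ b s) z -
          basisPart e e (fun s => ¬ p ≤ b s ∧ a s = n) z ∈ W (n + 1) := by
        refine (heW _ _).2 fun s hs => ?_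
        rw [map_sub, map_sub, Finsupp.sub_apply, Finsupp.sub_apply, repr_basisPart,
          repr_basisPart] at hs
        by_cases h0 : e.repr z s = 0
        · simp [h0] at hs
        · have h3 := hW s h0
          by_cases h4 : p ≤ b s
          · simp [h4] at hs
          · by_cases h5 : a s = n
            · simp [h4, h5] at hs
            · omega
      have := add_mem h2 h1
      rwa [sub_add_sub_cancel] at this

end Opposed

/-! ## The functorial bigrading of opposed filtrations -/

section Bigrading

variable {V : Type u} [AddCommGroup V] [Module k V] (W G H : ℤ → Submodule k V)

/-- The sum of the `W^j ∩ G^{1-q-j}` for `j ≥ n`. -/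
def staircase (q n : ℤ) : Submodule k V := ⨆ (j : ℤ) (_ : n ≤ j), W j ⊓ G (1 - q - j)

/-- The pieces of the bigrading. -/
def bigrading (i : ℤ × ℤ) : Submodule k V :=
  W i.1 ⊓ H i.2 ⊓ ((W i.1 ⊓ G (-i.1 - i.2)) ⊔ staircase W G i.2 (i.1 + 2))

variable {W G H}

theorem staircase_anti (q : ℤ) {n m : ℤ} (h : n ≤ m) : staircase W G q m ≤ staircase W G q n :=
  iSup₂_le fun j hj => le_iSup₂_of_le j (h.trans hj) le_rfl

theorem staircase_le (hW : Antitone W) (q n : ℤ) : staircase W G q n ≤ W n :=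
  iSup₂_le fun _ hj => inf_le_left.trans (hW hj)

theorem le_staircase (q n : ℤ) : W n ⊓ G (1 - q - n) ≤ staircase W G q n :=
  le_iSup₂_of_le n le_rfl le_rfl

theorem staircase_eq (q n : ℤ) :
    staircase W G q n = (W n ⊓ G (1 - q - n)) ⊔ staircase W G q (n + 1) := by
  refine le_antisymm (iSup₂_le fun j hj => ?_)
    (sup_le (le_staircase q n) (staircase_anti q (by omega)))
  rcases hj.eq_or_lt with rfl | hj
  · exact le_sup_left
  · exact le_sup_of_le_right (le_iSup₂_of_le j hj le_rfl)

theorem downward_induction {P : ℤ → Prop} {N : ℤ} (h0 : ∀ n, N ≤ n → P n)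
    (h1 : ∀ n, P (n + 1) → P n) (n : ℤ) : P n := by
  obtain ⟨t, ht⟩ : ∃ t : ℕ, N ≤ n + t := ⟨(N - n).toNat, by omega⟩
  induction t generalizing n with
  | zero => exact h0 n (by simpa using ht)
  | succ t ih => exact h1 n (ih (n + 1) (by push_cast at ht; omega))

variable {N : ℤ}

/-- Descending induction: spanning in Gr_W^n accounts for an element up to a remainder in W^{n+1}.
The part in G is a stair because its index is 1 - q - n. Together with `eq_zero_of_mem_staircase`,
this makes the staircase a complement of W^n ∩ H^q in W^n. -/
theorem le_sup_staircase (hW : Antitone W) (hN : W N = ⊥) (h : OppositePair W G H) (q n : ℤ) :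
    W n ≤ (W n ⊓ H q) ⊔ staircase W G q n := by
  induction n using downward_induction (N := N) with
  | h0 n hn => exact (hW hn).trans (hN.trans_le bot_le)
  | h1 n ih =>
    intro z hz
    obtain ⟨x, hx, hx', y, hy, hy', hz'⟩ := h.spanning (n := n) (p := 1 - q - n) (q := q)
      (by omega) hz
    have h1 : x ∈ staircase W G q n := le_staircase q n ⟨hx, hx'⟩
    have h2 : z - x - y ∈ (W n ⊓ H q) ⊔ staircase W G q n :=
      sup_le_sup (inf_le_inf_right _ (hW (by omega))) (staircase_anti q (by omega)) (ih hz')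
    have h3 := add_mem (add_mem h2 (Submodule.mem_sup_left (show y ∈ W n ⊓ H q from ⟨hy, hy'⟩)))
      (Submodule.mem_sup_right h1)
    simpa using h3

/-- The leading stair of `x` and `x` itself have the same class in Gr_W^n, one lying in G^{1-q-n}
and the other in H^q. Separation pushes the leading stair into W^{n+1}, where it joins the next
stair. -/
theorem eq_zero_of_mem_staircase (hW : Antitone W) (hG : Antitone G) (hN : W N = ⊥)
    (h : OppositePair W G H) (q n : ℤ) {x : V} (hx : x ∈ H q) (hs : x ∈ staircase W G q n) :
    x = 0 := by
  induction n using downward_induction (N := N) with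
  | h0 n hn =>
    have := (staircase_le hW q n).trans (hW hn) hs
    rwa [hN] at this
  | h1 n ih =>
    have hxn := staircase_le hW q n hs
    rw [staircase_eq] at hs
    obtain ⟨g, hg, s, hs', rfl⟩ := Submodule.mem_sup.1 hs
    refine ih (add_mem (le_staircase q (n + 1) ⟨?_, hG (by omega) hg.2⟩) hs')
    refine h.separated (n := n) (p := 1 - q - n) (q := q) (by omega) hg.1 hg.2 hxn hx ?_
    rw [sub_add_cancel_left]
    exact neg_mem (staircase_le hW q _ hs')

/-- A piece embeds in Gr_W: once an element goes one step deeper, its G-part becomes the stair of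
index i.1 + 1, since 1 - i.2 - (i.1 + 1) = -i.1 - i.2. The whole element is then in a staircase and
in H. -/
theorem bigrading_inf (hW : Antitone W) (hG : Antitone G) (hN : W N = ⊥)
    (h : OppositePair W G H) (i : ℤ × ℤ) {x : V} (hx : x ∈ bigrading W G H i)
    (hx' : x ∈ W (i.1 + 1)) : x = 0 := by
  obtain ⟨⟨h1, h2⟩, h3⟩ := hx
  refine eq_zero_of_mem_staircase hW hG hN h i.2 (i.1 + 1) h2 ?_
  obtain ⟨g, hg, s, hs, rfl⟩ := Submodule.mem_sup.1 h3
  refine add_mem (le_staircase _ _ ⟨?_, hG (by omega) hg.2⟩) (staircase_anti _ (by omega) hs)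
  have := sub_mem hx' (((staircase_le hW _ _).trans (hW (by omega : i.1 + 1 ≤ i.1 + 2))) hs)
  simpa using this

/-- Classes of Gr_W^n lying in H^q and in G^{-n-q} lift to the piece of index (n, q). The
discrepancy between the two representatives is split by spanning in W^{n+1}, and what remains in
W^{n+2} by `le_sup_staircase`; the H-parts are subtracted from `v`, the G-parts are absorbed in the
definition of the piece. -/
theorem exists_mem_bigrading (hW : Antitone W) (hN : W N = ⊥) (h : OppositePair W G H)
    (n q : ℤ) {v v' : V} (hv : v ∈ W n) (hvH : v ∈ H q) (hv' : v' ∈ W n) (hvG : v' ∈ G (-n - q))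
    (hvv : v - v' ∈ W (n + 1)) :
    ∃ w ∈ bigrading W G H (n, q), v - w ∈ W (n + 1) ⊓ H q := by
  obtain ⟨x, hx, hx', y, hy, hy', hz⟩ := h.spanning (p := -n - q) (q := q) (by omega) hvv
  have hz' : v - v' - x - y ∈ W (n + 2) := by
    have : n + 1 + 1 = n + 2 := by omega
    rwa [this] at hz
  obtain ⟨y', hy1, s, hs, hys⟩ := Submodule.mem_sup.1 (le_sup_staircase hW hN h q _ hz')
  have hyy : y + y' ∈ W (n + 1) ⊓ H q :=
    add_mem ⟨hy, hy'⟩ ⟨hW (by omega) hy1.1, hy1.2⟩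
  have hle : W (n + 1) ≤ W n := hW (by omega)
  refine ⟨v - (y + y'), ⟨⟨sub_mem hv (hle hyy.1), sub_mem hvH hyy.2⟩, ?_⟩, by simpa using hyy⟩
  have h1 : v - (y + y') = (v' + x) + s := by
    have : s = v - v' - x - y - y' := by rw [← hys]; abel
    rw [this]; abel
  rw [h1]
  exact add_mem (Submodule.mem_sup_left ⟨add_mem hv' (hle hx), add_mem hvG hx'⟩)
    (Submodule.mem_sup_right hs)

theorem bigrading_le (hW : Antitone W) (hH : Antitone H) {a b : ℤ} {i : ℤ × ℤ} (ha : a ≤ i.1)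
    (hb : b ≤ i.2) : bigrading W G H i ≤ W a ⊓ H b :=
  inf_le_left.trans (inf_le_inf (hW ha) (hH hb))

/-- A double descending induction: an element of W^n ∩ H^c is corrected by one element of the piece
(n, c), up to elements deeper in W or deeper in H. -/
theorem inf_eq_iSup_bigrading (hW : Antitone W) (hH : Antitone H) (hN : W N = ⊥)
    {M : ℤ} (hM : H M = ⊥) (h : OppositePair W G H) (a b : ℤ) :
    W a ⊓ H b = ⨆ (i : ℤ × ℤ) (_ : a ≤ i.1 ∧ b ≤ i.2), bigrading W G H i := by
  refine le_antisymm ?_ (iSup₂_le fun i hi => bigrading_le hW hH hi.1 hi.2)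
  induction a using downward_induction (N := N) with
  | h0 n hn => exact inf_le_left.trans ((hW hn).trans (hN.trans_le bot_le))
  | h1 n ih =>
    have ih' : W (n + 1) ⊓ H b ≤
        ⨆ (i : ℤ × ℤ) (_ : n ≤ i.1 ∧ b ≤ i.2), bigrading W G H i :=
      ih.trans (iSup₂_le fun i hi => le_iSup₂_of_le i ⟨by omega, hi.2⟩ le_rfl)
    suffices ∀ c, b ≤ c → W n ⊓ H c ≤
        ⨆ (i : ℤ × ℤ) (_ : n ≤ i.1 ∧ b ≤ i.2), bigrading W G H i from this b le_rfl
    intro c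
    induction c using downward_induction (N := M) with
    | h0 c hc =>
      intro _
      exact inf_le_right.trans ((hH hc).trans (hM.trans_le bot_le))
    | h1 c ihc =>
      rintro hbc v ⟨hv, hvH⟩
      -- Indices -n - c and c + 1: removing the part `y` in H^{c+1} leaves an element of H^c whose
      -- class is that of `x` in G^{-n-c}, as `exists_mem_bigrading` needs.
      obtain ⟨x, hx, hx', y, hy, hy', hz⟩ :=
        h.spanning (n := n) (p := -n - c) (q := c + 1) (by omega) hv
      obtain ⟨w, hw, hvw⟩ := exists_mem_bigrading hW hN h n c (sub_mem hv hy)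
        (sub_mem hvH (hH (by omega) hy')) hx hx' (by rwa [sub_right_comm])
      have h1 := ih' ⟨hvw.1, hH hbc hvw.2⟩
      have h2 := ihc (by omega) ⟨hy, hy'⟩
      have h3 : w ∈ ⨆ (i : ℤ × ℤ) (_ : n ≤ i.1 ∧ b ≤ i.2), bigrading W G H i :=
        Submodule.mem_iSup_of_mem (n, c) (Submodule.mem_iSup_of_mem ⟨le_rfl, hbc⟩ hw)
      have h4 := add_mem (add_mem h1 h3) h2
      simpa using h4

/-- For the lexicographically smallest index with a nonzero term, all other terms are deeper in W or
equally deep in W and deeper in H. The class of the smallest term in Gr_W is then both in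
G^{-i.1-i.2} and in H^{i.2+1}, hence zero by separation, and `bigrading_inf` applies. -/
theorem bigrading_sum_eq_zero (hW : Antitone W) (hG : Antitone G) (hH : Antitone H) (hN : W N = ⊥)
    (h : OppositePair W G H) (s : Finset (ℤ × ℤ)) (x : ℤ × ℤ → V)
    (hx : ∀ i ∈ s, x i ∈ bigrading W G H i) (hsum : ∑ i ∈ s, x i = 0) : ∀ i ∈ s, x i = 0 := by
  classical
  by_contra! hcon
  obtain ⟨i₀, hi₀, hi₀'⟩ := hcon
  obtain ⟨i, hi, hmin⟩ := Finset.exists_min_image (s.filter fun i => x i ≠ 0) (fun i => toLex i)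
    ⟨i₀, Finset.mem_filter.2 ⟨hi₀, hi₀'⟩⟩
  obtain ⟨his, hi0⟩ := Finset.mem_filter.1 hi
  refine hi0 (bigrading_inf hW hG hN h i (hx i his) ?_)
  have hrest : ∑ j ∈ s.erase i, x j ∈ (W i.1 ⊓ H (i.2 + 1)) ⊔ W (i.1 + 1) := by
    refine Submodule.sum_mem _ fun j hj => ?_
    obtain ⟨hji, hjs⟩ := Finset.mem_erase.1 hj
    by_cases h0 : x j = 0
    · rw [h0]; exact zero_mem _
    have hle := hmin j (Finset.mem_filter.2 ⟨hjs, h0⟩)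
    rw [Prod.Lex.toLex_le_toLex] at hle
    rcases hle with hlt | ⟨heq, hle⟩
    · exact Submodule.mem_sup_right (hW hlt (hx j hjs).1.1)
    · have hlt : i.2 < j.2 := lt_of_le_of_ne hle fun h2 => hji (Prod.ext heq.symm h2.symm)
      exact Submodule.mem_sup_left (bigrading_le hW hH heq.le hlt (hx j hjs))
  obtain ⟨y, hy, z, hz, hyz⟩ := Submodule.mem_sup.1 hrest
  have hxi : x i + (y + z) = 0 := by rw [hyz, Finset.add_sum_erase s x his, hsum]
  obtain ⟨-, h3⟩ := hx i his
  obtain ⟨g, hg, t, ht, hgt⟩ := Submodule.mem_sup.1 h3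
  have ht' : t ∈ W (i.1 + 1) := ((staircase_le hW _ _).trans (hW (by omega))) ht
  have hg' : g ∈ W (i.1 + 1) := by
    refine h.separated (p := -i.1 - i.2) (q := i.2 + 1) (by omega) hg.1 hg.2 (neg_mem hy.1)
      (neg_mem hy.2) ?_
    have : g - -y = - (t + z) := by
      rw [← hgt] at hxi
      have h5 : g + y + (t + z) = 0 := by rw [← hxi]; abel
      rw [sub_neg_eq_add]
      exact eq_neg_of_add_eq_zero_left h5
    rw [this]
    exact neg_mem (add_mem ht' hz)
  rw [← hgt]
  exact add_mem hg' ht'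

/-- The pieces are made from filtration steps by sums and intersections alone, which makes the
splitting functorial, unlike one chosen through bases. -/
theorem bigrading_map {V' : Type u} [AddCommGroup V'] [Module k V'] {W' G' H' : ℤ → Submodule k V'}
    (f : V →ₗ[k] V') (hfW : ∀ p, (W p).map f ≤ W' p) (hfG : ∀ p, (G p).map f ≤ G' p)
    (hfH : ∀ p, (H p).map f ≤ H' p) (i : ℤ × ℤ) :
    (bigrading W G H i).map f ≤ bigrading W' G' H' i := by
  have hinf : ∀ A B : Submodule k V, (A ⊓ B).map f ≤ A.map f ⊓ B.map f := fun A B =>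
    le_inf (Submodule.map_mono inf_le_left) (Submodule.map_mono inf_le_right)
  refine (hinf _ _).trans (inf_le_inf ((hinf _ _).trans (inf_le_inf (hfW _) (hfH _))) ?_)
  rw [Submodule.map_sup]
  refine sup_le_sup ((hinf _ _).trans (inf_le_inf (hfW _) (hfG _))) ?_
  simp only [staircase, Submodule.map_iSup]
  exact iSup₂_mono fun j _ => (hinf _ _).trans (inf_le_inf (hfW _) (hfG _))

/-- Intersections of sums of subspaces of the pieces of a grading are computed piecewise. -/
theorem iSup_inf_iSup_le {ι : Type*} {I R R' : ι → Submodule k V}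
    (hI : ∀ (s : Finset ι) (x : ι → V), (∀ i ∈ s, x i ∈ I i) → ∑ i ∈ s, x i = 0 →
      ∀ i ∈ s, x i = 0)
    (hR : ∀ i, R i ≤ I i) (hR' : ∀ i, R' i ≤ I i) :
    (⨆ i, R i) ⊓ (⨆ i, R' i) ≤ ⨆ i, R i ⊓ R' i := by
  classical
  rintro x ⟨hx, hx'⟩
  obtain ⟨f, hf, hfx⟩ := (Submodule.mem_iSup_iff_exists_finsupp _ _).1 hx
  obtain ⟨g, hg, hgx⟩ := (Submodule.mem_iSup_iff_exists_finsupp _ _).1 hx'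
  have hfg : f = g := by
    have h1 : (f - g).sum (fun _ y => y) = 0 := by
      rw [Finsupp.sum_sub_index (fun _ _ _ => rfl), hfx, hgx, sub_self]
    have h2 := hI (f - g).support (f - g) (fun i _ => sub_mem (hR i (hf i)) (hR' i (hg i))) h1
    ext i
    by_cases hi : i ∈ (f - g).support
    · exact sub_eq_zero.1 (h2 i hi)
    · exact sub_eq_zero.1 (Finsupp.notMem_support_iff.1 hi)
  rw [← hfx]
  exact Submodule.sum_mem _ fun i _ =>
    Submodule.mem_iSup_of_mem i ⟨hf i, hfg ▸ hg i⟩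

/-- Compatible maps between opposed filtrations are bistrict, and their images are in general position
with respect to the two filtrations. -/
theorem OppositePair.bistrict {V' : Type u} [AddCommGroup V'] [Module k V']
    {W' G' H' : ℤ → Submodule k V'} (f : V →ₗ[k] V') (hfW : ∀ p, (W p).map f ≤ W' p)
    (hfG : ∀ p, (G p).map f ≤ G' p) (hfH : ∀ p, (H p).map f ≤ H' p)
    (hW : Antitone W ∧ (∃ p, W p = ⊥) ∧ ∃ p, W p = ⊤)
    (hH : Antitone H ∧ (∃ p, H p = ⊥) ∧ ∃ p, H p = ⊤) (h : OppositePair W G H)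
    (hW' : Antitone W' ∧ (∃ p, W' p = ⊥) ∧ ∃ p, W' p = ⊤) (hG' : Antitone G')
    (hH' : Antitone H' ∧ (∃ p, H' p = ⊥) ∧ ∃ p, H' p = ⊤) (h' : OppositePair W' G' H') (a b : ℤ) :
    LinearMap.range f ⊓ (W' a ⊓ H' b) ≤ (W a ⊓ H b).map f ∧
    (LinearMap.range f ⊔ W' a) ⊓ (LinearMap.range f ⊔ H' b) ≤
      LinearMap.range f ⊔ (W' a ⊓ H' b) := by
  obtain ⟨hWa, ⟨N, hN⟩, P, hP⟩ := hW
  obtain ⟨hHa, ⟨M, hM⟩, Q, hQ⟩ := hH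
  obtain ⟨hWa', ⟨N', hN'⟩, P', hP'⟩ := hW'
  obtain ⟨hHa', ⟨M', hM'⟩, Q', hQ'⟩ := hH'
  have hI := bigrading_sum_eq_zero hWa' hG' hHa' hN' h'
  set I := bigrading W G H
  set I' := bigrading W' G' H'
  have hsup : ∀ T : ℤ × ℤ → Prop, (⨆ (i) (_ : T i), I i).map f = ⨆ (i) (_ : T i), (I i).map f :=
    fun T => by simp only [Submodule.map_iSup]
  have e1 := inf_eq_iSup_bigrading hWa hHa hN hM h
  have e2 := inf_eq_iSup_bigrading hWa' hHa' hN' hM' h'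
  -- The image is a graded subspace of the target. Both inclusions can then be checked in each
  -- piece, where the conditions `a ≤ i.1` and `b ≤ i.2` either hold or fail.
  have hrange : LinearMap.range f = ⨆ i, (I i).map f := by
    refine le_antisymm ?_ (iSup_le fun i => LinearMap.map_le_range)
    rw [LinearMap.range_eq_map, ← Submodule.map_iSup]
    refine Submodule.map_mono ?_
    have := e1 P Q
    rw [hP, hQ, top_inf_eq] at this
    rw [this]
    exact iSup₂_le fun i _ => le_iSup _ i
  have hmap : ∀ i, (I i).map f ≤ I' i := bigrading_map f hfW hfG hfH
  -- A single filtration is an intersection whose other member, here H' at `Q'`, is the whole space.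
  have e3 : W' a = ⨆ (i : ℤ × ℤ) (_ : a ≤ i.1 ∧ Q' ≤ i.2), I' i := by
    rw [← e2, hQ', inf_top_eq]
  have e4 : H' b = ⨆ (i : ℤ × ℤ) (_ : P' ≤ i.1 ∧ b ≤ i.2), I' i := by
    rw [← e2, hP', top_inf_eq]
  constructor
  · rw [e1, e2, hsup, hrange]
    refine (iSup_inf_iSup_le hI hmap fun i => iSup_le fun _ => le_rfl).trans
      (iSup_mono fun i => ?_)
    by_cases hi : a ≤ i.1 ∧ b ≤ i.2 <;> simp [hi]
  · rw [e2, hrange, e3, e4, ← iSup_sup_eq, ← iSup_sup_eq, ← iSup_sup_eq]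
    refine (iSup_inf_iSup_le hI (fun i => sup_le (hmap i) (iSup_le fun _ => le_rfl))
      fun i => sup_le (hmap i) (iSup_le fun _ => le_rfl)).trans (iSup_mono fun i => ?_)
    by_cases h1 : a ≤ i.1
    · by_cases h2 : b ≤ i.2
      · simpa [h1, h2] using inf_le_of_left_le
          (sup_le_sup_left (iSup_le fun _ => le_rfl) _)
      · simp [h1, h2]
    · simp [h1]

end Bigrading

/-! ## Coordinate rings and coefficients -/

/-- Unique sums make the monoid algebras below domains. -/
instance : UniqueSums charLattice :=
  UniqueSums.of_injective_addHom charLattice.subtype.toAddHom Subtype.val_injective inferInstance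

instance (S : Idx) : UniqueSums (cone S) :=
  UniqueSums.of_injective_addHom (cone S).subtype.toAddHom Subtype.val_injective inferInstance

instance : IsDomain (TorusRing k) where

theorem charLattice_sum (m : charLattice) : m.1 0 + m.1 1 + m.1 2 = 0 := m.2

theorem toTorus_injective (S : Idx) : Function.Injective (toTorus k S) :=
  AddMonoidAlgebra.mapDomain_injective Subtype.val_injective

theorem toTorus_single {S : Idx} (m : cone S) (c : k) :
    toTorus k S (AddMonoidAlgebra.single m c) = AddMonoidAlgebra.single m.1 c := by
  simp [toTorus]

theorem restr_single {S S' : Idx} (h : S ≤ S') (m : cone S) (c : k) :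
    restr k h (AddMonoidAlgebra.single m c) =
      AddMonoidAlgebra.single (AddSubmonoid.inclusion (cone_mono h) m) c := by
  simp [restr]

theorem restr_mono {S S' : Idx} (h : S ≤ S') (m : cone S) :
    restr k h (mono m) = mono (AddSubmonoid.inclusion (cone_mono h) m) :=
  restr_single h m 1

theorem mono_mul_mono {S : Idx} (m n : cone S) : mono m * mono n = (mono (m + n) : chartRing k S) := by
  simp [mono, AddMonoidAlgebra.single_mul_single]

theorem mono_zero {S : Idx} : (mono 0 : chartRing k S) = 1 := rfl

theorem single_eq_smul_mono {S : Idx} (m : cone S) (c : k) :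
    (AddMonoidAlgebra.single m c : chartRing k S) = c • mono m := by
  simp [mono]

theorem mono_pow {S : Idx} (m : cone S) (n : ℕ) : (mono m : chartRing k S) ^ n = mono (n • m) := by
  simp [mono, AddMonoidAlgebra.single_pow]

theorem toTorus_coeff_of_notMem {S : Idx} (a : chartRing k S) {m : charLattice} (hm : m ∉ cone S) :
    (toTorus k S a).coeff m = 0 := by
  induction a using AddMonoidAlgebra.induction_linear with
  | zero => simp
  | add f g hf hg => simp [hf, hg]
  | single n c =>
    classical
    rw [toTorus_single, AddMonoidAlgebra.coeff_single, Finsupp.single_apply, if_neg]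
    rintro rfl
    exact hm n.2

theorem mem_range_toTorus {S : Idx} (a : TorusRing k)
    (h : ∀ m, a.coeff m ≠ 0 → m ∈ cone S) : a ∈ (toTorus k S).range := by
  rw [← AddMonoidAlgebra.sum_coeff_single a]
  refine Subring.sum_mem _ fun m hm => ?_
  exact ⟨AddMonoidAlgebra.single ⟨m, h m (Finsupp.mem_support_iff.1 hm)⟩ _, toTorus_single _ _⟩

theorem isUnit_mono {S : Idx} (m : cone S) (h : -m.1 ∈ cone S) : IsUnit (mono m : chartRing k S) :=
  IsUnit.of_mul_eq_one (mono ⟨-m.1, h⟩) (by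
    rw [mono_mul_mono, ← mono_zero]
    congr 1
    exact Subtype.ext (add_neg_cancel _))

section Coeffs

variable {V : Type u} [AddCommGroup V] [Module k V]

open Classical in
/-- The coefficients of an element of `k[T] ⊗ V`. -/
def coeffs (k : Type u) [Field k] (V : Type u) [AddCommGroup V] [Module k V] :
    TorusRing k ⊗[k] V ≃ₗ[k] (charLattice →₀ V) :=
  (AddMonoidAlgebra.coeffLinearEquiv k).rTensor V ≪≫ₗ
    TensorProduct.finsuppScalarLeft k V charLattice

theorem coeffs_tmul (a : TorusRing k) (v : V) (m : charLattice) :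
    coeffs k V (a ⊗ₜ v) m = a.coeff m • v := by
  simp [coeffs, TensorProduct.finsuppScalarLeft_apply_tmul_apply]

theorem coeffs_chi_tmul (n : charLattice) (v : V) :
    coeffs k V (chi n ⊗ₜ v) = Finsupp.single n v := by
  classical
  ext m
  rw [coeffs_tmul, chi, AddMonoidAlgebra.coeff_single, Finsupp.single_apply, Finsupp.single_apply]
  split_ifs <;> simp

theorem coeffs_symm_single (n : charLattice) (v : V) :
    (coeffs k V).symm (Finsupp.single n v) = chi n ⊗ₜ[k] v := by
  rw [← coeffs_chi_tmul (k := k), LinearEquiv.symm_apply_apply]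

theorem coeffs_ext {x y : TorusRing k ⊗[k] V} (h : ∀ m, coeffs k V x m = coeffs k V y m) : x = y :=
  (coeffs k V).injective (Finsupp.ext h)

theorem eq_sum_coeffs (x : TorusRing k ⊗[k] V) :
    x = (coeffs k V x).sum fun m v => chi m ⊗ₜ[k] v := by
  conv_lhs => rw [← (coeffs k V).symm_apply_apply x, ← Finsupp.sum_single (coeffs k V x)]
  rw [Finsupp.sum, map_sum]
  exact Finset.sum_congr rfl fun m _ => coeffs_symm_single _ _

theorem coeffs_single_smul (n : charLattice) (c : k) (x : TorusRing k ⊗[k] V) (m : charLattice) :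
    coeffs k V ((AddMonoidAlgebra.single n c : TorusRing k) • x) m = c • coeffs k V x (m - n) := by
  induction x with
  | zero => simp
  | add x y hx hy => rw [smul_add, map_add, map_add, Finsupp.add_apply, Finsupp.add_apply, hx, hy,
      smul_add]
  | tmul a v =>
    rw [TensorProduct.smul_tmul', coeffs_tmul, coeffs_tmul, smul_eq_mul,
      AddMonoidAlgebra.coeff_single_mul_apply, mul_smul, neg_add_eq_sub]

theorem coeffs_lTensor {W : Type u} [AddCommGroup W] [Module k W] (f : V →ₗ[k] W)
    (x : TorusRing k ⊗[k] V) (m : charLattice) :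
    coeffs k W (f.lTensor (TorusRing k) x) m = f (coeffs k V x m) := by
  induction x with
  | zero => simp
  | add x y hx hy => simp only [map_add, Finsupp.add_apply, hx, hy]
  | tmul a v => rw [LinearMap.lTensor_tmul, coeffs_tmul, coeffs_tmul, map_smul]

end Coeffs

/-! ## Sections of Rees bundles -/

/-- The coefficients of a section of a trivial bundle over the open orbit. -/
def orbitCoeffs (k : Type u) [Field k] (S : Idx) (V : Type u) [AddCommGroup V] [Module k V] :
    OrbitSec k S V ≃ₗ[k] (charLattice →₀ V) :=
  coeffs k V

/-- The section `u^m ⊗ v`. -/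
def orbitMono (k : Type u) [Field k] (S : Idx) {V : Type u} [AddCommGroup V] [Module k V]
    (m : charLattice) : V →ₗ[k] OrbitSec k S V :=
  TensorProduct.mk k (TorusRing k) V (chi m)

section Orbit

variable {V : Type u} [AddCommGroup V] [Module k V] {S : Idx}

theorem orbitMono_def (m : charLattice) (v : V) :
    orbitMono k S m v = (chi m ⊗ₜ[k] v : TorusRing k ⊗[k] V) := rfl

theorem orbitCoeffs_mono (m : charLattice) (v : V) :
    orbitCoeffs k S V (orbitMono k S m v) = Finsupp.single m v := coeffs_chi_tmul m v

theorem orbitCoeffs_smul (n : cone S) (c : k) (x : OrbitSec k S V) (m : charLattice) :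
    orbitCoeffs k S V ((AddMonoidAlgebra.single n c : chartRing k S) • x) m =
      c • orbitCoeffs k S V x (m - n.1) := by
  rw [chartRing_smul_def, toTorus_single]
  exact coeffs_single_smul n.1 c x m

theorem single_smul_orbitMono (n : cone S) (c : k) (m : charLattice) (v : V) :
    (AddMonoidAlgebra.single n c : chartRing k S) • orbitMono k S m v =
      orbitMono k S (n.1 + m) (c • v) := by
  classical
  apply (orbitCoeffs k S V).injective
  ext m'
  rw [orbitCoeffs_smul, orbitCoeffs_mono, orbitCoeffs_mono, Finsupp.single_apply,
    Finsupp.single_apply]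
  simp only [eq_sub_iff_add_eq, add_comm m n.1]
  split_ifs <;> simp

theorem mono_smul_orbitMono (n : cone S) (m : charLattice) (v : V) :
    (mono n : chartRing k S) • orbitMono k S m v = orbitMono k S (n.1 + m) v := by
  rw [mono, single_smul_orbitMono, one_smul]

theorem eq_sum_orbitMono (x : OrbitSec k S V) :
    x = (orbitCoeffs k S V x).sum fun m v => orbitMono k S m v := eq_sum_coeffs (k := k) (V := V) x

end Orbit

theorem orbitMono_mem_reesSec {V : MultiFil k} {S : Idx} {m : charLattice} {w : V.V}
    (h : ∀ i ∉ S.1, w ∈ V.F i (-m.1 i)) : orbitMono k S m w ∈ reesSec V S :=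
  Submodule.subset_span ⟨m, w, h, rfl⟩

/-- A section of the trivial bundle over the open orbit is a section of the Rees bundle over `U_S`
iff its coefficients lie in the appropriate steps of the filtrations. -/
theorem mem_reesSec {V : MultiFil k} (hV : ∀ i, Antitone (V.F i)) {S : Idx}
    {x : OrbitSec k S V.V} :
    x ∈ reesSec V S ↔
      ∀ (m : charLattice), ∀ i ∉ S.1, orbitCoeffs k S V.V x m ∈ V.F i (-m.1 i) := by
  constructor
  · intro hx
    induction hx using Submodule.span_induction with
    | mem x hx =>
      obtain ⟨n, w, hw, rfl⟩ := hx
      intro m i hi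
      classical
      rw [← orbitMono_def (S := S), orbitCoeffs_mono, Finsupp.single_apply]
      split_ifs with h
      · exact h ▸ hw i hi
      · exact zero_mem _
    | zero => intro m i _; rw [map_zero]; exact zero_mem _
    | add x y _ _ hx hy =>
      intro m i hi
      rw [map_add]
      exact add_mem (hx m i hi) (hy m i hi)
    | smul a x _ hx =>
      induction a using AddMonoidAlgebra.induction_linear with
      | zero => intro m i _; rw [zero_smul, map_zero]; exact zero_mem _
      | add f g hf hg =>
        intro m i hi
        rw [add_smul, map_add]
        exact add_mem (hf m i hi) (hg m i hi)
      | single n c =>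
        intro m i hi
        rw [orbitCoeffs_smul]
        refine Submodule.smul_mem _ _ (hV i ?_ (hx _ i hi))
        have := n.2 i hi
        simp only [AddSubgroup.coe_sub, Pi.sub_apply]
        omega
  · intro h
    rw [eq_sum_orbitMono x]
    exact Submodule.sum_mem (reesSec V S) fun m _ => orbitMono_mem_reesSec (h m)

/-- The exponent `m` with `m i = - d i` for `i ≠ l`. -/
def expo (l : Fin 3) (d : Fin 3 → ℤ) : charLattice :=
  ⟨(d 0 + d 1 + d 2) • Pi.single l 1 - d, by
    change _ + _ + _ = (0 : ℤ)
    fin_cases l <;> simp <;> ring⟩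

theorem expo_apply_of_ne {l i : Fin 3} (h : i ≠ l) (d : Fin 3 → ℤ) : (expo l d).1 i = - d i := by
  simp [expo, h]

theorem expo_apply_self (l : Fin 3) (d : Fin 3 → ℤ) : (expo l d).1 l = d 0 + d 1 + d 2 - d l := by
  simp [expo]

section Basis

variable {V : MultiFil k} {ι : Type} [Fintype ι] (e : Module.Basis ι k V.V) (d : ι → Fin 3 → ℤ)
  {S : Idx} {l : Fin 3}

/-- Over k[T] these are multiples of the basis 1 ⊗ e_s by nonzero monomials, and Γ(U_S, O) embeds in
k[T]. -/
theorem linearIndependent_orbitMono (S : Idx) {V : Type u} [AddCommGroup V] [Module k V]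
    (e : Module.Basis ι k V) (n : ι → charLattice) :
    LinearIndependent (chartRing k S) (fun s => orbitMono k S (n s) (e s)) := by
  rw [Fintype.linearIndependent_iff]
  intro g hg s
  have h1 : ∑ s, (toTorus k S (g s) * chi (n s)) • Algebra.TensorProduct.basis (TorusRing k) e s =
      0 := by
    refine Eq.trans (Finset.sum_congr rfl fun s _ => ?_) hg
    rw [Algebra.TensorProduct.basis_apply, chartRing_smul_def, mul_smul, TensorProduct.smul_tmul',
      smul_eq_mul, mul_one]
    rfl
  have h2 := Fintype.linearIndependent_iff.1
    (Algebra.TensorProduct.basis (TorusRing k) e).linearIndependent _ h1 s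
  have h3 : (chi (n s) : TorusRing k) ≠ 0 := by simp [chi]
  exact toTorus_injective S (((mul_eq_zero.1 h2).resolve_right h3).trans (map_zero _).symm)

/-- For a generator u^m ⊗ w, adaptedness bounds -m i by the degree of every basis vector occurring
in w. This says that u^m divided by the monomial of that basis vector is regular on `U_S`. -/
theorem span_orbitMono (hl : l ∈ S.1) (h : ∀ i ∉ S.1, Adapted e (V.F i) (fun s => d s i)) :
    Submodule.span (chartRing k S) (Set.range fun s => orbitMono k S (expo l (d s)) (e s)) =
      reesSec V S := by
  apply le_antisymm
  · refine Submodule.span_le.2 ?_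
    rintro _ ⟨s, rfl⟩
    refine orbitMono_mem_reesSec fun i hi => ?_
    rw [expo_apply_of_ne (by rintro rfl; exact hi hl), neg_neg]
    exact (h i hi).mem_self s
  · refine Submodule.span_le.2 ?_
    rintro _ ⟨m, w, hw, rfl⟩
    rw [← orbitMono_def (S := S), ← e.sum_repr w, map_sum]
    refine Submodule.sum_mem _ fun s _ => ?_
    by_cases h0 : e.repr w s = 0
    · rw [h0, zero_smul, map_zero]; exact Submodule.zero_mem _
    · have hc : m - expo l (d s) ∈ cone S := by
        intro i hi
        have h2 : -m.1 i ≤ d s i := (h i hi _ w).1 (hw i hi) s h0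
        change 0 ≤ m.1 i - (expo l (d s)).1 i
        rw [expo_apply_of_ne (by rintro rfl; exact hi hl)]
        omega
      have h3 := single_smul_orbitMono ⟨_, hc⟩ (e.repr w s) (expo l (d s)) (e s)
      rw [sub_add_cancel] at h3
      rw [← h3]
      exact Submodule.smul_mem _ _ (Submodule.subset_span ⟨s, rfl⟩)

/-- The basis of the sections of a Rees bundle over `U_S` given by a basis splitting the filtrations
`F_i`, `i ∉ S`. -/
def reesBasis (hl : l ∈ S.1) (h : ∀ i ∉ S.1, Adapted e (V.F i) (fun s => d s i)) :
    Module.Basis ι (chartRing k S) (reesSec V S) :=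
  (Module.Basis.span (linearIndependent_orbitMono S e fun s => expo l (d s))).map
    (LinearEquiv.ofEq _ _ (span_orbitMono e d hl h))

theorem coe_reesBasis (hl : l ∈ S.1) (h : ∀ i ∉ S.1, Adapted e (V.F i) (fun s => d s i)) (s : ι) :
    (reesBasis e d hl h s : OrbitSec k S V.V) = orbitMono k S (expo l (d s)) (e s) := by
  rw [reesBasis, Module.Basis.map_apply, LinearEquiv.coe_ofEq_apply, Module.Basis.span_apply]

end Basis

/-- Over every `U_S` there is a basis splitting the filtrations `F_i`, `i ∉ S`. -/
theorem exists_adapted_chart (V : TriFil k) (l : Fin 3) :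
    ∃ (e : Module.Basis (Fin (Module.finrank k V.obj.V)) k V.obj.V)
      (d : Fin (Module.finrank k V.obj.V) → Fin 3 → ℤ),
      ∀ i ≠ l, Adapted e (V.obj.F i) (fun s => d s i) := by
  have := V.property.1
  -- Only the two filtrations other than F_l matter on this chart; the third slot repeats one of
  -- them.
  obtain ⟨e, -, a, b, -, h1, h2, -⟩ := exists_adapted _ rfl (V.obj.F (l + 1)) (V.obj.F (l + 2))
    (V.obj.F (l + 2)) (V.property.2 _) (V.property.2 _) (V.property.2 _)
  refine ⟨e, fun s i => if i = l + 1 then a s else b s, fun i hi => ?_⟩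
  by_cases h : i = l + 1
  · subst h; simpa using h1
  · have : i = l + 2 := by fin_cases i <;> fin_cases l <;> simp_all
    subst this
    simpa [h] using h2

theorem exists_reesBasis (V : TriFil k) (S : Idx) :
    Nonempty (Module.Basis (Fin (Module.finrank k V.obj.V)) (chartRing k S) (reesSec V.obj S)) := by
  obtain ⟨l, hl⟩ := S.2
  obtain ⟨e, d, h⟩ := exists_adapted_chart V l
  exact ⟨reesBasis e d hl fun i hi => h i (by rintro rfl; exact hi hl)⟩

/-- An exponent that is at least `B` in the directions of `S' ∖ S` and zero outside `S'`. -/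
theorem exists_cone_shift {S S' : Idx} (h : S ≤ S') (B : ℕ) :
    ∃ n : cone S, (∀ i ∈ S'.1, i ∉ S.1 → (B : ℤ) ≤ n.1.1 i) ∧ ∀ i ∉ S'.1, n.1.1 i = 0 := by
  obtain ⟨l, hl⟩ := S.2
  let d : Fin 3 → ℤ := fun i => if i ∈ S'.1 ∧ i ∉ S.1 then - (B : ℤ) else 0
  have hd : ∀ i, i ≠ l → (expo l d).1 i = if i ∈ S'.1 ∧ i ∉ S.1 then (B : ℤ) else 0 := by
    intro i hi
    rw [expo_apply_of_ne hi]
    simp only [d]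
    split_ifs <;> simp
  have hne : ∀ i, i ∉ S.1 → i ≠ l := by rintro i hi rfl; exact hi hl
  refine ⟨⟨expo l d, fun i hi => ?_⟩, fun i hi hi' => ?_, fun i hi => ?_⟩
  · rw [hd i (hne i hi)]; split_ifs <;> simp
  · rw [hd i (hne i hi'), if_pos ⟨hi, hi'⟩]
  · rw [hd i (hne i fun h' => hi (h h')), if_neg (fun h' => hi h'.1)]

/-- Rees bundles are vector bundles. -/
theorem isVectorBundle_rees (V : TriFil k) : isVectorBundle k (reesObj V.obj) := by
  have hA : ∀ i, Antitone (V.obj.F i) := fun i => (V.property.2 i).1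
  refine ⟨fun S S' h => ⟨fun x hx => ⟨1, by simp, ?_⟩, fun y => ?_⟩, fun S => ?_⟩
  · have : x = 0 := by
      apply reesIncl_injective V.obj S
      exact congrArg (reesIncl V.obj S') hx
    rw [this, smul_zero]
  · choose q hq using fun i => (V.property.2 i).2.2
    -- The section has finitely many coefficients, so one shift by `B` in the directions of S' ∖ S
    -- moves all of them into the range where the filtration step is the whole space.
    obtain ⟨B, hB⟩ : ∃ B : ℕ, ∀ m ∈ (orbitCoeffs k S' V.obj.V y.1).support, ∀ i,
        -m.1 i - B ≤ q i := by
      let g : charLattice → ℕ := fun m => ∑ i, (-m.1 i - q i).natAbs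
      refine ⟨(orbitCoeffs k S' V.obj.V y.1).support.sup g, fun m hm i => ?_⟩
      have h1 := Finset.le_sup (f := g) hm
      have h2 : (-m.1 i - q i).natAbs ≤ g m :=
        Finset.single_le_sum (f := fun i => (-m.1 i - q i).natAbs) (fun _ _ => Nat.zero_le _)
          (Finset.mem_univ i)
      omega
    obtain ⟨n, hn1, hn2⟩ := exists_cone_shift h B
    let y' : OrbitSec k S V.obj.V := y.1
    have hmem : (mono n : chartRing k S) • y' ∈ reesSec V.obj S := by
      rw [mem_reesSec hA]
      intro m i hi
      rw [mono, orbitCoeffs_smul, one_smul]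
      change orbitCoeffs k S' V.obj.V y.1 (m - n.1) ∈ _
      by_cases hi' : i ∈ S'.1
      · by_cases h0 : orbitCoeffs k S' V.obj.V y.1 (m - n.1) = 0
        · rw [h0]; exact zero_mem _
        · have h1 := hB _ (Finsupp.mem_support_iff.2 h0) i
          have h2 := hn1 i hi' hi
          have h3 : V.obj.F i (-m.1 i) = ⊤ := by
            refine top_le_iff.1 ((hq i).symm.le.trans (hA i ?_))
            simp only [AddSubgroup.coe_sub, Pi.sub_apply] at h1
            omega
          rw [h3]; exact Submodule.mem_top
      · have := (mem_reesSec hA).1 y.2 (m - n.1) i hi'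
        simpa only [AddSubgroup.coe_sub, Pi.sub_apply, hn2 i hi', sub_zero] using this
    refine ⟨mono n, ⟨_, hmem⟩, ?_, ?_⟩
    · rw [restr_mono]
      refine isUnit_mono _ fun i hi => ?_
      have : n.1.1 i = 0 := hn2 i hi
      simp [this]
    · apply reesIncl_injective V.obj S'
      exact (reesIncl_smul V.obj S' (restr k h (mono n)) y).trans (by rw [toTorus_restr]; rfl)
  · obtain ⟨b⟩ := exists_reesBasis V S
    exact ⟨Module.Finite.of_basis b, Module.Projective.of_basis b⟩

/-! ## The grading given by the torus action -/

/-- The component of weight `m` of a section. -/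
def weight (ξ : EqSheaf k) (S : Idx) (m : charLattice) : ξ.sec S →ₗ[k] ξ.sec S :=
  Finsupp.lapply m ∘ₗ (coeffs k (ξ.sec S)).toLinearMap ∘ₗ ξ.coact S

/-- `x` is homogeneous of weight `m`. -/
def HasWeight (ξ : EqSheaf k) (S : Idx) (x : ξ.sec S) (m : charLattice) : Prop :=
  ξ.coact S x = chi m ⊗ₜ x

section Weight

variable {ξ : EqSheaf k} {S : Idx}

theorem weight_apply (m : charLattice) (x : ξ.sec S) :
    weight ξ S m x = coeffs k (ξ.sec S) (ξ.coact S x) m := rfl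

theorem weight_eq_of_hasWeight {x : ξ.sec S} {m : charLattice} (h : HasWeight ξ S x m) :
    weight ξ S m x = x := by
  rw [weight_apply, h, coeffs_chi_tmul, Finsupp.single_eq_same]

/-- The coefficient of t^m in the coassociativity identity. -/
theorem hasWeight_weight (m : charLattice) (x : ξ.sec S) :
    HasWeight ξ S (weight ξ S m x) m := by
  have h1 := congrArg (fun z => coeffs k _ z m) (ξ.coassoc S x)
  simp only [coeffs_lTensor] at h1
  rw [HasWeight, weight_apply, ← h1]
  generalize ξ.coact S x = y
  induction y using orbit_induction with
  | h0 => simp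
  | hadd x y hx hy => simp only [map_add, Finsupp.add_apply, hx, hy, TensorProduct.tmul_add]
  | h n c w =>
    classical
    have : (Coalgebra.comul (R := k) (A := TorusRing k)) (AddMonoidAlgebra.single n c) =
        chi n ⊗ₜ AddMonoidAlgebra.single n c := by
      simp [chi]
    rw [LinearMap.rTensor_tmul, this, TensorProduct.assoc_tmul, coeffs_chi_tmul, coeffs_tmul,
      AddMonoidAlgebra.coeff_single, Finsupp.single_apply, Finsupp.single_apply]
    split_ifs with h
    · rw [h, TensorProduct.tmul_smul, TensorProduct.smul_tmul']
      congr 1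
      simp [chi]
    · simp

/-- The counit sends every character to 1, so applying it to the coaction adds up the components. -/
theorem sum_weight (x : ξ.sec S) :
    ((coeffs k (ξ.sec S) (ξ.coact S x)).sum fun _ y => y) = x := by
  have h1 := congrArg (TensorProduct.lid k (ξ.sec S)) (ξ.counit_coact S x)
  rw [TensorProduct.lid_tmul, one_smul] at h1
  conv_rhs => rw [← h1, eq_sum_coeffs (ξ.coact S x)]
  rw [Finsupp.sum, Finsupp.sum, map_sum, map_sum]
  refine Finset.sum_congr rfl fun m _ => ?_
  simp [chi]

/-- Every section is a sum of homogeneous ones. -/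
theorem weight_induction {P : ξ.sec S → Prop} (h : ∀ m x, HasWeight ξ S x m → P x)
    (hadd : ∀ x y, P x → P y → P (x + y)) (x : ξ.sec S) : P x := by
  rw [← sum_weight x]
  refine Finset.sum_induction _ P hadd (h 0 0 ?_) fun m _ => h m _ (hasWeight_weight m x)
  rw [HasWeight, map_zero, TensorProduct.tmul_zero]

theorem HasWeight.smul {x : ξ.sec S} {m : charLattice} (h : HasWeight ξ S x m) (n : cone S) :
    HasWeight ξ S (mono (k := k) n • x) (n.1 + m) := by
  rw [HasWeight, ξ.coact_smul, h, TensorProduct.map_tmul]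
  simp [chi]

theorem HasWeight.res {S' : Idx} {x : ξ.sec S} {m : charLattice} (h : HasWeight ξ S x m)
    (hS : S ≤ S') : HasWeight ξ S' (ξ.res hS x) m := by
  rw [HasWeight, ξ.coact_res, h, LinearMap.lTensor_tmul]

theorem HasWeight.app {η : EqSheaf k} (f : ξ ⟶ η) {x : ξ.sec S} {m : charLattice}
    (h : HasWeight ξ S x m) : HasWeight η S (f.app S x) m := by
  rw [HasWeight, f.app_coact, h, LinearMap.lTensor_tmul]
  rfl

theorem hasWeight_zero_iff {x : ξ.sec S} : HasWeight ξ S x 0 ↔ ξ.coact S x = 1 ⊗ₜ x := Iff.rfl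

theorem weight_mono_smul (m : charLattice) (n : cone S) (x : ξ.sec S) :
    weight ξ S m (mono (k := k) n • x) = mono (k := k) n • weight ξ S (m - n.1) x := by
  induction x using weight_induction with
  | h m' x hx =>
    classical
    rw [weight_apply, weight_apply, hx.smul n, hx, coeffs_chi_tmul, coeffs_chi_tmul,
      Finsupp.single_apply, Finsupp.single_apply]
    simp only [eq_sub_iff_add_eq, add_comm m' n.1]
    split_ifs <;> simp
  | hadd x y hx hy => rw [smul_add, map_add, map_add, smul_add, hx, hy]

theorem single_smul (n : cone S) (c : k) (x : ξ.sec S) :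
    (AddMonoidAlgebra.single n c : chartRing k S) • x = c • (mono (k := k) n • x) := by
  rw [single_eq_smul_mono, smul_assoc]

theorem weight_res {S' : Idx} (hS : S ≤ S') (m : charLattice) (x : ξ.sec S) :
    weight ξ S' m (ξ.res hS x) = ξ.res hS (weight ξ S m x) := by
  rw [weight_apply, weight_apply, ξ.coact_res, coeffs_lTensor]

theorem eq_zero_of_weight {x : ξ.sec S} (h : ∀ m, weight ξ S m x = 0) : x = 0 := by
  rw [← sum_weight x]
  exact Finset.sum_eq_zero fun m _ => h m

end Weight

/-! ## The fibre at the unit point -/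

/-- Every exponent is allowed on the open orbit. -/
def orbitExp (m : charLattice) : cone orbit := ⟨m, fun i hi => absurd (Finset.mem_univ i) hi⟩

theorem mono_orbitExp_smul_smul (ξ : EqSheaf k) (m n : charLattice) (x : ξ.sec orbit) :
    mono (k := k) (orbitExp m) • mono (k := k) (orbitExp n) • x =
      mono (k := k) (orbitExp (m + n)) • x := by
  rw [← mul_smul, mono_mul_mono]
  rfl

theorem mono_orbitExp_zero_smul (ξ : EqSheaf k) (x : ξ.sec orbit) :
    mono (k := k) (orbitExp 0) • x = x := one_smul _ x

theorem mono_smul_injective (ξ : EqSheaf k) (m : charLattice) {x y : ξ.sec orbit}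
    (h : mono (k := k) (orbitExp m) • x = mono (k := k) (orbitExp m) • y) : x = y := by
  have := congrArg (fun z => mono (k := k) (orbitExp (-m)) • z) h
  simpa only [mono_orbitExp_smul_smul, neg_add_cancel, mono_orbitExp_zero_smul] using this

section Fibre

variable {ξ : EqSheaf k}

theorem unitEval_mono_smul (n : cone orbit) (x : ξ.sec orbit) :
    unitEval ξ (mono (k := k) n • x) = unitEval ξ x := by
  rw [← sub_eq_zero, ← map_sub]
  have h : mono (k := k) n • x - x = (mono (k := k) n - 1) • x := by rw [sub_smul, one_smul]
  rw [h]
  exact (Submodule.Quotient.mk_eq_zero _).2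
    (Submodule.smul_mem_smul (Ideal.subset_span ⟨n, rfl⟩) Submodule.mem_top)

/-- The invariant section with the same value at the unit point. -/
def invariantPart (ξ : EqSheaf k) : ξ.sec orbit →ₗ[k] ξ.sec orbit :=
  Finsupp.lsum k (fun m : charLattice =>
    Algebra.lsmul k k (ξ.sec orbit) (mono (k := k) (orbitExp (-m)))) ∘ₗ
    (coeffs k (ξ.sec orbit)).toLinearMap ∘ₗ ξ.coact orbit

theorem HasWeight.invariantPart {x : ξ.sec orbit} {m : charLattice} (h : HasWeight ξ orbit x m) :
    invariantPart ξ x = mono (k := k) (orbitExp (-m)) • x := by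
  rw [TriRees.invariantPart, LinearMap.comp_apply, LinearMap.comp_apply, h]
  erw [coeffs_chi_tmul]
  rw [Finsupp.lsum_single]
  rfl

theorem invariantPart_eq_self {x : ξ.sec orbit} (h : HasWeight ξ orbit x 0) :
    invariantPart ξ x = x := by
  rw [h.invariantPart, neg_zero, mono_orbitExp_zero_smul]

theorem hasWeight_invariantPart (x : ξ.sec orbit) : HasWeight ξ orbit (invariantPart ξ x) 0 := by
  induction x using weight_induction with
  | h m x hx =>
    rw [hx.invariantPart]
    simpa [orbitExp] using hx.smul (orbitExp (-m))
  | hadd x y hx hy => rw [HasWeight, map_add, map_add, hx, hy, TensorProduct.tmul_add]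

theorem unitEval_invariantPart (x : ξ.sec orbit) :
    unitEval ξ (invariantPart ξ x) = unitEval ξ x := by
  induction x using weight_induction with
  | h m x hx => rw [hx.invariantPart, unitEval_mono_smul]
  | hadd x y hx hy => rw [map_add, map_add, map_add, hx, hy]

theorem invariantPart_mono_smul (n : cone orbit) (x : ξ.sec orbit) :
    invariantPart ξ (mono (k := k) n • x) = invariantPart ξ x := by
  induction x using weight_induction with
  | h m x hx =>
    rw [hx.invariantPart, (hx.smul n).invariantPart]
    refine (mono_orbitExp_smul_smul ξ _ n.1 x).trans ?_
    congr 3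
    abel
  | hadd x y hx hy => rw [smul_add, map_add, map_add, hx, hy]

/-- `invariantPart` does not see multiplication by monomials, so it kills the multiples of the
generators u^m - 1 of the ideal of the unit point. Hence invariant sections embed in the fibre;
`exists_invariant` gives the other half. -/
theorem invariantPart_eq_zero {x : ξ.sec orbit} (h : unitEval ξ x = 0) : invariantPart ξ x = 0 := by
  have hx : x ∈ unitIdeal k • (⊤ : Submodule (chartRing k orbit) (ξ.sec orbit)) :=
    (Submodule.Quotient.mk_eq_zero _).1 h
  have h1 : ∀ a ∈ unitIdeal k, ∀ y : ξ.sec orbit, invariantPart ξ (a • y) = 0 := by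
    intro a ha
    induction ha using Submodule.span_induction with
    | mem a ha =>
      obtain ⟨m, rfl⟩ := ha
      intro y
      rw [sub_smul, one_smul, map_sub, invariantPart_mono_smul, sub_self]
    | zero => intro y; rw [zero_smul, map_zero]
    | add a b _ _ ha hb => intro y; rw [add_smul, map_add, ha, hb, add_zero]
    | smul b a _ ha => intro y; rw [smul_eq_mul, mul_comm, mul_smul, ha]
  exact Submodule.smul_induction_on hx (fun a ha y _ => h1 a ha y)
    fun x y hx hy => by rw [map_add, hx, hy, add_zero]

theorem HasWeight.eq_of_unitEval_eq {x y : ξ.sec orbit} (hx : HasWeight ξ orbit x 0)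
    (hy : HasWeight ξ orbit y 0) (h : unitEval ξ x = unitEval ξ y) : x = y := by
  have := invariantPart_eq_zero (ξ := ξ) (x := x - y) (by rw [map_sub, h, sub_self])
  rwa [map_sub, invariantPart_eq_self hx, invariantPart_eq_self hy, sub_eq_zero] at this

theorem exists_invariant (v : unitFibre ξ) : ∃ x, HasWeight ξ orbit x 0 ∧ unitEval ξ x = v := by
  obtain ⟨x, rfl⟩ := unitEval_surjective ξ v
  exact ⟨_, hasWeight_invariantPart x, unitEval_invariantPart x⟩

theorem le_awayFrom {S : Idx} {i : Fin 3} (h : i ∉ S.1) : S ≤ awayFrom i := by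
  intro j hj
  change j ∈ ({i}ᶜ : Finset (Fin 3))
  rw [Finset.mem_compl, Finset.mem_singleton]
  rintro rfl
  exact h hj

theorem notMem_awayFrom {i j : Fin 3} : j ∉ (awayFrom i).1 ↔ j = i := by
  simp [awayFrom]

theorem mono_smul_mem_range_res {i : Fin 3} {n : charLattice} (hn : 0 ≤ n.1 i) {x : ξ.sec orbit}
    (hx : x ∈ LinearMap.range (ξ.res (le_orbit (awayFrom i)))) :
    mono (k := k) (orbitExp n) • x ∈ LinearMap.range (ξ.res (le_orbit (awayFrom i))) := by
  obtain ⟨y, rfl⟩ := hx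
  have hn' : n ∈ cone (awayFrom i) := fun j hj => by
    rw [notMem_awayFrom.1 hj]; exact hn
  refine ⟨mono (k := k) ⟨n, hn'⟩ • y, ?_⟩
  rw [ξ.res_smul, restr_mono]
  rfl

/-- It suffices to check the condition defining `poleSec` for one exponent. -/
theorem mem_poleSec_of {i : Fin 3} {p : ℤ} {x : ξ.sec orbit} (hx : HasWeight ξ orbit x 0)
    {n : charLattice} (hn : n.1 i ≤ -p)
    (h : mono (k := k) (orbitExp n) • x ∈ LinearMap.range (ξ.res (le_orbit (awayFrom i)))) :
    x ∈ poleSec ξ i p := by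
  refine ⟨hx, fun m hm => ?_⟩
  have h1 := mono_smul_mem_range_res (n := m.1 - n) (by
    change 0 ≤ m.1.1 i - n.1 i
    omega) h
  rw [mono_orbitExp_smul_smul, sub_add_cancel] at h1
  exact h1

theorem exists_exponent (i : Fin 3) (p : ℤ) : ∃ n : charLattice, n.1 i = p :=
  ⟨expo (i + 1) fun _ => -p, by
    rw [expo_apply_of_ne (by fin_cases i <;> decide), neg_neg]⟩

theorem poleSec_antitone (ξ : EqSheaf k) (i : Fin 3) : Antitone (poleSec ξ i) := by
  intro p q hpq x hx
  obtain ⟨n, hn⟩ := exists_exponent i (-q)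
  exact mem_poleSec_of hx.1 (by omega) (hx.2 (orbitExp n) hn)

end Fibre

/-! ## The canonical map from a sheaf to the Rees bundle of its fibre -/

section ToRees

variable (ξ : EqSheaf k)

/-- The sections over `U_S` as functions on the orbit with values in the fibre at `(1:1:1)`. -/
def toOrbit (S : Idx) : ξ.sec S →ₗ[k] OrbitSec k S (unitFibre ξ) :=
  (unitEval ξ ∘ₗ ξ.res (le_orbit S)).lTensor (TorusRing k) ∘ₗ ξ.coact S

variable {ξ}

theorem HasWeight.toOrbit {S : Idx} {x : ξ.sec S} {m : charLattice} (h : HasWeight ξ S x m) :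
    toOrbit ξ S x = orbitMono k S m (unitEval ξ (ξ.res (le_orbit S) x)) := by
  change (unitEval ξ ∘ₗ ξ.res (le_orbit S)).lTensor (TorusRing k) (ξ.coact S x) = _
  rw [h, LinearMap.lTensor_tmul]
  rfl

/-- For `x` of weight m, the invariant section through its value is u^{-m} x. Multiplying by u^m
gives back `x`, which is regular along u_i = 0 for i ∉ S, so the value is in F_i^{-m i}. -/
theorem toOrbit_mem {S : Idx} (x : ξ.sec S) : toOrbit ξ S x ∈ reesSec (fibreObj ξ) S := by
  induction x using weight_induction with
  | h m x hx =>
    rw [hx.toOrbit]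
    refine orbitMono_mem_reesSec (V := fibreObj ξ) fun i hi => ?_
    refine ⟨mono (k := k) (orbitExp (-m)) • ξ.res (le_orbit S) x, ?_, unitEval_mono_smul _ _⟩
    refine mem_poleSec_of (n := m) ?_ (by simp) ?_
    · simpa [orbitExp] using (hx.res (le_orbit S)).smul (orbitExp (-m))
    · rw [mono_orbitExp_smul_smul, add_neg_cancel, mono_orbitExp_zero_smul,
        ξ.res_trans (le_awayFrom hi) (le_orbit _)]
      exact ⟨_, rfl⟩
  | hadd x y hx hy => rw [map_add]; exact add_mem hx hy

theorem toOrbit_smul {S : Idx} (a : chartRing k S) (x : ξ.sec S) :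
    toOrbit ξ S (a • x) = a • toOrbit ξ S x := by
  induction x using weight_induction with
  | h m x hx =>
    induction a using AddMonoidAlgebra.induction_linear with
    | zero => rw [zero_smul, zero_smul, map_zero]
    | add f g hf hg => rw [add_smul, add_smul, map_add, hf, hg]
    | single n c =>
      rw [single_smul, LinearMap.map_smul, (hx.smul n).toOrbit, hx.toOrbit, single_smul_orbitMono,
        LinearMap.map_smul, ξ.res_smul, restr_mono, unitEval_mono_smul]
  | hadd x y hx hy => rw [smul_add, map_add, map_add, smul_add, hx, hy]

/-- The canonical map on sections over `U_S`. -/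
def toReesApp (ξ : EqSheaf k) (S : Idx) :
    ξ.sec S →ₗ[chartRing k S] reesSec (fibreObj ξ) S where
  toFun x := ⟨toOrbit ξ S x, toOrbit_mem x⟩
  map_add' x y := Subtype.ext (map_add (toOrbit ξ S) x y)
  map_smul' a x := Subtype.ext (toOrbit_smul a x)

theorem toReesApp_coact {S : Idx} (x : ξ.sec S) :
    reesCoact (fibreObj ξ) S (toReesApp ξ S x) =
      ((toReesApp ξ S).restrictScalars k).lTensor (TorusRing k) (ξ.coact S x) := by
  apply reesIncl_lTensor_injective
  rw [reesCoact_spec, ← LinearMap.lTensor_comp_apply]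
  induction x using weight_induction with
  | h m x hx =>
    rw [hx, LinearMap.lTensor_tmul]
    have h1 : reesIncl (fibreObj ξ) S (toReesApp ξ S x) =
        (chi m ⊗ₜ[k] unitEval ξ (ξ.res (le_orbit S) x) : TorusRing k ⊗[k] unitFibre ξ) := hx.toOrbit
    rw [h1, LinearMap.comp_apply]
    refine (orbitCoact_single m 1 _).trans ?_
    exact congrArg (fun z => chi m ⊗ₜ[k] z) h1.symm
  | hadd x y hx hy => rw [map_add, map_add, map_add, map_add, map_add, hx, hy]

/-- The canonical morphism from `ξ` to the Rees bundle of its fibre at `(1:1:1)`. -/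
def toRees (ξ : EqSheaf k) : ξ ⟶ reesObj (fibreObj ξ) :=
  EqSheaf.Hom.mk (ξ := ξ) (η := reesObj (fibreObj ξ)) (toReesApp ξ)
    (by
      intro S S' h x
      refine Subtype.ext ?_
      change toOrbit ξ S' (ξ.res h x) = toOrbit ξ S x
      induction x using weight_induction with
      | h m x hx =>
        rw [(hx.res h).toOrbit, hx.toOrbit, ← ξ.res_trans]
        rfl
      | hadd x y hx hy => rw [map_add, map_add, hx, hy, map_add]; rfl)
    (fun _ x => toReesApp_coact x)

theorem toRees_naturality {ξ η : EqSheaf k} (f : ξ ⟶ η) :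
    f ≫ toRees η = toRees ξ ≫ (reesFunctor k).map (fibreMap f) := by
  refine EqSheaf.Hom.ext (funext fun S => LinearMap.ext fun x => Subtype.ext ?_)
  change toOrbit η S (f.app S x) = (unitMap f).lTensor (TorusRing k) (toOrbit ξ S x)
  induction x using weight_induction with
  | h m x hx =>
    rw [(hx.app f).toOrbit, hx.toOrbit]
    refine Eq.trans ?_ (LinearMap.lTensor_tmul _ _ _ _).symm
    rw [unitMap_unitEval, f.app_res]
    rfl
  | hadd x y hx hy =>
    rw [map_add, map_add, map_add, hx, hy]
    exact (map_add ((unitMap f).lTensor (TorusRing k)) _ _).symm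

end ToRees

/-! ## Fibres of vector bundles -/

section Bundle

variable {ξ : EqSheaf k}

theorem restr_ne_zero_of_isUnit {S S' : Idx} {h : S ≤ S'} {a : chartRing k S}
    (ha : IsUnit (restr k h a)) : a ≠ 0 := by
  rintro rfl
  rw [map_zero] at ha
  exact not_isUnit_zero ha

/-- Sections of a vector bundle over `U_S` are determined by their restriction to the orbit. -/
theorem res_injective (hξ : isVectorBundle k ξ) {S S' : Idx} (h : S ≤ S') :
    Function.Injective (ξ.res h) := by
  rw [injective_iff_map_eq_zero]
  intro x hx
  have := (hξ.2 S).1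
  have := (hξ.2 S).2
  obtain ⟨n, f, g, -, hg, -⟩ :=
    Module.Finite.exists_comp_eq_id_of_projective (chartRing k S) (ξ.sec S)
  obtain ⟨a, ha, hax⟩ := (hξ.1 S S' h).1 x hx
  have ha0 := restr_ne_zero_of_isUnit ha
  apply hg
  rw [map_zero]
  have h1 : a • g x = 0 := by rw [← map_smul, hax, map_zero]
  exact (smul_eq_zero.1 h1).resolve_left ha0

/-- An invertible factor can be removed in `k[T]`, keeping track of the charts. -/
theorem exists_div_of_isUnit {S S' : Idx} (h : S ≤ S') {a : chartRing k S}
    (ha : IsUnit (restr k h a)) (b : chartRing k S) :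
    ∃ c : chartRing k S', toTorus k S a * toTorus k S' c = toTorus k S b := by
  obtain ⟨c, hc⟩ := ha.exists_right_inv
  refine ⟨c * restr k h b, ?_⟩
  have h1 := congrArg (toTorus k S') hc
  rw [map_mul, toTorus_restr, map_one] at h1
  rw [map_mul, ← mul_assoc, h1, one_mul, toTorus_restr]

theorem mem_cone_of_forall {S : Idx} {m : charLattice}
    (h : ∀ i ∉ S.1, m ∈ cone (awayFrom i)) : m ∈ cone S :=
  fun i hi => h i hi i (notMem_awayFrom.2 rfl)

/-- A section over the orbit that extends across each of the divisors `u_i = 0`, `i ∉ S`, extends to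
`U_S`. -/
theorem mem_range_res (hξ : isVectorBundle k ξ) (S : Idx) {y : ξ.sec orbit}
    (hy : ∀ i ∉ S.1, y ∈ LinearMap.range (ξ.res (le_orbit (awayFrom i)))) :
    y ∈ LinearMap.range (ξ.res (le_orbit S)) := by
  have := (hξ.2 S).1
  have := (hξ.2 S).2
  -- The module is a retract of a free one, which reduces extension of sections to extension of
  -- coordinate functions.
  obtain ⟨n, f, g, -, -, hfg⟩ :=
    Module.Finite.exists_comp_eq_id_of_projective (chartRing k S) (ξ.sec S)
  have hfg' : ∀ x, f (g x) = x := fun x => LinearMap.congr_fun hfg x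
  obtain ⟨a, x, ha, hax⟩ := (hξ.1 S orbit (le_orbit S)).2 y
  -- `q` holds the coordinates of `y` as Laurent polynomials: quasi-coherence makes `a • y` extend
  -- to `x`, and `a` is invertible on the orbit.
  obtain ⟨q, hq⟩ : ∃ q : Fin n → TorusRing k, ∀ j, toTorus k S a * q j = toTorus k S (g x j) := by
    choose c hc using fun j => exists_div_of_isUnit (le_orbit S) ha (g x j)
    exact ⟨fun j => toTorus k orbit (c j), hc⟩
  have ha0 : toTorus k S a ≠ 0 := fun h0 =>
    restr_ne_zero_of_isUnit ha (toTorus_injective S (h0.trans (map_zero _).symm))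
  have hqi : ∀ j, ∀ i ∉ S.1, ∃ c : chartRing k (awayFrom i), toTorus k (awayFrom i) c = q j := by
    intro j i hi
    obtain ⟨z, rfl⟩ := hy i hi
    obtain ⟨b, w, hb, hbw⟩ := (hξ.1 S (awayFrom i) (le_awayFrom hi)).2 z
    -- Two ways of clearing denominators, one from the orbit and one from the open set along u_i =
    -- 0, compared after restriction to the orbit.
    have h1 : a • w = b • x := by
      apply res_injective hξ (le_orbit S)
      rw [ξ.res_smul, ξ.res_smul, ← hax, ξ.res_trans (le_awayFrom hi) (le_orbit _), ← hbw,
        ξ.res_smul, smul_comm]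
      congr 1
      exact toTorus_injective orbit (by simp only [toTorus_restr])
    obtain ⟨c, hc⟩ := exists_div_of_isUnit (le_awayFrom hi) hb (g w j)
    refine ⟨c, ?_⟩
    have hb0 : toTorus k S b ≠ 0 := fun h0 =>
      restr_ne_zero_of_isUnit hb (toTorus_injective S (h0.trans (map_zero _).symm))
    have h2 : toTorus k S a * toTorus k S (g w j) = toTorus k S b * toTorus k S (g x j) := by
      have h3 := congrFun (congrArg g h1) j
      simp only [map_smul, Pi.smul_apply, smul_eq_mul] at h3
      rw [← map_mul, h3, map_mul]
    rw [← hc, ← hq j] at h2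
    refine mul_left_cancel₀ (mul_ne_zero ha0 hb0) ?_
    rw [mul_assoc, h2]
    ring
  -- The exponents of `q j` satisfy the inequality for each i ∉ S separately, and the cone of `S` is
  -- cut out by exactly these inequalities.
  have hqS : ∀ j, ∃ r : chartRing k S, toTorus k S r = q j := by
    intro j
    refine mem_range_toTorus (q j) fun m hm => mem_cone_of_forall fun i hi => ?_
    by_contra hmi
    obtain ⟨c, hc⟩ := hqi j i hi
    rw [← hc, toTorus_coeff_of_notMem c hmi] at hm
    exact hm rfl
  choose r hr using hqS
  refine ⟨f r, ?_⟩
  have h4 : a • f r = x := by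
    rw [← map_smul, ← hfg' x]
    congr 1
    funext j
    apply toTorus_injective S
    rw [Pi.smul_apply, smul_eq_mul, map_mul, hr, hq]
  have h5 : restr k (le_orbit S) a • ξ.res (le_orbit S) (f r) = restr k (le_orbit S) a • y := by
    rw [← ξ.res_smul, h4, hax]
  exact (ha.smul_left_cancel).1 h5

/-- Injectivity comes from torsion-freeness and the injectivity of evaluation on invariant sections.
For surjectivity, u^m ⊗ v is hit as soon as u^m times the invariant section through v extends to
`U_S`; membership in the filtrations gives extension across each divisor, and `mem_range_res` does
the rest. -/
theorem toReesApp_bijective (hξ : isVectorBundle k ξ) (S : Idx) :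
    Function.Bijective (toReesApp ξ S) := by
  constructor
  · rw [injective_iff_map_eq_zero]
    intro x hx
    refine eq_zero_of_weight fun m => ?_
    have h1 : toOrbit ξ S x = 0 := congrArg Subtype.val hx
    have h2 : unitEval ξ (ξ.res (le_orbit S) (weight ξ S m x)) = 0 := by
      have h3 := congrArg (fun z => orbitCoeffs k S _ z m) h1
      simp only [map_zero] at h3
      refine Eq.trans ?_ h3
      exact (coeffs_lTensor (unitEval ξ ∘ₗ ξ.res (le_orbit S)) (ξ.coact S x) m).symm
    have hw := ((hasWeight_weight m x).res (le_orbit S))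
    have h3 := invariantPart_eq_zero h2
    rw [hw.invariantPart] at h3
    have h4 := mono_smul_injective ξ (-m) (h3.trans (smul_zero _).symm)
    exact res_injective hξ (le_orbit S) (h4.trans (map_zero _).symm)
  · rintro ⟨z, hz⟩
    have hmem : z ∈ LinearMap.range (toOrbit ξ S) := by
      induction hz using Submodule.span_induction with
      | mem z hz =>
        obtain ⟨m, v, hv, rfl⟩ := hz
        obtain ⟨y, hy, rfl⟩ := exists_invariant (ξ := ξ) v
        obtain ⟨x, hx⟩ := mem_range_res hξ S (y := mono (k := k) (orbitExp m) • y) (by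
          intro i hi
          obtain ⟨y', hy', hyy⟩ := hv i hi
          rw [hy.eq_of_unitEval_eq hy'.1 hyy.symm]
          exact hy'.2 _ (neg_neg _).symm)
        refine ⟨weight ξ S m x, ?_⟩
        rw [(hasWeight_weight m x).toOrbit, ← weight_res, hx, weight_eq_of_hasWeight
          (by simpa [orbitExp] using hy.smul (orbitExp m)), unitEval_mono_smul]
        rfl
      | zero => exact zero_mem _
      | add x y _ _ hx hy => exact add_mem hx hy
      | smul a x _ hx =>
        obtain ⟨y, rfl⟩ := hx
        exact ⟨a • y, toOrbit_smul a y⟩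
    obtain ⟨x, hx⟩ := hmem
    exact ⟨x, Subtype.ext hx⟩

/-- Finitely many generators have finitely many weights, and functions regular along u_i = 0 can
only raise the i-th exponent. This is why the filtration reaches 0. -/
theorem weight_eq_zero_of_small (hξ : isVectorBundle k ξ) (i : Fin 3) :
    ∃ B : ℤ, ∀ (n : charLattice), n.1 i < B → ∀ y : ξ.sec (awayFrom i),
      weight ξ (awayFrom i) n y = 0 := by
  classical
  obtain ⟨s, hs⟩ := (hξ.2 (awayFrom i)).1
  let T : Finset charLattice := s.biUnion fun g =>
    (coeffs k (ξ.sec (awayFrom i)) (ξ.coact (awayFrom i) g)).support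
  obtain ⟨B, hB⟩ : ∃ B : ℤ, ∀ m ∈ T, B ≤ m.1 i := by
    obtain ⟨B, hB⟩ := (T.finite_toSet.image fun m => m.1 i).bddBelow
    exact ⟨B, fun m hm => hB ⟨m, hm, rfl⟩⟩
  refine ⟨B, fun n hn y => ?_⟩
  have hy : y ∈ Submodule.span (chartRing k (awayFrom i)) (s : Set (ξ.sec (awayFrom i))) :=
    hs ▸ Submodule.mem_top
  induction hy using Submodule.span_induction generalizing n with
  | mem g hg =>
    by_contra h0
    have := hB n (Finset.mem_biUnion.2 ⟨g, hg, Finsupp.mem_support_iff.2 h0⟩)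
    omega
  | zero => rw [map_zero]
  | add x y _ _ hx hy => rw [map_add, hx n hn, hy n hn, add_zero]
  | smul a x _ hx =>
    induction a using AddMonoidAlgebra.induction_linear with
    | zero => rw [zero_smul, map_zero]
    | add f g hf hg => rw [add_smul, map_add, hf, hg, add_zero]
    | single m c =>
      rw [single_smul, LinearMap.map_smul, weight_mono_smul, hx, smul_zero, smul_zero]
      have := m.2 i (notMem_awayFrom.2 rfl)
      simp only [AddSubgroup.coe_sub, Pi.sub_apply]
      omega

/-- Quasi-coherence gives some function `a` with a x regular along u_i = 0, not necessarily a
monomial. As `x` is invariant, the weight n component of a x is the coefficient of a at n times u^n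
x, so a nonzero coefficient shows that u^n x is regular. -/
theorem exists_mem_poleSec (hξ : isVectorBundle k ξ) (i : Fin 3) {x : ξ.sec orbit}
    (hx : HasWeight ξ orbit x 0) : ∃ p, x ∈ poleSec ξ i p := by
  obtain ⟨a, y, ha, hay⟩ := (hξ.1 (awayFrom i) orbit (le_orbit _)).2 x
  have ha0 := restr_ne_zero_of_isUnit ha
  obtain ⟨n, hn⟩ : ∃ n, a.coeff n ≠ 0 := by
    by_contra! h
    exact ha0 (AddMonoidAlgebra.ext (Finsupp.ext h))
  have h1 : weight ξ orbit n.1 (restr k (le_orbit _) a • x) =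
      a.coeff n • (mono (k := k) (orbitExp n.1) • x) := by
    clear hay ha ha0 hn
    induction a using AddMonoidAlgebra.induction_linear with
    | zero => simp
    | add f g hf hg =>
      rw [map_add, add_smul, map_add, hf, hg, AddMonoidAlgebra.coeff_add, Finsupp.add_apply,
        add_smul]
    | single m c =>
      classical
      rw [restr_single, single_smul, LinearMap.map_smul, weight_apply, hx.smul, coeffs_chi_tmul,
        AddMonoidAlgebra.coeff_single, Finsupp.single_apply, Finsupp.single_apply, add_zero]
      have h2 : ((AddSubmonoid.inclusion (cone_mono (le_orbit (awayFrom i))) m : cone orbit) :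
          charLattice) = n.1 ↔ m = n := ⟨fun h => Subtype.ext h, fun h => h ▸ rfl⟩
      simp only [h2]
      split_ifs with h
      · subst h; rfl
      · simp
  rw [hay, weight_res] at h1
  refine ⟨-n.1.1 i, mem_poleSec_of hx (n := n.1) (by simp) ?_⟩
  refine ⟨(a.coeff n)⁻¹ • weight ξ _ n.1 y, ?_⟩
  rw [LinearMap.map_smul, h1, inv_smul_smul₀ hn]

/-- The fibre of a vector bundle at `(1:1:1)` is finite-dimensional with exhaustive filtrations. -/
theorem isTriFil_fibre (hξ : isVectorBundle k ξ) : isTriFil k (fibreObj ξ) := by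
  have hfin : Module.Finite k (unitFibre ξ) := by
    obtain ⟨s, hs⟩ := (hξ.2 orbit).1
    refine Module.Finite.of_fg_top (R := k) (Submodule.fg_def.2
      ⟨unitEval ξ '' s, s.finite_toSet.image _, top_le_iff.1 ?_⟩)
    rintro v -
    obtain ⟨x, rfl⟩ := unitEval_surjective ξ v
    have hx : x ∈ Submodule.span (chartRing k orbit) (s : Set (ξ.sec orbit)) :=
      hs ▸ Submodule.mem_top
    induction hx using Submodule.span_induction with
    | mem x hx => exact Submodule.subset_span ⟨x, hx, rfl⟩
    | zero => rw [map_zero]; exact zero_mem _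
    | add x y _ _ hx hy => rw [map_add]; exact add_mem hx hy
    | smul a x _ hx =>
      induction a using AddMonoidAlgebra.induction_linear with
      | zero => rw [zero_smul, map_zero]; exact zero_mem _
      | add f g hf hg => rw [add_smul, map_add]; exact add_mem hf hg
      | single m c =>
        rw [single_smul, LinearMap.map_smul, unitEval_mono_smul]
        exact Submodule.smul_mem _ _ hx
  have hanti : ∀ i, Antitone ((fibreObj ξ).F i) := fun i p q hpq =>
    Submodule.map_mono (poleSec_antitone ξ i hpq)
  refine ⟨hfin, fun i => ⟨hanti i, ?_, ?_⟩⟩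
  · obtain ⟨B, hB⟩ := weight_eq_zero_of_small hξ i
    -- The exponent tested at step 1 - B has i-th coordinate B - 1, just below the smallest possible
    -- weight.
    refine ⟨1 - B, eq_bot_iff.2 ?_⟩
    rintro _ ⟨x, hx, rfl⟩
    obtain ⟨n, hn⟩ := exists_exponent i (-(1 - B))
    obtain ⟨y, hy⟩ := hx.2 (orbitExp n) hn
    have h1 := weight_res (le_orbit (awayFrom i)) n y
    rw [hB n (by omega), map_zero, hy, weight_eq_of_hasWeight
      (by simpa [orbitExp] using HasWeight.smul (hasWeight_zero_iff.2 hx.1) (orbitExp n))] at h1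
    have h2 := mono_smul_injective ξ n (h1.trans (smul_zero _).symm)
    rw [h2, map_zero]
    exact zero_mem _
  · obtain ⟨s, hs⟩ := hfin
    have h1 : ∀ v : unitFibre ξ, ∃ p, v ∈ (fibreObj ξ).F i p := by
      intro v
      obtain ⟨x, hx, rfl⟩ := exists_invariant (ξ := ξ) v
      obtain ⟨p, hp⟩ := exists_mem_poleSec hξ i hx
      exact ⟨p, x, hp, rfl⟩
    choose p hp using h1
    obtain ⟨B, hB⟩ := (s.finite_toSet.image p).bddBelow
    refine ⟨B, top_le_iff.1 (hs.symm.le.trans (Submodule.span_le.2 fun v hv => ?_))⟩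
    exact hanti i (hB ⟨v, hv, rfl⟩) (hp v)

end Bundle

/-! ## The unit -/

section Unit

/-- The invariant section `1 ⊗ v` of a Rees bundle over the orbit. -/
def constSec (V : MultiFil k) : V.V →ₗ[k] (reesObj V).sec orbit :=
  (orbitMono k orbit 0).codRestrict ((reesSec V orbit).restrictScalars k) fun _ =>
    orbitMono_mem_reesSec fun i hi => absurd (Finset.mem_univ i) hi

theorem coe_constSec (V : MultiFil k) (v : V.V) :
    (show reesSec V orbit from constSec V v).1 = orbitMono k orbit 0 v := rfl

/-- The weight decomposition of a Rees bundle is its decomposition into coefficients. The coaction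
is compared inside k[T] ⊗ (k[T] ⊗ V), where the inclusion stays injective. -/
theorem hasWeight_rees_iff {V : MultiFil k} {S : Idx} {x : reesSec V S} {m : charLattice} :
    HasWeight (reesObj V) S x m ↔ ∃ v, x.1 = orbitMono k S m v := by
  have h1 : HasWeight (reesObj V) S x m ↔
      orbitCoact k V.V (reesIncl V S x) = chi m ⊗ₜ reesIncl V S x := by
    rw [← reesCoact_spec, ← LinearMap.lTensor_tmul]
    exact (reesIncl_lTensor_injective V S).eq_iff.symm
  rw [h1]
  constructor
  · intro h
    refine ⟨coeffs k V.V (reesIncl V S x) m, ?_⟩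
    apply coeffs_ext
    intro n
    have h2 : ∀ y : TorusRing k ⊗[k] V.V, coeffs k _ (orbitCoact k V.V y) n =
        chi n ⊗ₜ coeffs k V.V y n := by
      classical
      intro y
      induction y using orbit_induction with
      | h0 => simp
      | hadd x y hx hy => simp only [map_add, Finsupp.add_apply, hx, hy, TensorProduct.tmul_add]
      | h m c w =>
        rw [orbitCoact_single, coeffs_chi_tmul, coeffs_tmul, AddMonoidAlgebra.coeff_single,
          Finsupp.single_apply, Finsupp.single_apply]
        split_ifs with h
        · subst h
          rw [TensorProduct.tmul_smul, TensorProduct.smul_tmul']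
          simp [chi]
        · simp
    have h3 := h2 (reesIncl V S x)
    rw [h, coeffs_chi_tmul] at h3
    classical
    rw [orbitMono_def, coeffs_chi_tmul, Finsupp.single_apply]
    rw [Finsupp.single_apply] at h3
    split_ifs with hmn
    · subst hmn; rfl
    · rw [if_neg hmn] at h3
      have h4 := congrArg (fun z => coeffs k V.V z n) h3
      rw [map_zero, coeffs_chi_tmul, Finsupp.single_eq_same] at h4
      exact h4.symm
  · rintro ⟨v, hv⟩
    have : reesIncl V S x = chi m ⊗ₜ v := hv
    rw [this]
    exact orbitCoact_single m 1 v

theorem hasWeight_constSec (V : MultiFil k) (v : V.V) :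
    HasWeight (reesObj V) orbit (constSec V v) 0 :=
  hasWeight_rees_iff.2 ⟨v, rfl⟩

theorem constSec_mem_poleSec_iff {V : MultiFil k} (hV : ∀ i, Antitone (V.F i)) (i : Fin 3) (p : ℤ)
    (v : V.V) : constSec V v ∈ poleSec (reesObj V) i p → v ∈ V.F i p := by
  rintro ⟨-, h⟩
  obtain ⟨n, hn⟩ := exists_exponent i (-p)
  obtain ⟨y, hy⟩ := h (orbitExp n) hn
  have h1 : (show reesSec V (awayFrom i) from y).1 = orbitMono k (awayFrom i) n v := by
    refine (congrArg Subtype.val hy).trans ?_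
    refine (mono_smul_orbitMono (S := orbit) (orbitExp n) 0 v).trans ?_
    rw [add_zero]
    rfl
  have h2 := (mem_reesSec hV).1 (show reesSec V (awayFrom i) from y).2 n i (notMem_awayFrom.2 rfl)
  rw [h1, orbitCoeffs_mono, Finsupp.single_eq_same, hn, neg_neg] at h2
  exact h2

theorem constSec_mem_poleSec {V : MultiFil k} {i : Fin 3} {p : ℤ} {v : V.V} (hv : v ∈ V.F i p) :
    constSec V v ∈ poleSec (reesObj V) i p := by
  obtain ⟨n, hn⟩ := exists_exponent i (-p)
  refine mem_poleSec_of (hasWeight_constSec V v) hn.le ?_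
  have hmem : orbitMono k (awayFrom i) n v ∈ reesSec V (awayFrom i) :=
    orbitMono_mem_reesSec fun j hj => by
      rw [notMem_awayFrom.1 hj, hn, neg_neg]
      exact hv
  refine ⟨(⟨_, hmem⟩ : reesSec V (awayFrom i)), Subtype.ext ?_⟩
  refine Eq.trans ?_ (mono_smul_orbitMono (S := orbit) (orbitExp n) 0 v).symm
  rw [add_zero]
  rfl

/-- The canonical map from a filtered space to the fibre of its Rees bundle. -/
def toFibre (V : MultiFil k) : V ⟶ fibreObj (reesObj V) :=
  MultiFil.Hom.mk (V := V) (W := fibreObj (reesObj V)) (unitEval (reesObj V) ∘ₗ constSec V) (by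
    rintro i p _ ⟨v, hv, rfl⟩
    exact ⟨constSec V v, constSec_mem_poleSec hv, rfl⟩)

theorem toFibre_naturality {V W : MultiFil k} (f : V ⟶ W) :
    f ≫ toFibre W = toFibre V ≫ fibreMap ((reesFunctor k).map f) := by
  refine MultiFil.Hom.ext (LinearMap.ext fun v => ?_)
  change unitEval (reesObj W) (constSec W (f.lin v)) =
    unitEval (reesObj W) (((reesFunctor k).map f).app orbit (constSec V v))
  congr 1

theorem eq_constSec {V : MultiFil k} {x : (reesObj V).sec orbit}
    (hx : HasWeight (reesObj V) orbit x 0) : ∃ v, x = constSec V v := by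
  obtain ⟨v, hv⟩ := hasWeight_rees_iff.1 hx
  exact ⟨v, Subtype.ext hv⟩

theorem constSec_injective (V : MultiFil k) : Function.Injective (constSec V) := by
  intro v w h
  have h1 := congrArg (fun z => orbitCoeffs k orbit V.V (show reesSec V orbit from z).1 0) h
  simpa only [coe_constSec, orbitCoeffs_mono, Finsupp.single_eq_same] using h1

/-- The invariant sections of a Rees bundle over the orbit are the constants 1 ⊗ v, and evaluation
identifies invariant sections with the fibre. -/
theorem toFibre_bijective (V : MultiFil k) : Function.Bijective (toFibre V).lin := by
  constructor
  · intro v w h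
    exact constSec_injective V ((hasWeight_constSec V v).eq_of_unitEval_eq
      (hasWeight_constSec V w) h)
  · intro y
    obtain ⟨x, hx, rfl⟩ := exists_invariant (ξ := reesObj V) y
    obtain ⟨v, rfl⟩ := eq_constSec hx
    exact ⟨v, rfl⟩

theorem mem_of_toFibre_mem {V : MultiFil k} (hV : ∀ i, Antitone (V.F i)) {i : Fin 3} {p : ℤ}
    {v : V.V} (h : (toFibre V).lin v ∈ (fibreObj (reesObj V)).F i p) : v ∈ V.F i p := by
  obtain ⟨x, hx, hxv⟩ := h
  have := HasWeight.eq_of_unitEval_eq (hasWeight_zero_iff.2 hx.1) (hasWeight_constSec V v) hxv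
  rw [this] at hx
  exact constSec_mem_poleSec_iff hV i p v hx

end Unit

/-! ## The equivalence -/

section Equivalence

theorem EqSheaf.isIso_of_bijective {ξ η : EqSheaf k} (f : ξ ⟶ η)
    (hf : ∀ S, Function.Bijective (f.app S)) : IsIso f := by
  let e : ∀ S, ξ.sec S ≃ₗ[chartRing k S] η.sec S := fun S => LinearEquiv.ofBijective _ (hf S)
  have he : ∀ S x, e S x = f.app S x := fun _ _ => rfl
  have he' : ∀ S y, f.app S ((e S).symm y) = y := fun S y => (e S).apply_symm_apply y
  let g : η ⟶ ξ := EqSheaf.Hom.mk (ξ := η) (η := ξ) (fun S => (e S).symm)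
    (fun {S S'} h y => by
      apply (e S').injective
      change f.app S' _ = f.app S' _
      rw [f.app_res]
      exact (he' S' _).trans (congrArg (η.res h) (he' S y).symm))
    (fun S y => by
      have h1 := f.app_coact S ((e S).symm y)
      rw [he'] at h1
      rw [h1, ← LinearMap.lTensor_comp_apply]
      have h2 : ((e S).symm : η.sec S →ₗ[chartRing k S] ξ.sec S).restrictScalars k ∘ₗ
          (f.app S).restrictScalars k = LinearMap.id :=
        LinearMap.ext fun x => (e S).symm_apply_apply x
      exact ((congrArg (fun φ => LinearMap.lTensor (TorusRing k) φ _) h2).trans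
        (by rw [LinearMap.lTensor_id]; rfl)).symm)
  refine ⟨g, EqSheaf.Hom.ext (funext fun S => LinearMap.ext fun x => ?_),
    EqSheaf.Hom.ext (funext fun S => LinearMap.ext fun y => ?_)⟩
  · exact (e S).symm_apply_apply x
  · exact (e S).apply_symm_apply y

theorem EqSheaf.bijective_of_isIso {ξ η : EqSheaf k} (f : ξ ⟶ η) [IsIso f] (S : Idx) :
    Function.Bijective (f.app S) := by
  refine Function.bijective_iff_has_inverse.2 ⟨(inv f).app S, fun x => ?_, fun y => ?_⟩
  · have := congrArg (fun g : ξ ⟶ ξ => g.app S x) (IsIso.hom_inv_id f)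
    exact this
  · have := congrArg (fun g : η ⟶ η => g.app S y) (IsIso.inv_hom_id f)
    exact this

/-- A bijective compatible map need not have a compatible inverse; reflecting every filtration step
is what is missing. -/
theorem MultiFil.isIso_of_bijective {V W : MultiFil k} (f : V ⟶ W)
    (hf : Function.Bijective f.lin) (h : ∀ i p v, f.lin v ∈ W.F i p → v ∈ V.F i p) : IsIso f := by
  let e : V.V ≃ₗ[k] W.V := LinearEquiv.ofBijective _ hf
  let g : W ⟶ V := MultiFil.Hom.mk (V := W) (W := V) e.symm (by
    rintro i p _ ⟨w, hw, rfl⟩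
    refine h i p _ ?_
    exact (e.apply_symm_apply w).symm ▸ hw)
  exact ⟨g, MultiFil.Hom.ext (LinearMap.ext fun x => e.symm_apply_apply x),
    MultiFil.Hom.ext (LinearMap.ext fun x => e.apply_symm_apply x)⟩

/-- The Rees functor on triples. -/
abbrev triRees (k : Type u) [Field k] : TriFil k ⥤ Fib k :=
  (isVectorBundle k).lift ((isTriFil k).ι ⋙ reesFunctor k) isVectorBundle_rees

/-- The fibre functor on vector bundles. -/
abbrev triFibre (k : Type u) [Field k] : Fib k ⥤ TriFil k :=
  (isTriFil k).lift ((isVectorBundle k).ι ⋙ fibreFunctor k) fun ξ => isTriFil_fibre ξ.property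

theorem isIso_toRees (ξ : Fib k) : IsIso (toRees ξ.obj) :=
  EqSheaf.isIso_of_bijective _ (toReesApp_bijective ξ.property)

theorem isIso_toFibre (V : TriFil k) : IsIso (toFibre V.obj) :=
  MultiFil.isIso_of_bijective _ (toFibre_bijective V.obj) fun _ _ _ h =>
    mem_of_toFibre_mem (fun i => (V.property.2 i).1) h

/-- The equivalence between triples and equivariant vector bundles. -/
def triEquiv (k : Type u) [Field k] : TriFil k ≌ Fib k :=
  CategoryTheory.Equivalence.mk (triRees k) (triFibre k)
    (NatIso.ofComponents (fun V => (isTriFil k).isoMk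
      (X := V) (Y := (triRees k ⋙ triFibre k).obj V) (@asIso _ _ _ _ _ (isIso_toFibre V)))
      fun {V W} (f : V ⟶ W) => ObjectProperty.hom_ext _ (toFibre_naturality f.hom))
    (NatIso.ofComponents (fun ξ => (isVectorBundle k).isoMk
      (X := ξ) (Y := (triFibre k ⋙ triRees k).obj ξ) (@asIso _ _ _ _ _ (isIso_toRees ξ)))
      fun {ξ η} (f : ξ ⟶ η) => ObjectProperty.hom_ext _ (toRees_naturality f.hom)).symm

end Equivalence

/-! ## Cokernels of maps of Rees bundles -/

/-- A module in which some linearly independent family generates up to denominators in `T` becomes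
free after localization at `T`. -/
theorem free_localizedModule {R M ι : Type*} [CommRing R] [AddCommGroup M] [Module R M]
    (T : Submonoid R) {v : ι → M} (hv : LinearIndependent R v)
    (hgen : ∀ y : M, ∃ a ∈ T, a • y ∈ Submodule.span R (Set.range v)) :
    Module.Free (Localization T) (LocalizedModule T M) := by
  have hli := hv.of_isLocalizedModule (Localization T) T (LocalizedModule.mkLinearMap T M)
  refine Module.Free.of_basis (Module.Basis.mk hli ?_)
  rintro z -
  induction z using LocalizedModule.induction_on with
  | h y s =>
    obtain ⟨a, ha, hay⟩ := hgen y
    have h1 : ∀ w ∈ Submodule.span R (Set.range v), LocalizedModule.mkLinearMap T M w ∈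
        Submodule.span (Localization T) (Set.range (LocalizedModule.mkLinearMap T M ∘ v)) := by
      intro w hw
      induction hw using Submodule.span_induction with
      | mem w hw => obtain ⟨i, rfl⟩ := hw; exact Submodule.subset_span ⟨i, rfl⟩
      | zero => rw [map_zero]; exact zero_mem _
      | add x y _ _ hx hy => rw [map_add]; exact add_mem hx hy
      | smul c x _ hx =>
        rw [map_smul, ← algebraMap_smul (Localization T) c]
        exact Submodule.smul_mem _ _ hx
    have h2 : LocalizedModule.mk y s = Localization.mk 1 (s * ⟨a, ha⟩) •
        LocalizedModule.mkLinearMap T M (a • y) := by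
      rw [LocalizedModule.mkLinearMap_apply, LocalizedModule.mk_smul_mk, one_smul, mul_one]
      exact (LocalizedModule.mk_cancel_common_right (s := s) (s' := ⟨a, ha⟩) (m := y)).symm
    rw [h2]
    exact Submodule.smul_mem _ _ (h1 _ hay)

/-- The map induced on sections over the orbit by a linear map. -/
def orbitMap {V W : Type u} [AddCommGroup V] [Module k V] [AddCommGroup W] [Module k W] (S : Idx)
    (f : V →ₗ[k] W) : OrbitSec k S V →ₗ[chartRing k S] OrbitSec k S W where
  toFun := f.lTensor (TorusRing k)
  map_add' := map_add (f.lTensor (TorusRing k))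
  map_smul' a x := lTensor_torus_smul f (toTorus k S a) x

section OrbitMap

variable {V W : Type u} [AddCommGroup V] [Module k V] [AddCommGroup W] [Module k W] {S : Idx}

theorem orbitMap_mono (f : V →ₗ[k] W) (m : charLattice) (v : V) :
    orbitMap S f (orbitMono k S m v) = orbitMono k S m (f v) := LinearMap.lTensor_tmul _ _ _ _

theorem orbitCoeffs_orbitMap (f : V →ₗ[k] W) (x : OrbitSec k S V) (m : charLattice) :
    orbitCoeffs k S W (orbitMap S f x) m = f (orbitCoeffs k S V x m) := coeffs_lTensor f x m

end OrbitMap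

theorem coe_reesMap {V W : MultiFil k} (f : V ⟶ W) (S : Idx) (x : reesSec V S) :
    (reesMap f S x).1 = orbitMap S f.lin x.1 := rfl

theorem reesSec_induction {V : MultiFil k} (hV : ∀ i, Antitone (V.F i)) {S : Idx}
    {P : reesSec V S → Prop}
    (h : ∀ (m : charLattice) (w : V.V) (hw : ∀ i ∉ S.1, w ∈ V.F i (-m.1 i)),
      P ⟨orbitMono k S m w, orbitMono_mem_reesSec hw⟩)
    (hadd : ∀ x y, P x → P y → P (x + y)) (x : reesSec V S) : P x := by
  have hx : x = ∑ m ∈ (orbitCoeffs k S V.V x.1).support,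
      (⟨orbitMono k S m (orbitCoeffs k S V.V x.1 m),
        orbitMono_mem_reesSec ((mem_reesSec hV).1 x.2 m)⟩ : reesSec V S) := by
    apply Subtype.ext
    rw [Submodule.coe_sum]
    exact eq_sum_orbitMono x.1
  rw [hx]
  refine Finset.sum_induction _ P hadd ?_ fun m _ => h m _ ((mem_reesSec hV).1 x.2 m)
  have h0 := h 0 0 fun i _ => zero_mem _
  convert h0
  rw [map_zero]
  rfl

/-- The cokernel of a map of Rees bundles becomes free over a localization when the cokernel of the
map of vector spaces has a basis with suitable lifts. -/
theorem free_localized_coker {V W : MultiFil k} (hW : ∀ i, Antitone (W.F i)) (f : V ⟶ W) (S : Idx)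
    (T : Submonoid (chartRing k S)) {r : ℕ}
    (c : Module.Basis (Fin r) k (W.V ⧸ LinearMap.range f.lin)) (ε : Fin r → W.V)
    (hε : ∀ t, (LinearMap.range f.lin).mkQ (ε t) = c t) (n : Fin r → charLattice)
    (hn : ∀ t, ∀ i ∉ S.1, ε t ∈ W.F i (-(n t).1 i))
    (hgen : ∀ (m : charLattice) (w : W.V), (∀ i ∉ S.1, w ∈ W.F i (-m.1 i)) →
      ∃ b : cone S, mono b ∈ T ∧
        (∀ t, c.repr ((LinearMap.range f.lin).mkQ w) t ≠ 0 →
          ∀ i ∉ S.1, (n t).1 i ≤ b.1.1 i + m.1 i) ∧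
        ∃ v : V.V, (∀ i ∉ S.1, v ∈ V.F i (-(b.1.1 i + m.1 i))) ∧
          w - ∑ t, c.repr ((LinearMap.range f.lin).mkQ w) t • ε t = f.lin v) :
    Module.Free (Localization T)
      (LocalizedModule T (reesSec W S ⧸ LinearMap.range (reesMap f S))) := by
  let N := LinearMap.range (reesMap f S)
  let g : Fin r → reesSec W S := fun t => ⟨orbitMono k S (n t) (ε t), orbitMono_mem_reesSec (hn t)⟩
  -- Independence of the proposed generators is tested after mapping to the trivial bundle on the
  -- cokernel of the map of vector spaces.
  let π : reesSec W S →ₗ[chartRing k S] OrbitSec k S (W.V ⧸ LinearMap.range f.lin) :=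
    orbitMap S (LinearMap.range f.lin).mkQ ∘ₗ (reesSec W S).subtype
  have hπ : N ≤ LinearMap.ker π := by
    rintro _ ⟨x, rfl⟩
    rw [LinearMap.mem_ker]
    apply (orbitCoeffs k S _).injective
    ext m
    change orbitCoeffs k S _ (orbitMap S (LinearMap.range f.lin).mkQ (orbitMap S f.lin x.1)) m = _
    rw [orbitCoeffs_orbitMap, orbitCoeffs_orbitMap, map_zero, Finsupp.zero_apply,
      Submodule.mkQ_apply, Submodule.Quotient.mk_eq_zero]
    exact ⟨_, rfl⟩
  have hli : LinearIndependent (chartRing k S) (fun t => N.mkQ (g t)) := by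
    refine LinearIndependent.of_comp (N.liftQ π hπ) ?_
    have : N.liftQ π hπ ∘ (fun t => N.mkQ (g t)) = fun t => orbitMono k S (n t) (c t) := by
      funext t
      change orbitMap S (LinearMap.range f.lin).mkQ (orbitMono k S (n t) (ε t)) = _
      rw [orbitMap_mono, hε]
    rw [this]
    exact linearIndependent_orbitMono S c n
  refine free_localizedModule T hli fun y => ?_
  obtain ⟨x, rfl⟩ := N.mkQ_surjective y
  induction x using reesSec_induction hW with
  | h m w hw =>
    obtain ⟨b, hb, hc, v, hv, hwv⟩ := hgen m w hw
    refine ⟨mono b, hb, ?_⟩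
    -- Modulo the image, u^b u^m w is the combination of the generators with coefficients c_t
    -- u^{b+m-n_t}. The default value 0 is only used where the coordinate c_t vanishes.
    have h1 : (mono b : chartRing k S) • (⟨orbitMono k S m w, orbitMono_mem_reesSec hw⟩ :
          reesSec W S) -
        ∑ t, (if h : ∀ i ∉ S.1, (n t).1 i ≤ b.1.1 i + m.1 i then
          (AddMonoidAlgebra.single (⟨b.1 + m - n t, fun i hi => by
            have := h i hi
            change 0 ≤ b.1.1 i + m.1 i - (n t).1 i
            omega⟩ : cone S)
            (c.repr ((LinearMap.range f.lin).mkQ w) t) : chartRing k S) else 0) • g t ∈ N := by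
      have hvm : orbitMono k S (b.1 + m) v ∈ reesSec V S := orbitMono_mem_reesSec hv
      refine ⟨⟨_, hvm⟩, Subtype.ext ?_⟩
      rw [coe_reesMap, orbitMap_mono, ← hwv, map_sub, map_sum, Submodule.coe_sub,
        Submodule.coe_sum]
      refine congrArg₂ _ (mono_smul_orbitMono b m w).symm (Finset.sum_congr rfl fun t _ => ?_)
      rw [Submodule.coe_smul]
      split_ifs with h
      · refine Eq.trans ?_ (single_smul_orbitMono _ _ (n t) (ε t)).symm
        congr 1
        rw [sub_add_cancel]
      · have h0 : c.repr ((LinearMap.range f.lin).mkQ w) t = 0 := by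
          by_contra h0
          exact h (hc t h0)
        rw [h0, zero_smul, zero_smul, map_zero]
    have h2 := (Submodule.Quotient.eq N).2 h1
    rw [← map_smul]
    refine (congrArg (· ∈ _) h2).mpr ?_
    change N.mkQ _ ∈ _
    rw [map_sum]
    refine Submodule.sum_mem _ fun t _ => ?_
    rw [map_smul]
    exact Submodule.smul_mem _ _ (Submodule.subset_span ⟨t, rfl⟩)
  | hadd x y hx hy =>
    obtain ⟨a, ha, hax⟩ := hx
    obtain ⟨b, hb, hby⟩ := hy
    refine ⟨a * b, T.mul_mem ha hb, ?_⟩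
    rw [map_add, smul_add]
    refine add_mem ?_ ?_
    · rw [mul_comm, mul_smul]; exact Submodule.smul_mem _ _ hax
    · rw [mul_smul]; exact Submodule.smul_mem _ _ hby

/-! ### Points of a chart and cokernels of strict maps. -/

theorem notMem_chart {i l : Fin 3} : i ∉ (chart l).1 ↔ i ≠ l := by simp [chart]

/-- The exponent of the coordinate `u_i / u_l` on the chart `U_l`. -/
def coord (l i : Fin 3) : cone (chart l) := ⟨ratio l i, fun j hj => by
  have : j ≠ l := notMem_chart.1 hj
  simp only [ratio, Pi.sub_apply, Pi.single_apply, this, if_false, sub_zero]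
  split_ifs <;> simp⟩

theorem coord_apply {l j : Fin 3} (i : Fin 3) (hj : j ≠ l) :
    (coord l i).1.1 j = if j = i then 1 else 0 := by
  simp only [coord, ratio, Pi.sub_apply, Pi.single_apply, hj, if_false, sub_zero]

theorem exists_third {l i : Fin 3} (h : i ≠ l) :
    ∃ j, j ≠ l ∧ j ≠ i ∧ ∀ i', i' ≠ l → i' = i ∨ i' = j := by
  revert l i; decide

theorem charLattice_ext {l : Fin 3} {m n : charLattice} (h : ∀ i, i ≠ l → m.1 i = n.1 i) : m = n := by
  apply Subtype.ext
  have h1 := charLattice_sum m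
  have h2 := charLattice_sum n
  funext i
  by_cases hi : i = l
  · subst hi
    have h3 : ∀ j, j ≠ i → m.1 j = n.1 j := h
    fin_cases i
    · have := h3 1 (by decide); have := h3 2 (by decide); simp only [Fin.zero_eta]; omega
    · have := h3 0 (by decide); have := h3 2 (by decide); simp only [Fin.mk_one]; omega
    · have := h3 0 (by decide); have := h3 1 (by decide); simp only [Fin.reduceFinMk]; omega
  · exact h i hi

/-- A point of the chart `U_l` other than the coordinate point lies off one of the axes. -/
theorem exists_coord_notMem {l : Fin 3} {x : PrimeSpectrum (chartRing k (chart l))}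
    (hx : x.asIdeal ≠ pointIdeal k l) :
    ∃ i : Fin 3, i ≠ l ∧ (mono (coord l i) : chartRing k (chart l)) ∉ x.asIdeal := by
  by_contra! hcon
  have h1 : pointIdeal k l ≤ x.asIdeal := by
    refine Ideal.span_le.2 ?_
    rintro _ ⟨m, hm, rfl⟩
    obtain ⟨i, hi, him⟩ : ∃ i, i ≠ l ∧ 0 < m.1.1 i := by
      by_contra! h
      refine hm (Subtype.ext (charLattice_ext (l := l) fun i hi => ?_))
      exact le_antisymm (h i hi) (m.2 i (notMem_chart.2 hi))
    have hc : m.1 - (coord l i).1 ∈ cone (chart l) := by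
      intro j hj
      have h2 := m.2 j hj
      have h3 := coord_apply i (notMem_chart.1 hj)
      change 0 ≤ m.1.1 j - (coord l i).1.1 j
      rw [h3]
      split_ifs with hji
      · subst hji; omega
      · omega
    have h4 : (mono m : chartRing k (chart l)) = mono ⟨_, hc⟩ * mono (coord l i) := by
      rw [mono_mul_mono]
      congr 1
      exact Subtype.ext (sub_add_cancel _ _).symm
    rw [h4]
    exact Ideal.mul_mem_left _ _ (hcon i hi)
  refine hx (le_antisymm (fun a ha => ?_) h1)
  -- Modulo the ideal of the coordinate point every function is its constant term, and a prime ideal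
  -- contains no nonzero constant. Hence that ideal is all of the prime.
  have h2 : ∀ a : chartRing k (chart l),
      a - AddMonoidAlgebra.single 0 (a.coeff 0) ∈ pointIdeal k l := by
    intro a
    induction a using AddMonoidAlgebra.induction_linear with
    | zero => simp
    | add f g hf hg =>
      rw [AddMonoidAlgebra.coeff_add, Finsupp.add_apply, AddMonoidAlgebra.single_add,
        add_sub_add_comm]
      exact add_mem hf hg
    | single m c =>
      by_cases hm : m = 0
      · subst hm; simp
      · have h3 : (AddMonoidAlgebra.single m c : chartRing k (chart l)).coeff 0 = 0 := by
          rw [AddMonoidAlgebra.coeff_single, Finsupp.single_eq_of_ne (Ne.symm hm)]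
        rw [h3, AddMonoidAlgebra.single_zero, sub_zero, single_eq_smul_mono]
        exact Submodule.smul_of_tower_mem _ c (Ideal.subset_span ⟨m, hm, rfl⟩)
  by_cases h0 : a.coeff 0 = 0
  · simpa [h0] using h2 a
  · exfalso
    have h3 : (AddMonoidAlgebra.single 0 (a.coeff 0) : chartRing k (chart l)) ∈ x.asIdeal := by
      have := sub_mem ha (h1 (h2 a))
      simpa using this
    refine x.isPrime.ne_top (Ideal.eq_top_of_isUnit_mem _ h3 ?_)
    refine IsUnit.of_mul_eq_one (AddMonoidAlgebra.single 0 (a.coeff 0)⁻¹) ?_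
    rw [AddMonoidAlgebra.single_mul_single, add_zero, mul_inv_cancel₀ h0]
    rfl

theorem quotient_filtration {V : Type u} [AddCommGroup V] [Module k V] (N : Submodule k V)
    {F : ℤ → Submodule k V} (hF : Antitone F ∧ (∃ p, F p = ⊥) ∧ ∃ q, F q = ⊤) :
    Antitone (fun p => (F p).map N.mkQ) ∧ (∃ p, (F p).map N.mkQ = ⊥) ∧
      ∃ q, (F q).map N.mkQ = ⊤ := by
  obtain ⟨h1, ⟨p, hp⟩, ⟨q, hq⟩⟩ := hF
  refine ⟨fun a b hab => Submodule.map_mono (h1 hab), ⟨p, ?_⟩, ⟨q, ?_⟩⟩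
  · rw [hp, Submodule.map_bot]
  · rw [hq, Submodule.map_top, Submodule.range_mkQ]

theorem exists_le_eq_top {V : Type u} [AddCommGroup V] [Module k V] {F : ℤ → Submodule k V}
    (hF : Antitone F ∧ (∃ p, F p = ⊥) ∧ ∃ q, F q = ⊤) : ∃ q, ∀ p ≤ q, F p = ⊤ := by
  obtain ⟨h1, -, ⟨q, hq⟩⟩ := hF
  exact ⟨q, fun p hp => top_le_iff.1 (hq ▸ h1 hp)⟩

/-- The cokernel of a strict map is free away from the coordinate points. -/
theorem free_coker_of_strict {V W : TriFil k} (f : V ⟶ W) (hf : strict k f) (l : Fin 3)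
    (x : PrimeSpectrum (chartRing k (chart l))) (hx : x.asIdeal ≠ pointIdeal k l) :
    Module.Free (Localization.AtPrime x.asIdeal)
      (LocalizedModule x.asIdeal.primeCompl
        (reesSec W.obj (chart l) ⧸ LinearMap.range (reesMap f.hom (chart l)))) := by
  have hA : ∀ i, Antitone (W.obj.F i) := fun i => (W.property.2 i).1
  obtain ⟨i, hi, hxi⟩ := exists_coord_notMem hx
  obtain ⟨j, hjl, hji, hj⟩ := exists_third hi
  have := W.property.1
  have hQ := quotient_filtration (LinearMap.range f.hom.lin) (W.property.2 j)
  -- Since u_i / u_l is invertible at the point, only F_j counts: the basis of the cokernel is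
  -- adapted to the filtration induced by F_j, and its lifts are chosen in F_j.
  obtain ⟨c, -, q, -, -, hc, -⟩ := exists_adapted _ rfl _ _ _ hQ hQ hQ
  choose ε hε hε' using fun t => hc.mem_self t
  obtain ⟨A, hAtop⟩ := exists_le_eq_top (W.property.2 i)
  obtain ⟨B, hBtop⟩ := exists_le_eq_top (V.property.2 i)
  let n : Fin _ → charLattice := fun t => expo l fun i' => if i' = i then A else q t
  have hni : ∀ t, (n t).1 i = -A := fun t => by rw [expo_apply_of_ne hi, if_pos rfl]
  have hnj : ∀ t, (n t).1 j = -q t := fun t => by rw [expo_apply_of_ne hjl, if_neg hji]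
  have hcases : ∀ {P : Fin 3 → Prop}, P i → P j → ∀ i' ∉ (chart l).1, P i' := by
    intro P h1 h2 i' hi'
    rcases hj i' (notMem_chart.1 hi') with rfl | rfl
    exacts [h1, h2]
  refine free_localized_coker hA f.hom (chart l) _ c ε hε' n (fun t => hcases ?_ ?_) ?_
  · rw [hni, neg_neg, hAtop A le_rfl]; exact Submodule.mem_top
  · rw [hnj, neg_neg]; exact hε t
  intro m w hw
  have hwj := hw j (notMem_chart.2 hjl)
  have hrepr := (hc (-m.1 j) ((LinearMap.range f.hom.lin).mkQ w)).1 ⟨w, hwj, rfl⟩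
  -- A power of u_i / u_l that makes the F_i-conditions empty, on the target through `A` and on the
  -- source through `B`.
  obtain ⟨b, hb1, hb2⟩ : ∃ b : ℕ, -A ≤ b + m.1 i ∧ -B ≤ b + m.1 i :=
    ⟨(-A - m.1 i).toNat + (-B - m.1 i).toNat, by omega, by omega⟩
  have hbi : (b • coord l i).1.1 i = b := by
    change (b • (coord l i).1.1) i = b
    rw [Pi.smul_apply, coord_apply i hi, if_pos rfl]; simp
  have hbj : (b • coord l i).1.1 j = 0 := by
    change (b • (coord l i).1.1) j = 0
    rw [Pi.smul_apply, coord_apply i hjl, if_neg hji]; simp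
  refine ⟨b • coord l i, ?_, fun t ht => hcases ?_ ?_, ?_⟩
  · rw [← mono_pow]
    exact fun h => hxi (x.isPrime.mem_of_pow_mem b h)
  · rw [hni, hbi]; exact hb1
  · rw [hnj, hbj]
    have := hrepr t ht
    omega
  · have h1 : w - ∑ t, c.repr ((LinearMap.range f.hom.lin).mkQ w) t • ε t ∈
        LinearMap.range f.hom.lin ⊓ W.obj.F j (-m.1 j) := by
      refine ⟨?_, sub_mem hwj (Submodule.sum_mem _ fun t _ => ?_)⟩
      · refine (Submodule.Quotient.mk_eq_zero _).1 ?_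
        change (LinearMap.range f.hom.lin).mkQ _ = 0
        rw [map_sub, map_sum, sub_eq_zero]
        refine (c.sum_repr ((LinearMap.range f.hom.lin).mkQ w)).symm.trans ?_
        exact Finset.sum_congr rfl fun t _ => by rw [map_smul, hε']
      · by_cases h0 : c.repr ((LinearMap.range f.hom.lin).mkQ w) t = 0
        · rw [h0, zero_smul]; exact zero_mem _
        · exact Submodule.smul_mem _ _ (hA j (hrepr t h0) (hε t))
    -- Strictness for F_j: the error term lies in the image and in the F_j-step, so it comes from
    -- that step of the source.
    rw [← hf j] at h1
    obtain ⟨v, hv, hvw⟩ := h1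
    refine ⟨v, hcases ?_ ?_, hvw.symm⟩
    · rw [hbi, hBtop _ (by omega)]; exact Submodule.mem_top
    · rw [hbj, zero_add]; exact hv

/-! ### Divisors u_i = 0 and the strictness of maps with free cokernel. -/

/-- Restriction of functions on `U_S` to the orbit in the divisor `u_i = 0`. -/
def edge (k : Type u) [Field k] {S : Idx} {i : Fin 3} (hi : i ∉ S.1) :
    chartRing k S →ₐ[k] TorusRing k :=
  AddMonoidAlgebra.lift k (TorusRing k) (cone S)
    { toFun := fun m => if m.toAdd.1.1 i = 0 then chi m.toAdd.1 else 0
      map_one' := if_pos rfl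
      map_mul' := fun m n => by
        have h1 := m.toAdd.2 i hi
        have h2 := n.toAdd.2 i hi
        have h3 : (m * n).toAdd.1.1 i = m.toAdd.1.1 i + n.toAdd.1.1 i := rfl
        rw [h3]
        by_cases hm : m.toAdd.1.1 i = 0
        · by_cases hn : n.toAdd.1.1 i = 0
          · rw [if_pos (by omega), if_pos hm, if_pos hn]
            simp [chi]
          · rw [if_neg (by omega), if_neg hn, mul_zero]
        · rw [if_neg (by omega), if_neg hm, zero_mul] }

theorem edge_single {S : Idx} {i : Fin 3} (hi : i ∉ S.1) (m : cone S) (c : k) :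
    edge k hi (AddMonoidAlgebra.single m c) =
      if m.1.1 i = 0 then AddMonoidAlgebra.single m.1 c else 0 := by
  rw [edge, AddMonoidAlgebra.lift_single]
  change c • (if m.1.1 i = 0 then chi m.1 else 0) = _
  split_ifs
  · simp [chi]
  · simp

theorem edge_coeff {S : Idx} {i : Fin 3} (hi : i ∉ S.1) (a : chartRing k S) (m : cone S) :
    (edge k hi a).coeff m.1 = if m.1.1 i = 0 then a.coeff m else 0 := by
  induction a using AddMonoidAlgebra.induction_linear with
  | zero => simp
  | add f g hf hg =>
    rw [map_add, AddMonoidAlgebra.coeff_add, Finsupp.add_apply, hf, hg,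
      AddMonoidAlgebra.coeff_add, Finsupp.add_apply]
    split_ifs <;> simp
  | single n c =>
    classical
    rw [edge_single]
    by_cases hnm : n = m
    · subst hnm
      split_ifs <;> simp
    · have h1 : n.1 ≠ m.1 := fun h => hnm (Subtype.ext h)
      have h2 : (AddMonoidAlgebra.single n c : chartRing k S).coeff m = 0 := by
        rw [AddMonoidAlgebra.coeff_single, Finsupp.single_eq_of_ne (Ne.symm hnm)]
      have h3 : (AddMonoidAlgebra.single n.1 c : TorusRing k).coeff m.1 = 0 := by
        rw [AddMonoidAlgebra.coeff_single, Finsupp.single_eq_of_ne (Ne.symm h1)]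
      rw [h2, ite_self]
      split_ifs
      · exact h3
      · simp

theorem edge_coeff_of_notMem {S : Idx} {i : Fin 3} (hi : i ∉ S.1) (a : chartRing k S)
    {m : charLattice} (hm : m ∉ cone S) : (edge k hi a).coeff m = 0 := by
  induction a using AddMonoidAlgebra.induction_linear with
  | zero => simp
  | add f g hf hg => rw [map_add, AddMonoidAlgebra.coeff_add, Finsupp.add_apply, hf, hg, add_zero]
  | single n c =>
    rw [edge_single]
    split_ifs
    · rw [AddMonoidAlgebra.coeff_single, Finsupp.single_eq_of_ne]
      rintro rfl
      exact hm n.2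
    · simp

theorem exists_coeff_ne_zero {S : Idx} {i : Fin 3} (hi : i ∉ S.1) {a : chartRing k S}
    (ha : edge k hi a ≠ 0) : ∃ n : cone S, n.1.1 i = 0 ∧ a.coeff n ≠ 0 := by
  by_contra! h
  refine ha (AddMonoidAlgebra.ext (Finsupp.ext fun m => ?_))
  by_cases hm : m ∈ cone S
  · rw [edge_coeff hi a ⟨m, hm⟩]
    split_ifs with h0
    · exact h ⟨m, hm⟩ h0
    · rfl
  · exact edge_coeff_of_notMem hi a hm

theorem coeffs_smul_orbitMono {V : Type u} [AddCommGroup V] [Module k V] {S : Idx}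
    (a : chartRing k S) (m : charLattice) (w : V) (n : cone S) :
    orbitCoeffs k S V (a • orbitMono k S m w) (n.1 + m) = a.coeff n • w := by
  classical
  induction a using AddMonoidAlgebra.induction_linear with
  | zero => simp
  | add f g hf hg =>
    rw [add_smul, map_add (orbitCoeffs k S V), Finsupp.add_apply, hf, hg,
      AddMonoidAlgebra.coeff_add, Finsupp.add_apply, add_smul]
  | single n' c =>
    rw [single_smul_orbitMono, orbitCoeffs_mono, AddMonoidAlgebra.coeff_single,
      Finsupp.single_apply, Finsupp.single_apply]
    simp only [add_left_inj, Subtype.ext_iff]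
    split_ifs <;> simp

/-- A map whose cokernel is free at the generic points of the coordinate lines is strict. -/
theorem strict_of_free_coker {V W : TriFil k} (f : V ⟶ W)
    (hf : cokerFreeOutside k Set.univ ((triRees k).map f)) : strict k f := by
  intro i p
  refine le_antisymm (le_inf LinearMap.map_le_range (f.hom.map_le i p)) ?_
  rintro _ ⟨⟨v, rfl⟩, hw⟩
  obtain ⟨l, hl⟩ : ∃ l : Fin 3, i ≠ l := ⟨i + 1, by fin_cases i <;> decide⟩
  obtain ⟨j, hjl, hji, hj⟩ := exists_third hl
  have hcases : ∀ {P : Fin 3 → Prop}, P i → P j → ∀ i' ∉ (chart l).1, P i' := by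
    intro P h1 h2 i' hi'
    rcases hj i' (notMem_chart.1 hi') with rfl | rfl
    exacts [h1, h2]
  have hi : i ∉ (chart l).1 := notMem_chart.2 hl
  -- The generic point of the divisor u_i = 0: its prime is the kernel of restriction to the
  -- divisor.
  obtain ⟨x, hxI⟩ : ∃ x : PrimeSpectrum (chartRing k (chart l)),
      ∀ a, a ∈ x.asIdeal ↔ edge k hi a = 0 :=
    ⟨⟨RingHom.ker (edge k hi), RingHom.ker_isPrime _⟩, fun _ => Iff.rfl⟩
  have := x.isPrime
  have hedge : ∀ m : cone (chart l), m.1.1 i = 0 → edge k hi (mono m) ≠ 0 := by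
    intro m hm h0
    rw [mono, edge_single, if_pos hm] at h0
    simp at h0
  have hx : x.asIdeal ≠ pointIdeal k l := by
    intro h
    have h1 : (mono (coord l j) : chartRing k (chart l)) ∈ x.asIdeal := by
      rw [h]
      refine Ideal.subset_span ⟨_, fun h0 => ?_, rfl⟩
      have := coord_apply j hjl
      rw [h0, if_pos rfl] at this
      exact zero_ne_one this
    exact hedge _ (by rw [coord_apply j hl, if_neg (Ne.symm hji)]) ((hxI _).1 h1)
  have hfree := hf l x fun _ => hx
  change Module.Free (Localization.AtPrime x.asIdeal) (LocalizedModule x.asIdeal.primeCompl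
    (reesSec W.obj (chart l) ⧸ LinearMap.range (reesMap f.hom (chart l)))) at hfree
  -- `A` and `B` serve to choose an exponent for which the F_j-conditions on target and source are
  -- empty; below `C` the filtration F_i of the source is the whole space.
  obtain ⟨A, hA⟩ := exists_le_eq_top (W.property.2 j)
  obtain ⟨B, hB⟩ := exists_le_eq_top (V.property.2 j)
  obtain ⟨C, hC⟩ := exists_le_eq_top (V.property.2 i)
  let m : charLattice := expo l fun i' => if i' = i then p else min A B
  have hmi : m.1 i = -p := by
    have := expo_apply_of_ne hl fun i' => if i' = i then p else min A B
    rwa [if_pos rfl] at this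
  have hmj : m.1 j = -(min A B) := by
    have := expo_apply_of_ne hjl fun i' => if i' = i then p else min A B
    rwa [if_neg hji] at this
  have hmem : orbitMono k (chart l) m (f.hom.lin v) ∈ reesSec W.obj (chart l) := by
    refine orbitMono_mem_reesSec (hcases ?_ ?_)
    · rw [hmi, neg_neg]; exact hw
    · rw [hmj, neg_neg, hA _ (min_le_left _ _)]; exact Submodule.mem_top
  let N := LinearMap.range (reesMap f.hom (chart l))
  let y : reesSec W.obj (chart l) ⧸ N := N.mkQ ⟨_, hmem⟩
  obtain ⟨a, ha⟩ : ∃ a : ℕ, -C ≤ a - p := ⟨(p - C).natAbs, by omega⟩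
  have hai : (a • coord l i).1.1 i = a := by
    change (a • (coord l i).1.1) i = a
    rw [Pi.smul_apply, coord_apply i hl, if_pos rfl]; simp
  have haj : (a • coord l i).1.1 j = 0 := by
    change (a • (coord l i).1.1) j = 0
    rw [Pi.smul_apply, coord_apply i hjl, if_neg hji]; simp
  -- The class of u^m ⊗ f v is torsion: after multiplication by a power of u_i / u_l the vector `v`
  -- itself defines a section of the source.
  have hay : (mono (a • coord l i) : chartRing k (chart l)) • y = 0 := by
    rw [← map_smul, Submodule.mkQ_apply, Submodule.Quotient.mk_eq_zero]
    have h1 : orbitMono k (chart l) ((a • coord l i).1 + m) v ∈ reesSec V.obj (chart l) := by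
      refine orbitMono_mem_reesSec (hcases ?_ ?_)
      · change v ∈ V.obj.F i (-((a • coord l i).1.1 i + m.1 i))
        rw [hai, hmi, hC _ (by omega)]; exact Submodule.mem_top
      · change v ∈ V.obj.F j (-((a • coord l i).1.1 j + m.1 j))
        rw [haj, hmj, zero_add, neg_neg, hB _ (min_le_right _ _)]; exact Submodule.mem_top
    refine ⟨⟨_, h1⟩, Subtype.ext ?_⟩
    rw [coe_reesMap, orbitMap_mono, Submodule.coe_smul]
    exact (mono_smul_orbitMono _ _ _).symm
  have hzero : LocalizedModule.mkLinearMap x.asIdeal.primeCompl _ y = 0 := by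
    have h1 := congrArg (LocalizedModule.mkLinearMap x.asIdeal.primeCompl _) hay
    rw [map_smul, map_zero, ← algebraMap_smul (Localization.AtPrime x.asIdeal)] at h1
    obtain ⟨ι, b⟩ := hfree.exists_basis
    apply b.repr.injective
    rw [map_zero]
    ext s
    have h2 := congrArg (fun z => b.repr z s) h1
    simp only [map_smul, Finsupp.smul_apply, map_zero, Finsupp.zero_apply, smul_eq_mul] at h2
    refine (mul_eq_zero.1 h2).resolve_left fun h3 => ?_
    rw [IsLocalization.map_eq_zero_iff x.asIdeal.primeCompl] at h3
    obtain ⟨s, hs⟩ := h3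
    rcases mul_eq_zero.1 hs with h4 | h4
    · exact s.2 (h4 ▸ zero_mem _)
    · simp [mono] at h4
  obtain ⟨s, hs⟩ := (IsLocalizedModule.eq_zero_iff x.asIdeal.primeCompl
    (LocalizedModule.mkLinearMap x.asIdeal.primeCompl _)).1 hzero
  -- Freeness makes the torsion class vanish locally, so some `s` not vanishing on the divisor kills
  -- it. A monomial of `s` with i-th exponent 0 keeps the F_i-degree equal to `p`; the corresponding
  -- coefficient of a preimage is, up to a scalar, the vector of F_i^p sought.
  obtain ⟨n, hn, hsn⟩ := exists_coeff_ne_zero hi (fun h0 => s.2 ((hxI _).2 h0) : edge k hi s.1 ≠ 0)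
  have hs' : N.mkQ (s.1 • ⟨_, hmem⟩) = 0 := by rw [map_smul]; exact hs
  obtain ⟨z, hz⟩ := (Submodule.Quotient.mk_eq_zero N).1 hs'
  have h5 := congrArg (fun z => orbitCoeffs k (chart l) W.obj.V z.1 (n.1 + m)) hz
  simp only [coe_reesMap, orbitCoeffs_orbitMap, Submodule.coe_smul] at h5
  rw [coeffs_smul_orbitMono] at h5
  have h6 := (mem_reesSec fun i => (V.property.2 i).1).1 z.2 (n.1 + m) i hi
  have h7 : -(n.1 + m).1 i = p := by
    change -(n.1.1 i + m.1 i) = p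
    omega
  rw [h7] at h6
  refine ⟨(s.1.coeff n)⁻¹ • orbitCoeffs k (chart l) V.obj.V z.1 (n.1 + m),
    Submodule.smul_mem _ _ h6, ?_⟩
  rw [map_smul, h5, inv_smul_smul₀ hsn]

theorem cokerFreeOutside_univ_iff {V W : TriFil k} (f : V ⟶ W) :
    cokerFreeOutside k Set.univ ((triRees k).map f) ↔ strict k f :=
  ⟨strict_of_free_coker f, fun hf l x hx => free_coker_of_strict f hf l x (hx trivial)⟩

/-! ## Restricting the equivalence -/

section Restrict

/-- The isomorphism on sections given by an isomorphism of vector bundles. -/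
def appEquiv {ξ η : Fib k} (α : ξ ≅ η) (S : Idx) : ξ.obj.sec S ≃ₗ[chartRing k S] η.obj.sec S :=
  LinearEquiv.ofBijective (α.hom.hom.app S) (by
    have : IsIso α.hom.hom := ((isVectorBundle k).ι.mapIso α).isIso_hom
    exact EqSheaf.bijective_of_isIso α.hom.hom S)

theorem appEquiv_apply {ξ η : Fib k} (α : ξ ≅ η) (S : Idx) (x : ξ.obj.sec S) :
    appEquiv α S x = α.hom.hom.app S x := rfl

theorem free_localized_of_equiv {R M N : Type*} [CommRing R] [AddCommGroup M] [Module R M]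
    [AddCommGroup N] [Module R N] (T : Submonoid R) (e : M ≃ₗ[R] N)
    (h : Module.Free (Localization T) (LocalizedModule T M)) :
    Module.Free (Localization T) (LocalizedModule T N) :=
  Module.Free.of_equiv (IsLocalizedModule.mapEquiv T (LocalizedModule.mkLinearMap T M)
    (LocalizedModule.mkLinearMap T N) (Localization T) e)

instance (Z : Set (Fin 3)) : (cokerFreeOutside k Z).RespectsIso :=
  MorphismProperty.RespectsIso.mk _
    (fun {ξ η ζ} α f hf i x hx => by
      refine free_localized_of_equiv _ (Submodule.quotEquivOfEq _ _ ?_) (hf i x hx)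
      change _ = LinearMap.range (f.hom.app (chart i) ∘ₗ (appEquiv α (chart i)).toLinearMap)
      rw [LinearMap.range_comp, LinearEquiv.range, Submodule.map_top])
    (fun {ξ η ζ} α f hf i x hx => by
      refine free_localized_of_equiv _
        (Submodule.Quotient.equiv _ _ (appEquiv α (chart i)) ?_) (hf i x hx)
      rw [← LinearMap.range_comp]
      rfl)

theorem isomorphisms_le_cokerFreeOutside (Z : Set (Fin 3)) :
    MorphismProperty.isomorphisms (Fib k) ≤ cokerFreeOutside k Z := by
  intro ξ η f (hf : IsIso f) i x _
  have h : LinearMap.range (f.hom.app (chart i)) = ⊤ :=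
    LinearMap.range_eq_top.2 (appEquiv (asIso f) (chart i)).surjective
  have : Subsingleton (η.obj.sec (chart i) ⧸ LinearMap.range (f.hom.app (chart i))) :=
    Submodule.Quotient.subsingleton_iff.2 h
  have : Subsingleton (LocalizedModule x.asIdeal.primeCompl
    (η.obj.sec (chart i) ⧸ LinearMap.range (f.hom.app (chart i)))) := inferInstance
  exact Module.Free.of_subsingleton _ _

theorem isomorphisms_le_strict : MorphismProperty.isomorphisms (TriFil k) ≤ strict k := by
  intro V W f (hf : IsIso f) i p
  refine le_antisymm (le_inf LinearMap.map_le_range (f.hom.map_le i p)) ?_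
  rintro w ⟨-, hw⟩
  refine ⟨(inv f).hom.lin w, (inv f).hom.map_le i p ⟨w, hw, rfl⟩, ?_⟩
  exact congrArg (fun g : W ⟶ W => g.hom.lin w) (IsIso.inv_hom_id f)

/-- When both classes contain the isomorphisms, criteria for the functor alone are enough: the
statements for the inverse follow by conjugating with the counit, which changes neither `Q` nor
`W'`. -/
theorem restrictsToEquivalence {C D : Type*} [Category C] [Category D] {e : C ≌ D}
    {P : ObjectProperty C} {W : MorphismProperty C} {Q : ObjectProperty D}
    {W' : MorphismProperty D} [Q.IsClosedUnderIsomorphisms] [W'.RespectsIso]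
    (hobj : ∀ X, Q (e.functor.obj X) ↔ P X)
    (hmap : ∀ {X X'} (f : X ⟶ X'), P X → P X' → (W' (e.functor.map f) ↔ W f))
    (hW : MorphismProperty.isomorphisms C ≤ W) (hW' : MorphismProperty.isomorphisms D ≤ W') :
    RestrictsToEquivalence e P W Q W' := by
  have hinv : ∀ Y, Q Y → P (e.inverse.obj Y) := fun Y hY =>
    (hobj _).1 (Q.prop_of_iso (e.counitIso.app Y).symm hY)
  refine ⟨fun X hX => (hobj X).2 hX, hinv, hmap, fun {Y Y'} g hY hY' => ?_,
    fun X _ => ⟨hW _ ?_, hW _ ?_⟩, fun Y _ => ⟨hW' _ ?_, hW' _ ?_⟩⟩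
  · rw [← hmap _ (hinv Y hY) (hinv Y' hY'), Equivalence.fun_inv_map]
    exact (W'.cancel_left_of_respectsIso _ _).trans (W'.cancel_right_of_respectsIso _ _)
  all_goals rw [MorphismProperty.isomorphisms.iff]; infer_instance

end Restrict

/-! ## Split triples and sums of line bundles -/

section Split

theorem Adapted.reindex {V : Type u} [AddCommGroup V] [Module k V] {ι κ : Type*}
    {e : Module.Basis ι k V} {F : ℤ → Submodule k V} {a : ι → ℤ} (h : Adapted e F a) (σ : ι ≃ κ) :
    Adapted (e.reindex σ) F (a ∘ σ.symm) := fun p w => by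
  rw [h p w]
  refine ⟨fun h s hs => h _ (by rwa [Module.Basis.repr_reindex_apply] at hs), fun h s hs => ?_⟩
  have := h (σ s) (by rwa [Module.Basis.repr_reindex_apply, Equiv.symm_apply_apply])
  rwa [Function.comp_apply, Equiv.symm_apply_apply] at this

theorem adapted_iff {V : Type u} [AddCommGroup V] [Module k V] {ι : Type*}
    {e : Module.Basis ι k V} {F : ℤ → Submodule k V} {a : ι → ℤ} :
    Adapted e F a ↔ ∀ p, F p = Submodule.span k (e '' {s | p ≤ a s}) := by
  refine forall_congr' fun p => ?_
  rw [SetLike.ext_iff]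
  refine forall_congr' fun w => ?_
  rw [e.mem_span_image]
  simp [Set.subset_def]

/-- Bases of the pieces of a trigrading together form one basis adapted to all three filtrations;
conversely the pieces are spanned by the basis vectors of given degree. -/
theorem isSplit_iff (V : TriFil k) : isSplit k V ↔
    ∃ (n : ℕ) (e : Module.Basis (Fin n) k V.obj.V) (d : Fin n → Fin 3 → ℤ),
      ∀ i, Adapted e (V.obj.F i) fun s => d s i := by
  have := V.property.1
  constructor
  · rintro ⟨D, hD, hF⟩
    let b := hD.collectedBasis fun m => Module.finBasis k (D m)
    have hb : ∀ s, b s = Module.finBasis k (D s.1) s.2 := fun s => by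
      rw [hD.collectedBasis_coe]
    have hDm : ∀ m, D m = Submodule.span k (b '' {s | s.1 = m}) := by
      intro m
      refine le_antisymm ?_ (Submodule.span_le.2 ?_)
      · intro w hw
        have h1 := congrArg Subtype.val ((Module.finBasis k (D m)).sum_repr ⟨w, hw⟩)
        rw [Submodule.coe_sum] at h1
        change _ = w at h1
        rw [← h1]
        refine Submodule.sum_mem _ fun t _ => ?_
        exact Submodule.smul_mem _ _ (Submodule.subset_span ⟨⟨m, t⟩, rfl, hb _⟩)
      · rintro _ ⟨s, rfl, rfl⟩
        rw [hb]
        exact Subtype.property _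
    have hA : ∀ i, Adapted b (V.obj.F i) fun s => s.1 i := by
      refine fun i => adapted_iff.2 fun p => ?_
      rw [hF]
      refine le_antisymm (iSup₂_le fun m hm => ?_) (Submodule.span_le.2 ?_)
      · rw [hDm]
        exact Submodule.span_mono (Set.image_mono fun s (hs : s.1 = m) => show p ≤ s.1 i from hs ▸ hm)
      · rintro _ ⟨s, hs, rfl⟩
        refine Submodule.mem_iSup_of_mem s.1 (Submodule.mem_iSup_of_mem hs ?_)
        rw [hb]
        exact Subtype.property _
    let := FiniteDimensional.fintypeBasisIndex b
    exact ⟨_, b.reindex (Fintype.equivFin _), fun s => ((Fintype.equivFin _).symm s).1,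
      fun i => (hA i).reindex _⟩
  · rintro ⟨n, e, d, h⟩
    refine ⟨fun m => Submodule.span k (e '' {s | d s = m}),
      DirectSum.isInternal_submodule_of_iSupIndep_of_iSup_eq_top ?_ ?_, fun i p => ?_⟩
    · intro m
      refine (e.linearIndependent.disjoint_span_image (s := {s | d s = m}) (t := {s | d s ≠ m})
        (Set.disjoint_left.2 fun s h1 h2 => h2 h1)).mono_right (iSup₂_le fun m' hm' => ?_)
      exact Submodule.span_mono (Set.image_mono fun s (hs : d s = m') => show d s ≠ m from hs ▸ hm')
    · rw [← top_le_iff, ← e.span_eq]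
      refine Submodule.span_le.2 ?_
      rintro _ ⟨s, rfl⟩
      exact Submodule.mem_iSup_of_mem (d s) (Submodule.subset_span ⟨s, rfl, rfl⟩)
    · rw [adapted_iff.1 (h i) p]
      refine le_antisymm (Submodule.span_le.2 ?_) (iSup₂_le fun m hm => ?_)
      · rintro _ ⟨s, hs, rfl⟩
        exact Submodule.mem_iSup_of_mem (d s) (Submodule.mem_iSup_of_mem hs
          (Submodule.subset_span ⟨s, rfl, rfl⟩))
      · exact Submodule.span_mono (Set.image_mono fun s (hs : d s = m) =>
          show p ≤ d s i from hs ▸ hm)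

/-- The field `k` with the three filtrations that jump at `d`. -/
def lineFil (k : Type u) [Field k] (d : Fin 3 → ℤ) : TriFil k where
  obj :=
    { V := k
      F := fun i p => if p ≤ d i then ⊤ else ⊥ }
  property := by
    refine ⟨inferInstanceAs (FiniteDimensional k k), fun i => ⟨fun p q hpq => ?_,
      ⟨d i + 1, if_neg (by omega)⟩, ⟨d i, if_pos le_rfl⟩⟩⟩
    change (if q ≤ d i then ⊤ else ⊥) ≤ (if p ≤ d i then ⊤ else ⊥)
    split_ifs
    · exact le_rfl
    · omega
    · exact bot_le
    · exact le_rfl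

theorem adapted_lineFil (d : Fin 3 → ℤ) (i : Fin 3) :
    Adapted (V := (lineFil k d).obj.V) (Module.Basis.singleton Unit k) ((lineFil k d).obj.F i)
      fun _ => d i := by
  intro p (w : k)
  change w ∈ (if p ≤ d i then ⊤ else ⊥ : Submodule k k) ↔
    ∀ s : Unit, (Module.Basis.singleton Unit k).repr w s ≠ 0 → p ≤ d i
  simp only [Module.Basis.singleton_repr]
  split_ifs with h <;> simp [h]

/-- The map from `lineFil k d` that sends `1` to `v`. -/
def lineFilMap {V : TriFil k} {d : Fin 3 → ℤ} {v : V.obj.V} (hv : ∀ i, v ∈ V.obj.F i (d i)) :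
    lineFil k d ⟶ V :=
  (isTriFil k).homMk (MultiFil.Hom.mk (V := (lineFil k d).obj) (LinearMap.toSpanSingleton k _ v) (by
    rintro i p _ ⟨(c : k), hc, rfl⟩
    change c • v ∈ _
    change c ∈ (if p ≤ d i then ⊤ else ⊥ : Submodule k k) at hc
    split_ifs at hc with h
    · exact Submodule.smul_mem _ _ ((V.property.2 i).1 h (hv i))
    · rw [(Submodule.mem_bot k).1 hc, zero_smul]; exact zero_mem _))

/-- Each vector of a common adapted basis is the image of the generator of a one-dimensional triple
with the same jumps. On sections the monomial generators go to the elements of `reesBasis`. -/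
theorem isSumOfLineBundles_of_isSplit {V : TriFil k} (h : isSplit k V) :
    isSumOfLineBundles k ((triRees k).obj V) := by
  obtain ⟨n, e, d, he⟩ := (isSplit_iff V).1 h
  obtain ⟨l, hl⟩ : ∃ l : Idx → Fin 3, ∀ S, l S ∈ S.1 := Classical.axiomOfChoice fun S => S.2
  let B : ∀ (S : Idx) (j : Fin n), Module.Basis Unit (chartRing k S)
      (reesSec (lineFil k (d j)).obj S) := fun S j =>
    reesBasis (V := (lineFil k (d j)).obj) (Module.Basis.singleton Unit k) (fun _ => d j)
      (hl S) fun i _ => adapted_lineFil (d j) i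
  let ε : ∀ (S : Idx) (j : Fin n), reesSec (lineFil k (d j)).obj S ≃ₗ[chartRing k S]
      chartRing k S := fun S j => (B S j).equivFun.trans (LinearEquiv.funUnique Unit _ _)
  refine ⟨n, fun j => (triRees k).obj (lineFil k (d j)),
    fun j => (triRees k).map (lineFilMap fun i => (he i).mem_self j),
    fun j S => Module.Invertible.congr (ε S j).symm, fun S => ?_⟩
  let b := reesBasis e d (hl S) fun i _ => he i
  suffices h : ∀ y : ∀ j, reesSec (lineFil k (d j)).obj S,
      ∑ j, reesMap (lineFilMap fun i => (he i).mem_self j).hom S (y j) =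
        ((LinearEquiv.piCongrRight (ε S)).trans b.equivFun.symm) y from
    (congrArg Function.Bijective (funext h)).mpr
      ((LinearEquiv.piCongrRight (ε S)).trans b.equivFun.symm).bijective
  intro y
  rw [LinearEquiv.trans_apply, Module.Basis.equivFun_symm_apply]
  refine Finset.sum_congr rfl fun j _ => ?_
  have h1 : y j = ε S j (y j) • B S j () := by
    have := (B S j).sum_repr (y j)
    rw [Finset.univ_unique, Finset.sum_singleton] at this
    exact this.symm
  have h2 : reesMap (lineFilMap fun i => (he i).mem_self j).hom S (B S j ()) = b j := by
    apply Subtype.ext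
    have h3 : (B S j ()).1 = orbitMono (V := (lineFil k (d j)).obj.V) k S (expo (l S) (d j))
        (Module.Basis.singleton Unit k ()) := coe_reesBasis _ _ _ _ _
    rw [coe_reesMap, coe_reesBasis, h3]
    refine (orbitMap_mono _ _ _).trans (congrArg _ ?_)
    change (Module.Basis.singleton Unit k ()) • e j = _
    rw [Module.Basis.singleton_apply, one_smul]
  change reesMap (lineFilMap fun i => (he i).mem_self j).hom S (y j) = ε S j (y j) • b j
  conv_lhs => rw [h1]
  rw [map_smul, h2]

instance : (isSumOfLineBundles k).IsClosedUnderIsomorphisms where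
  of_iso := by
    rintro ξ η α ⟨n, L, inj, h1, h2⟩
    refine ⟨n, L, fun j => inj j ≫ α.hom, h1, fun S => ?_⟩
    convert (appEquiv α S).bijective.comp (h2 S) using 1
    funext y
    rw [Function.comp_apply, map_sum]
    rfl

/-- A filtration of a line jumps once. -/
theorem exists_jump {V : Type u} [AddCommGroup V] [Module k V] (hV : Module.finrank k V = 1)
    {F : ℤ → Submodule k V} (hF : Antitone F ∧ (∃ p, F p = ⊥) ∧ ∃ q, F q = ⊤) :
    ∃ a, ∀ p w, w ∈ F p ↔ (w ≠ 0 → p ≤ a) := by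
  have := Module.finite_of_finrank_pos (hV ▸ one_pos : 0 < Module.finrank k V)
  obtain ⟨e, -, a, -, -, h, -⟩ := exists_adapted 1 hV F F F hF hF hF
  refine ⟨a 0, fun p w => ?_⟩
  rw [h p w, Unique.forall_iff, ← e.repr.map_ne_zero_iff]
  refine imp_congr_left ⟨fun h1 h2 => h1 (by rw [h2]; rfl), fun h1 h2 => h1 (Finsupp.ext fun s => ?_)⟩
  rw [Subsingleton.elim s default]
  exact h2

/-- The equivalence carries the line bundles and their inclusions back to one-dimensional triples `W
j` mapping to `V`. Comparing coefficients of one monomial shows that the sum of these maps is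
bijective and that each F_i^p of `V` is the sum of those of the lines, so nonzero vectors of the
lines form an adapted basis. -/
theorem isSplit_of_isSumOfLineBundles {V : TriFil k}
    (h : isSumOfLineBundles k ((triRees k).obj V)) : isSplit k V := by
  obtain ⟨n, L, inj, hL, hinj⟩ := h
  let W : Fin n → TriFil k := fun j => (triFibre k).obj (L j)
  let α : ∀ j, (triRees k).obj (W j) ≅ L j := fun j => (triEquiv k).counitIso.app (L j)
  choose g hg using fun j => (triEquiv k).functor.map_surjective ((α j).hom ≫ inj j)
  have hbij : ∀ S : Idx, Function.Bijective
      fun y : ∀ j, reesSec (W j).obj S => ∑ j, reesMap (g j).hom S (y j) := by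
    intro S
    refine (congrArg Function.Bijective (funext fun y => ?_)).mpr ((hinj S).comp
      (LinearEquiv.piCongrRight fun j => appEquiv (α j) S).bijective)
    refine Finset.sum_congr rfl fun j _ => ?_
    exact congrArg (fun f : (triRees k).obj (W j) ⟶ (triRees k).obj V => f.hom.app S (y j)) (hg j)
  -- The sections over the orbit are free of rank equal to the dimension of the triple, and an
  -- invertible module has rank one.
  have hdim : ∀ j, Module.finrank k (W j).obj.V = 1 := by
    intro j
    obtain ⟨b⟩ := exists_reesBasis (W j) orbit
    have := hL j orbit
    have h1 : Module.Invertible (chartRing k orbit) (reesSec (W j).obj orbit) :=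
      Module.Invertible.congr (appEquiv (α j) orbit).symm
    have h2 := Module.Free.of_basis b
    have h3 := Module.Invertible.finrank_eq_one (chartRing k orbit) (reesSec (W j).obj orbit)
    rwa [Module.finrank_eq_card_basis b, Fintype.card_fin] at h3
  choose d hd using fun j i => exists_jump (hdim j) ((W j).property.2 i)
  let Φ : (∀ j, (W j).obj.V) →ₗ[k] V.obj.V :=
    ∑ j, (g j).hom.lin ∘ₗ LinearMap.proj j
  have hΦ : ∀ w, Φ w = ∑ j, (g j).hom.lin (w j) := fun w => by
    simp only [Φ, LinearMap.sum_apply, LinearMap.comp_apply, LinearMap.proj_apply]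
  -- Over the open set where only u_i may vanish, the section u^m ⊗ v with m i = -p detects F_i^p
  -- alone; the coefficients at m of its decomposition give `w`.
  have hlift : ∀ i p v, v ∈ V.obj.F i p → ∃ w, Φ w = v ∧ ∀ j, w j ∈ (W j).obj.F i p := by
    intro i p v hv
    obtain ⟨m, hm⟩ := exists_exponent i (-p)
    have hmem : orbitMono k (awayFrom i) m v ∈ reesSec V.obj (awayFrom i) := by
      refine orbitMono_mem_reesSec fun j hj => ?_
      rw [notMem_awayFrom.1 hj, hm, neg_neg]; exact hv
    obtain ⟨y, hy⟩ := (hbij (awayFrom i)).2 ⟨_, hmem⟩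
    refine ⟨fun j => orbitCoeffs k _ _ (y j).1 m, ?_, fun j => ?_⟩
    · have h1 := congrArg (fun z => orbitCoeffs k (awayFrom i) V.obj.V z.1 m) hy
      simp only [Submodule.coe_sum, map_sum, Finsupp.finsetSum_apply, coe_reesMap,
        orbitCoeffs_orbitMap, orbitCoeffs_mono, Finsupp.single_eq_same] at h1
      rw [hΦ, h1]
    · have h1 := (mem_reesSec fun i => ((W j).property.2 i).1).1 (y j).2 m i
        (notMem_awayFrom.2 rfl)
      rwa [hm, neg_neg] at h1
  have hinjΦ : Function.Injective Φ := by
    rw [← LinearMap.ker_eq_bot, LinearMap.ker_eq_bot']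
    intro w hw
    have hmem : ∀ j, orbitMono k orbit 0 (w j) ∈ reesSec (W j).obj orbit := fun j =>
      orbitMono_mem_reesSec fun i hi => absurd (Finset.mem_univ i) hi
    have h1 : (fun j => (⟨_, hmem j⟩ : reesSec (W j).obj orbit)) = 0 := by
      apply (hbij orbit).1
      apply Subtype.ext
      simp only [Submodule.coe_sum, coe_reesMap, orbitMap_mono, Pi.zero_apply, map_zero]
      rw [← map_sum, ← hΦ, hw, map_zero]
      exact (Finset.sum_eq_zero fun _ _ => rfl).symm
    funext j
    have h2 := congrArg (fun z => orbitCoeffs k orbit _ (z j).1 0) h1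
    simpa [orbitCoeffs_mono] using h2
  have hsurjΦ : Function.Surjective Φ := by
    intro v
    obtain ⟨q, hq⟩ := (V.property.2 0).2.2
    obtain ⟨w, hw, -⟩ := hlift 0 q v (hq ▸ Submodule.mem_top)
    exact ⟨w, hw⟩
  let Ψ := LinearEquiv.ofBijective Φ ⟨hinjΦ, hsurjΦ⟩
  let ε : ∀ j, (W j).obj.V ≃ₗ[k] k := fun j =>
    have := (W j).property.1
    LinearEquiv.ofFinrankEq _ _ ((hdim j).trans (Module.finrank_self k).symm)
  let e : Module.Basis (Fin n) k V.obj.V :=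
    Module.Basis.ofEquivFun (Ψ.symm.trans (LinearEquiv.piCongrRight ε))
  refine (isSplit_iff V).2 ⟨n, e, d, fun i p v => ?_⟩
  have h1 : v ∈ V.obj.F i p ↔ ∀ j, Ψ.symm v j ∈ (W j).obj.F i p := by
    constructor
    · intro hv
      obtain ⟨w, hw, hw'⟩ := hlift i p v hv
      have : Ψ.symm v = w := (LinearEquiv.symm_apply_eq _).2 hw.symm
      rwa [this]
    · intro hv
      have : v = Φ (Ψ.symm v) := (Ψ.apply_symm_apply v).symm
      rw [this, hΦ]
      exact Submodule.sum_mem _ fun j _ => (g j).hom.map_le i p ⟨_, hv j, rfl⟩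
  rw [h1]
  refine forall_congr' fun j => ?_
  rw [hd j i p, ← (ε j).map_ne_zero_iff]
  rfl

theorem isSumOfLineBundles_iff (V : TriFil k) :
    isSumOfLineBundles k ((triRees k).obj V) ↔ isSplit k V :=
  ⟨isSplit_of_isSumOfLineBundles, isSumOfLineBundles_of_isSplit⟩

end Split

/-! ## Morphisms of opposed triples -/

section OpposedMorphisms

theorem exists_adapted_triple (V : TriFil k) :
    ∃ (e e' : Module.Basis (Fin (Module.finrank k V.obj.V)) k V.obj.V)
      (a b c : Fin (Module.finrank k V.obj.V) → ℤ), Adapted e (V.obj.F 0) a ∧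
      Adapted e (V.obj.F 1) b ∧ Adapted e' (V.obj.F 0) a ∧ Adapted e' (V.obj.F 2) c ∧
      ∀ s, e s - e' s ∈ V.obj.F 0 (a s + 1) :=
  have := V.property.1
  exists_adapted _ rfl _ _ _ (V.property.2 0) (V.property.2 1) (V.property.2 2)

theorem oppositePair_of_isOpposed {V : TriFil k} (h : isOpposed k V) :
    OppositePair (V.obj.F 0) (V.obj.F 1) (V.obj.F 2) := by
  obtain ⟨e, e', a, b, c, h1, h2, h3, h4, h5⟩ := exists_adapted_triple V
  exact OppositePair.of_degree h1 h2 h3 h4 h5 ((opposed_iff_degree h1 h2 h3 h4 h5).1 h)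

variable {V W : TriFil k} (f : V ⟶ W) (hV : isOpposed k V) (hW : isOpposed k W)

include hV hW

/-- The bigrading splits F_0 and F_2; exchanging the roles of F_1 and F_2 gives one that splits F_0
and F_1. -/
theorem bistrict_of_isOpposed {j : Fin 3} (hj : j ≠ 0) (a b : ℤ) :
    LinearMap.range f.hom.lin ⊓ (W.obj.F 0 a ⊓ W.obj.F j b) ≤
      (V.obj.F 0 a ⊓ V.obj.F j b).map f.hom.lin ∧
    (LinearMap.range f.hom.lin ⊔ W.obj.F 0 a) ⊓ (LinearMap.range f.hom.lin ⊔ W.obj.F j b) ≤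
      LinearMap.range f.hom.lin ⊔ (W.obj.F 0 a ⊓ W.obj.F j b) := by
  have h1 := oppositePair_of_isOpposed hV
  have h2 := oppositePair_of_isOpposed hW
  have hj' : j = 1 ∨ j = 2 := by revert hj; fin_cases j <;> simp
  rcases hj' with rfl | rfl
  · exact h1.swap.bistrict f.hom.lin (f.hom.map_le 0) (f.hom.map_le 2) (f.hom.map_le 1)
      (V.property.2 0) (V.property.2 1) (W.property.2 0) (W.property.2 2).1 (W.property.2 1)
      h2.swap a b
  · exact h1.bistrict f.hom.lin (f.hom.map_le 0) (f.hom.map_le 1) (f.hom.map_le 2)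
      (V.property.2 0) (V.property.2 2) (W.property.2 0) (W.property.2 1).1 (W.property.2 2)
      h2 a b

/-- Bistrictness with the other filtration taken at an index where it is the whole space. -/
theorem strict_of_isOpposed : strict k f := by
  intro i p
  refine le_antisymm (le_inf LinearMap.map_le_range (f.hom.map_le i p)) ?_
  rintro w ⟨h1, h2⟩
  by_cases hi : i = 0
  · subst hi
    obtain ⟨q, hq⟩ := (W.property.2 1).2.2
    exact Submodule.map_mono inf_le_left ((bistrict_of_isOpposed f hV hW one_ne_zero p q).1
      ⟨h1, h2, hq ▸ Submodule.mem_top⟩)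
  · obtain ⟨q, hq⟩ := (W.property.2 0).2.2
    exact Submodule.map_mono inf_le_right ((bistrict_of_isOpposed f hV hW hi q p).1
      ⟨h1, hq ▸ Submodule.mem_top, h2⟩)

/-- The cokernel of a map of opposed triples is free on the charts that meet `u₀ = 0`. -/
theorem free_coker_of_isOpposed {l : Fin 3} (hl : l ≠ 0) (T : Submonoid (chartRing k (chart l))) :
    Module.Free (Localization T)
      (LocalizedModule T
        (reesSec W.obj (chart l) ⧸ LinearMap.range (reesMap f.hom (chart l)))) := by
  have hA : ∀ i, Antitone (W.obj.F i) := fun i => (W.property.2 i).1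
  obtain ⟨j, hjl, hj0, hj⟩ := exists_third (Ne.symm hl)
  have := W.property.1
  obtain ⟨c, -, a, b, -, hca, hcb, -⟩ := exists_adapted _ rfl _ _ _
    (quotient_filtration (LinearMap.range f.hom.lin) (W.property.2 0))
    (quotient_filtration (LinearMap.range f.hom.lin) (W.property.2 j))
    (quotient_filtration (LinearMap.range f.hom.lin) (W.property.2 j))
  -- A vector of the cokernel has a lift in F_0 and a lift in F_j; general position of the image
  -- provides one lift in both.
  have hlift : ∀ t, ∃ ε : W.obj.V, (LinearMap.range f.hom.lin).mkQ ε = c t ∧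
      ε ∈ W.obj.F 0 (a t) ∧ ε ∈ W.obj.F j (b t) := by
    intro t
    obtain ⟨x, hx, hxt⟩ := hca.mem_self t
    obtain ⟨y, hy, hyt⟩ := hcb.mem_self t
    have hxy : x - y ∈ LinearMap.range f.hom.lin :=
      (Submodule.Quotient.eq _).1 (hxt.trans hyt.symm)
    have h1 := (bistrict_of_isOpposed f hV hW hj0 (a t) (b t)).2
      (x := x) ⟨Submodule.mem_sup_right hx, Submodule.mem_sup.2 ⟨_, hxy, y, hy, sub_add_cancel _ _⟩⟩
    obtain ⟨r, hr, z, hz, hrz⟩ := Submodule.mem_sup.1 h1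
    refine ⟨z, ?_, hz⟩
    rw [← hxt]
    refine ((Submodule.Quotient.eq _).2 ?_).symm
    rwa [← hrz, add_sub_cancel_right]
  choose ε hεc hε0 hεj using hlift
  let n : Fin _ → charLattice := fun t => expo l fun i' => if i' = 0 then a t else b t
  have hn0 : ∀ t, (n t).1 0 = -a t := fun t => by rw [expo_apply_of_ne (Ne.symm hl), if_pos rfl]
  have hnj : ∀ t, (n t).1 j = -b t := fun t => by rw [expo_apply_of_ne hjl, if_neg hj0]
  have hcases : ∀ {P : Fin 3 → Prop}, P 0 → P j → ∀ i' ∉ (chart l).1, P i' := by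
    intro P h1 h2 i' hi'
    rcases hj i' (notMem_chart.1 hi') with rfl | rfl
    exacts [h1, h2]
  refine free_localized_coker hA f.hom (chart l) _ c ε hεc n (fun t => hcases ?_ ?_) ?_
  · rw [hn0, neg_neg]; exact hε0 t
  · rw [hnj, neg_neg]; exact hεj t
  intro m w hw
  have hw0 := hw 0 (notMem_chart.2 (Ne.symm hl))
  have hwj := hw j (notMem_chart.2 hjl)
  have hra := (hca (-m.1 0) ((LinearMap.range f.hom.lin).mkQ w)).1 ⟨w, hw0, rfl⟩
  have hrb := (hcb (-m.1 j) ((LinearMap.range f.hom.lin).mkQ w)).1 ⟨w, hwj, rfl⟩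
  have hz : ∀ i, (0 : cone (chart l)).1.1 i = 0 := fun i => rfl
  refine ⟨0, by rw [mono_zero]; exact T.one_mem, fun t ht => hcases ?_ ?_, ?_⟩
  · have := hra t ht
    rw [hz, hn0]; omega
  · have := hrb t ht
    rw [hz, hnj]; omega
  · have h1 : w - ∑ t, c.repr ((LinearMap.range f.hom.lin).mkQ w) t • ε t ∈
        LinearMap.range f.hom.lin ⊓ (W.obj.F 0 (-m.1 0) ⊓ W.obj.F j (-m.1 j)) := by
      refine ⟨?_, sub_mem hw0 (Submodule.sum_mem _ fun t _ => ?_),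
        sub_mem hwj (Submodule.sum_mem _ fun t _ => ?_)⟩
      · refine (Submodule.Quotient.mk_eq_zero _).1 ?_
        change (LinearMap.range f.hom.lin).mkQ _ = 0
        rw [map_sub, map_sum, sub_eq_zero]
        refine (c.sum_repr ((LinearMap.range f.hom.lin).mkQ w)).symm.trans ?_
        exact Finset.sum_congr rfl fun t _ => by rw [map_smul, hεc]
      · by_cases h0 : c.repr ((LinearMap.range f.hom.lin).mkQ w) t = 0
        · rw [h0, zero_smul]; exact zero_mem _
        · exact Submodule.smul_mem _ _ (hA 0 (hra t h0) (hε0 t))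
      · by_cases h0 : c.repr ((LinearMap.range f.hom.lin).mkQ w) t = 0
        · rw [h0, zero_smul]; exact zero_mem _
        · exact Submodule.smul_mem _ _ (hA j (hrb t h0) (hεj t))
    -- The error term is lifted into both steps at once, so nothing has to be inverted and the
    -- denominator is 1.
    obtain ⟨v, hv, hvw⟩ := (bistrict_of_isOpposed f hV hW hj0 _ _).1 h1
    refine ⟨v, hcases ?_ ?_, hvw.symm⟩
    · rw [hz, zero_add]; exact hv.1
    · rw [hz, zero_add]; exact hv.2

theorem cokerFreeOutside_of_isOpposed : cokerFreeOutside k {0} ((triRees k).map f) := by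
  intro l x hx
  by_cases hl : l = 0
  · subst hl
    exact free_coker_of_strict f (strict_of_isOpposed f hV hW) 0 x (hx rfl)
  · exact free_coker_of_isOpposed f hV hW hl _

end OpposedMorphisms

/-! ## Restriction to the line -/

section Line

/-- Independent columns over a domain have a nonzero maximal minor. -/
theorem exists_minor_ne_zero {R : Type*} [CommRing R] [IsDomain R] {n r : ℕ}
    (X : Matrix (Fin n) (Fin r) R) (hX : LinearIndependent R X.col) :
    ∃ σ : Fin r → Fin n, (X.submatrix σ id).det ≠ 0 := by
  -- Independence passes to the fraction field, where row rank equals column rank; r independent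
  -- rows give the minor.
  let K := FractionRing R
  let Y : Matrix (Fin n) (Fin r) K := X.map (algebraMap R K)
  have hY : LinearIndependent K Y.col := by
    rw [← LinearIndependent.iff_fractionRing R K, Fintype.linearIndependent_iff]
    intro g hg
    refine Fintype.linearIndependent_iff.1 hX g (funext fun i => ?_)
    have h1 := congrFun hg i
    rw [Finset.sum_apply] at h1
    have h2 : algebraMap R K (∑ c, g c * X i c) = algebraMap R K 0 := by
      rw [map_sum, map_zero]
      refine Eq.trans (Finset.sum_congr rfl fun c _ => ?_) h1
      rw [map_mul, Pi.smul_apply, Algebra.smul_def]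
      rfl
    rw [Finset.sum_apply]
    exact IsFractionRing.injective R K h2
  have hrank : Y.rank = r := by
    rw [← Matrix.rank_transpose]
    exact (LinearIndependent.rank_matrix (M := Y.transpose) hY).trans (Fintype.card_fin r)
  have hspan : Submodule.span K (Set.range Y.row) = ⊤ := by
    apply Submodule.eq_top_of_finrank_eq
    rw [← Matrix.rank_eq_finrank_span_row, hrank, Module.finrank_fin_fun]
  obtain ⟨κ, a, ha, hs, hli⟩ := exists_linearIndependent' K Y.row
  have b := Module.Basis.mk hli (by rw [hs, hspan])
  let σ : Fin r ≃ κ := (Pi.basisFun K (Fin r)).indexEquiv b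
  refine ⟨a ∘ σ, fun h0 => ?_⟩
  have h1 : LinearIndependent K (Y.submatrix (a ∘ σ) id).row := hli.comp σ σ.injective
  have h2 := (Matrix.isUnit_iff_isUnit_det _).1 (Matrix.linearIndependent_rows_iff_isUnit.1 h1)
  refine h2.ne_zero ?_
  have h3 : Y.submatrix (a ∘ σ) id = (algebraMap R K).mapMatrix (X.submatrix (a ∘ σ) id) := rfl
  rw [h3, ← RingHom.map_det, h0, map_zero]

variable {ξ η : EqSheaf k} {S S' : Idx}

/-- The reduction modulo the ideal of the line. -/
def toLine (ξ : EqSheaf k) (S : Idx) : ξ.sec S →ₗ[chartRing k S] lineSec ξ S := Submodule.mkQ _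

theorem toLine_surjective (ξ : EqSheaf k) (S : Idx) : Function.Surjective (toLine ξ S) :=
  Submodule.mkQ_surjective _

theorem mk_smul_toLine (a : chartRing k S) (x : ξ.sec S) :
    Ideal.Quotient.mk (lineIdeal k S) a • toLine ξ S x = toLine ξ S (a • x) := rfl

theorem mk_smul_lineSec (a : chartRing k S) (y : lineSec ξ S) :
    Ideal.Quotient.mk (lineIdeal k S) a • y = a • y := by
  obtain ⟨x, rfl⟩ := toLine_surjective ξ S y
  rw [mk_smul_toLine, map_smul]

theorem lineRes_toLine (h : S ≤ S') (x : ξ.sec S) :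
    lineRes ξ h (toLine ξ S x) = toLine ξ S' (ξ.res h x) := rfl

theorem toLine_eq_zero {x : ξ.sec S}
    (hx : x ∈ lineIdeal k S • (⊤ : Submodule (chartRing k S) (ξ.sec S))) : toLine ξ S x = 0 :=
  (Submodule.Quotient.mk_eq_zero _).2 hx

theorem lineRes_refl (y : lineSec ξ S) : lineRes ξ (le_refl S) y = y := by
  obtain ⟨x, rfl⟩ := toLine_surjective ξ S y
  rw [lineRes_toLine, ξ.res_refl]

/-- Restriction of functions on the line. -/
def lineRestr (k : Type u) [Field k] (h : S ≤ S') : lineRing k S →+* lineRing k S' :=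
  Ideal.quotientMap _ (restr k h) (lineIdeal_le h)

theorem lineRes_smul (h : S ≤ S') (a : lineRing k S) (y : lineSec ξ S) :
    lineRes ξ h (a • y) = lineRestr k h a • lineRes ξ h y := by
  obtain ⟨a, rfl⟩ := Ideal.Quotient.mk_surjective a
  rw [mk_smul_lineSec, LinearMap.map_smulₛₗ]
  exact (mk_smul_lineSec _ _).symm

/-- The reduction of a basis. -/
def lineBasis {ι : Type*} [Fintype ι] (b : Module.Basis ι (chartRing k S) (ξ.sec S)) :
    Module.Basis ι (lineRing k S) (lineSec ξ S) :=
  Module.Basis.mk (v := fun s => toLine ξ S (b s))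
    (by
      rw [Fintype.linearIndependent_iff]
      intro g hg s
      choose g' hg' using fun s => Ideal.Quotient.mk_surjective (I := lineIdeal k S) (g s)
      have h1 : toLine ξ S (∑ s, g' s • b s) = 0 := by
        rw [map_sum, ← hg]
        exact Finset.sum_congr rfl fun s _ => by rw [← hg', mk_smul_toLine]
      have h2 := (Submodule.Quotient.mk_eq_zero _).1 h1
      have h3 : lineIdeal k S • (⊤ : Submodule (chartRing k S) (ξ.sec S)) ≤
          Submodule.comap (b.coord s) (lineIdeal k S) := by
        refine Submodule.smul_le.2 fun a ha x _ => ?_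
        rw [Submodule.mem_comap, map_smul]
        exact Ideal.mul_mem_right _ _ ha
      have h4 := h3 h2
      rw [Submodule.mem_comap, Module.Basis.coord_apply, Module.Basis.repr_sum_self] at h4
      rw [← hg', Ideal.Quotient.eq_zero_iff_mem]
      exact h4)
    (by
      rintro y -
      obtain ⟨x, rfl⟩ := toLine_surjective ξ S y
      rw [← b.sum_repr x, map_sum]
      refine Submodule.sum_mem _ fun s _ => ?_
      rw [← mk_smul_toLine]
      exact Submodule.smul_mem _ _ (Submodule.subset_span ⟨s, rfl⟩))

theorem lineBasis_apply {ι : Type*} [Fintype ι] (b : Module.Basis ι (chartRing k S) (ξ.sec S))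
    (s : ι) : lineBasis b s = toLine ξ S (b s) := by
  rw [lineBasis, Module.Basis.mk_apply]

theorem HasRankDegree.line {r : ℕ} {d : ℤ} (h : HasRankDegree ξ r d) :
    LineHasRankDegree ξ (fun _ => ⊤) r d := by
  obtain ⟨b, hb⟩ := h
  obtain ⟨P, c, hc, h1, h2⟩ := hb 1 2
  refine ⟨(lineBasis (b 1)).map Submodule.topEquiv.symm,
    (lineBasis (b 2)).map Submodule.topEquiv.symm,
    (Ideal.Quotient.mk (lineIdeal k (overlap 1 2))).mapMatrix P, c, P.det, hc, fun t => ?_, h2, ?_⟩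
  · simp only [Module.Basis.map_apply, lineBasis_apply]
    change lineRes ξ (chart_le_right 1 2) (toLine ξ _ (b 2 t)) =
      ∑ s, Ideal.Quotient.mk (lineIdeal k (overlap 1 2)) (P s t) •
        lineRes ξ (chart_le_left 1 2) (toLine ξ _ (b 1 s))
    rw [lineRes_toLine, h1, map_sum]
    refine Finset.sum_congr rfl fun s _ => ?_
    rw [lineRes_toLine, mk_smul_toLine]
  · rw [RingHom.map_det]

/-- The line does not meet `U_S` when `0 ∈ S` and `S ≠ {0}`. -/
theorem subsingleton_lineSec (ξ : EqSheaf k) {j : Fin 3} (h0 : 0 ∈ S.1) (hj : j ∈ S.1)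
    (hj0 : j ≠ 0) : Subsingleton (lineSec ξ S) := by
  have h1 : ratio j 0 ∈ cone S := by
    intro i hi
    have h2 : i ≠ 0 := fun h => hi (h ▸ h0)
    have h3 : i ≠ j := fun h => hi (h ▸ hj)
    simp [ratio, h2, h3]
  have h1' : -ratio j 0 ∈ cone S := by
    intro i hi
    have h2 : i ≠ 0 := fun h => hi (h ▸ h0)
    have h3 : i ≠ j := fun h => hi (h ▸ hj)
    simp [ratio, h2, h3]
  have h2 : lineIdeal k S = ⊤ := by
    refine Ideal.eq_top_of_isUnit_mem _ (Ideal.subset_span ⟨⟨_, h1⟩, ?_, rfl⟩)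
      (isUnit_mono ⟨_, h1⟩ h1')
    simp [ratio, hj0.symm]
  rw [Submodule.Quotient.subsingleton_iff, h2, Submodule.top_smul]

theorem idx_cases {S S' : Idx} (h : S ≤ S') :
    S = S' ∨ (0 ∈ S'.1 ∧ ∃ j ∈ S'.1, j ≠ 0) ∨ (S = chart 1 ∧ S' = overlap 1 2) ∨
      (S = chart 2 ∧ S' = overlap 1 2) := by
  revert S S'
  unfold chart overlap
  decide

/-- The target is zero when S' contains 0 and another index, and identity inclusions impose nothing;
only the two restrictions to `U_1 ∩ U_2` remain. -/
theorem isLineSubsheaf_iff (N : ∀ S, Submodule (lineRing k S) (lineSec ξ S)) :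
    IsLineSubsheaf ξ N ↔ ∀ (l : Fin 3) (h : chart l ≤ overlap 1 2), l ≠ 0 →
      N (overlap 1 2) = Submodule.span (lineRing k (overlap 1 2))
        (lineRes ξ h '' (N (chart l) : Set (lineSec ξ (chart l)))) := by
  refine ⟨fun hN l h _ => hN _ _ h, fun hN S S' h => ?_⟩
  rcases idx_cases h with rfl | ⟨h0, j, hj, hj0⟩ | ⟨rfl, rfl⟩ | ⟨rfl, rfl⟩
  · have : lineRes ξ h '' (N S : Set (lineSec ξ S)) = N S := by
      ext y
      exact ⟨fun ⟨x, hx, hxy⟩ => hxy ▸ (lineRes_refl x).symm ▸ hx,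
        fun hy => ⟨y, hy, lineRes_refl y⟩⟩
    rw [this, Submodule.span_eq]
  · have := subsingleton_lineSec ξ h0 hj hj0
    exact Subsingleton.elim _ _
  · exact hN 1 h (by decide)
  · exact hN 2 h (by decide)

theorem isLineSubsheaf_top (hξ : ξ.IsQuasiCoherent) : IsLineSubsheaf ξ fun _ => ⊤ := by
  intro S S' h
  refine (top_le_iff.1 ?_).symm
  rintro y -
  obtain ⟨y, rfl⟩ := toLine_surjective ξ S' y
  obtain ⟨a, x, ha, hax⟩ := (hξ S S' h).2 y
  obtain ⟨u, hu⟩ := ha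
  have h1 : y = (↑u⁻¹ : chartRing k S') • ξ.res h x := by
    rw [← hax, ← hu, smul_smul, Units.inv_mul, one_smul]
  rw [h1, ← mk_smul_toLine, ← lineRes_toLine]
  exact Submodule.smul_mem _ _ (Submodule.subset_span ⟨_, trivial, rfl⟩)

/-! ### Transport along isomorphisms -/

/-- The isomorphism induced on the restrictions to the line. -/
def lineEquiv {ξ η : Fib k} (α : ξ ≅ η) (S : Idx) :
    lineSec ξ.obj S ≃ₗ[lineRing k S] lineSec η.obj S :=
  LinearEquiv.extendScalarsOfSurjective Ideal.Quotient.mk_surjective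
    (Submodule.Quotient.equiv _ _ (appEquiv α S) (by
      rw [Submodule.map_smul'', Submodule.map_top, LinearEquiv.range]))

theorem lineEquiv_toLine {ξ η : Fib k} (α : ξ ≅ η) (S : Idx) (x : ξ.obj.sec S) :
    lineEquiv α S (toLine ξ.obj S x) = toLine η.obj S (α.hom.hom.app S x) := rfl

theorem lineRes_lineEquiv {ξ η : Fib k} (α : ξ ≅ η) (h : S ≤ S') (y : lineSec ξ.obj S) :
    lineRes η.obj h (lineEquiv α S y) = lineEquiv α S' (lineRes ξ.obj h y) := by
  obtain ⟨x, rfl⟩ := toLine_surjective ξ.obj S y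
  rw [lineEquiv_toLine, lineRes_toLine, lineRes_toLine, lineEquiv_toLine, α.hom.hom.app_res]

theorem IsLineSubsheaf.map {ξ η : Fib k} (α : ξ ≅ η)
    {N : ∀ S, Submodule (lineRing k S) (lineSec ξ.obj S)} (hN : IsLineSubsheaf ξ.obj N) :
    IsLineSubsheaf η.obj fun S => (N S).map (lineEquiv α S).toLinearMap := by
  intro S S' h
  beta_reduce
  rw [hN S S' h, Submodule.map_span, Set.image_image]
  congr 1
  rw [Submodule.map_coe, Set.image_image]
  exact Set.image_congr fun y _ => (lineRes_lineEquiv α h y).symm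

theorem LineHasRankDegree.map {ξ η : Fib k} (α : ξ ≅ η)
    {N : ∀ S, Submodule (lineRing k S) (lineSec ξ.obj S)} {r : ℕ} {d : ℤ}
    (hN : LineHasRankDegree ξ.obj N r d) :
    LineHasRankDegree η.obj (fun S => (N S).map (lineEquiv α S).toLinearMap) r d := by
  obtain ⟨b₁, b₂, P, c, a, hc, h1, h2, h3⟩ := hN
  refine ⟨b₁.map ((lineEquiv α _).submoduleMap _), b₂.map ((lineEquiv α _).submoduleMap _),
    P, c, a, hc, fun t => ?_, h2, h3⟩
  simp only [Module.Basis.map_apply, LinearEquiv.submoduleMap_apply, lineRes_lineEquiv, h1,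
    map_sum, map_smul]

theorem HasRankDegree.map {ξ η : Fib k} (α : ξ ≅ η) {r : ℕ} {d : ℤ}
    (h : HasRankDegree ξ.obj r d) : HasRankDegree η.obj r d := by
  obtain ⟨b, hb⟩ := h
  refine ⟨fun i => (b i).map (appEquiv α _), fun i j => ?_⟩
  obtain ⟨P, c, hc, h1, h2⟩ := hb i j
  refine ⟨P, c, hc, fun t => ?_, h2⟩
  simp only [Module.Basis.map_apply, appEquiv_apply, ← α.hom.hom.app_res, h1, map_sum, map_smul]

instance : (isSemistableSlopeZero k).IsClosedUnderIsomorphisms where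
  of_iso := by
    rintro ξ η α ⟨h1, r, d, h2, h3⟩
    refine ⟨fun N hN r r' d d' hr hd hd' => ?_, r, d, h2.map α, h3⟩
    refine h1 _ (hN.map α.symm) r r' d d' hr (hd.map α.symm) ?_
    have h4 := hd'.map α.symm
    simpa only [Submodule.map_top, LinearEquiv.range] using h4

end Line

/-! ## Degrees on the line -/

section LineDegree

variable {S S' : Idx}

theorem edge_eq_zero_iff (h0 : 0 ∉ S.1) (a : chartRing k S) :
    edge k h0 a = 0 ↔ a ∈ lineIdeal k S := by
  constructor
  · intro ha
    -- `b` is the part of `a` divisible by u_0; it is all of `a` when the restriction to the line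
    -- vanishes.
    have key : ∀ a : chartRing k S, ∃ b ∈ lineIdeal k S, ∀ n : cone S,
        (n.1.1 0 = 0 → b.coeff n = 0) ∧ (n.1.1 0 ≠ 0 → b.coeff n = a.coeff n) := by
      intro a
      induction a using AddMonoidAlgebra.induction_linear with
      | zero => exact ⟨0, zero_mem _, fun n => by simp⟩
      | add f g hf hg =>
        obtain ⟨b, hb, hb'⟩ := hf
        obtain ⟨c, hc, hc'⟩ := hg
        refine ⟨b + c, add_mem hb hc, fun n => ⟨fun hn => ?_, fun hn => ?_⟩⟩
        · simp [(hb' n).1 hn, (hc' n).1 hn]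
        · simp [(hb' n).2 hn, (hc' n).2 hn]
      | single m c =>
        by_cases hm : m.1.1 0 = 0
        · refine ⟨0, zero_mem _, fun n => ⟨fun _ => by simp, fun hn => ?_⟩⟩
          rw [AddMonoidAlgebra.coeff_single, Finsupp.single_eq_of_ne (by rintro rfl; exact hn hm)]
          simp
        · refine ⟨AddMonoidAlgebra.single m c, ?_, fun n => ⟨fun hn => ?_, fun _ => rfl⟩⟩
          · rw [single_eq_smul_mono]
            exact Submodule.smul_of_tower_mem _ c (Ideal.subset_span
              ⟨m, lt_of_le_of_ne (m.2 0 h0) (Ne.symm hm), rfl⟩)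
          · rw [AddMonoidAlgebra.coeff_single,
              Finsupp.single_eq_of_ne (by rintro rfl; exact hm hn)]
    obtain ⟨b, hb, hb'⟩ := key a
    have : a = b := by
      refine AddMonoidAlgebra.ext (Finsupp.ext fun n => ?_)
      by_cases hn : n.1.1 0 = 0
      · have h1 := edge_coeff h0 a n
        rw [ha, if_pos hn] at h1
        rw [(hb' n).1 hn, ← h1]
        simp
      · exact ((hb' n).2 hn).symm
    rwa [this]
  · intro ha
    have : lineIdeal k S ≤ RingHom.ker (edge k h0) := by
      refine Ideal.span_le.2 ?_
      rintro _ ⟨m, hm, rfl⟩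
      rw [SetLike.mem_coe, RingHom.mem_ker, mono, edge_single, if_neg hm.ne']
    exact this ha

/-- Functions on the intersection of the line with `U_S`, `0 ∉ S`, as Laurent polynomials. -/
def lineEval (k : Type u) [Field k] (h0 : 0 ∉ S.1) : lineRing k S →+* TorusRing k :=
  Ideal.Quotient.lift (lineIdeal k S) (edge k h0).toRingHom fun a ha => (edge_eq_zero_iff h0 a).2 ha

theorem lineEval_mk (h0 : 0 ∉ S.1) (a : chartRing k S) :
    lineEval k h0 (Ideal.Quotient.mk _ a) = edge k h0 a := rfl

theorem lineEval_injective (h0 : 0 ∉ S.1) : Function.Injective (lineEval k h0) := by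
  rw [injective_iff_map_eq_zero]
  intro x hx
  obtain ⟨a, rfl⟩ := Ideal.Quotient.mk_surjective x
  exact Ideal.Quotient.eq_zero_iff_mem.2 ((edge_eq_zero_iff h0 a).1 hx)

theorem isDomain_lineRing (h0 : 0 ∉ S.1) : IsDomain (lineRing k S) :=
  (lineEval_injective h0).isDomain

theorem edge_restr (h : S ≤ S') (h0 : 0 ∉ S.1) (h0' : 0 ∉ S'.1) (a : chartRing k S) :
    edge k h0' (restr k h a) = edge k h0 a := by
  induction a using AddMonoidAlgebra.induction_linear with
  | zero => simp
  | add f g hf hg => rw [map_add, map_add, map_add, hf, hg]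
  | single m c => rw [restr_single, edge_single, edge_single]; rfl

theorem lineEval_lineRestr (h : S ≤ S') (h0 : 0 ∉ S.1) (h0' : 0 ∉ S'.1) (x : lineRing k S) :
    lineEval k h0' (lineRestr k h x) = lineEval k h0 x := by
  obtain ⟨a, rfl⟩ := Ideal.Quotient.mk_surjective x
  exact edge_restr h h0 h0' a

theorem mem_cone_of_lineEval_coeff (h0 : 0 ∉ S.1) {x : lineRing k S} {m : charLattice}
    (hm : (lineEval k h0 x).coeff m ≠ 0) : m.1 0 = 0 ∧ m ∈ cone S := by
  obtain ⟨a, rfl⟩ := Ideal.Quotient.mk_surjective x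
  rw [lineEval_mk] at hm
  by_cases hc : m ∈ cone S
  · rw [edge_coeff h0 a ⟨m, hc⟩] at hm
    exact ⟨by_contra fun h => hm (if_neg h), hc⟩
  · exact absurd (edge_coeff_of_notMem h0 a hc) hm

theorem zero_notMem_chart_one : (0 : Fin 3) ∉ (chart 1).1 := notMem_chart.2 (by decide)

theorem zero_notMem_chart_two : (0 : Fin 3) ∉ (chart 2).1 := notMem_chart.2 (by decide)

theorem notMem_overlap_iff {i : Fin 3} : i ∉ (overlap 1 2).1 ↔ i = 0 := by
  revert i; unfold overlap; decide

theorem zero_notMem_overlap : (0 : Fin 3) ∉ (overlap 1 2).1 := notMem_overlap_iff.2 rfl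

theorem coe_zsmul_ratio (d : ℤ) (i j h : Fin 3) :
    (d • ratio i j).1 h = (if h = j then d else 0) - (if h = i then d else 0) := by
  change d • ((Pi.single j 1 : Fin 3 → ℤ) h - (Pi.single i 1 : Fin 3 → ℤ) h) = _
  rw [Pi.single_apply, Pi.single_apply]
  split_ifs <;> simp

/-- The exponent of `(u₂ / u₁)^d` on `U₁ ∩ U₂`. -/
def overlapExp (d : ℤ) : cone (overlap 1 2) := ⟨d • ratio 1 2, fun i hi => by
  rw [notMem_overlap_iff.1 hi, coe_zsmul_ratio]; simp⟩

/-- On the line, `p` is a polynomial in u_2 / u_1 and `q` a polynomial in u_1 / u_2. A nonzero `p`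
times (u_2 / u_1)^d can only be such a `q` if d ≤ 0. -/
theorem le_zero_of_lineEval_eq {p : lineRing k (chart 1)} {q : lineRing k (chart 2)} {d : ℤ} {c : k}
    (hc : c ≠ 0) (hp : p ≠ 0)
    (h : lineEval k zero_notMem_chart_two q =
      AddMonoidAlgebra.single (d • ratio 1 2) c * lineEval k zero_notMem_chart_one p) : d ≤ 0 := by
  obtain ⟨m, hm⟩ : ∃ m, (lineEval k zero_notMem_chart_one p).coeff m ≠ 0 := by
    by_contra! h0
    refine hp (lineEval_injective zero_notMem_chart_one ?_)
    rw [map_zero]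
    exact AddMonoidAlgebra.ext (Finsupp.ext h0)
  have h1 : (lineEval k zero_notMem_chart_two q).coeff (d • ratio 1 2 + m) ≠ 0 := by
    rw [h, AddMonoidAlgebra.coeff_single_mul_eq_mul_coeff m fun m' _ => by simp]
    exact mul_ne_zero hc hm
  have h2 := (mem_cone_of_lineEval_coeff _ hm).2 2 (notMem_chart.2 (by decide))
  have h3 := (mem_cone_of_lineEval_coeff _ h1).2 1 (notMem_chart.2 (by decide))
  have h4 := (mem_cone_of_lineEval_coeff _ hm).1
  have h5 := charLattice_sum m
  have h6 : 0 ≤ (d • ratio 1 2).1 1 + m.1 1 := h3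
  rw [coe_zsmul_ratio] at h6
  simp at h6
  omega

theorem lineEval_of_toTorus_eq {a : chartRing k (overlap 1 2)} {d : ℤ} {c : k}
    (h : toTorus k _ a = AddMonoidAlgebra.single (d • ratio 1 2) c) :
    lineEval k zero_notMem_overlap (Ideal.Quotient.mk _ a) =
      AddMonoidAlgebra.single (d • ratio 1 2) c := by
  have h1 : a = AddMonoidAlgebra.single (overlapExp d) c := by
    apply toTorus_injective
    rw [h, toTorus_single]
    rfl
  rw [h1, lineEval_mk, edge_single, if_pos]
  · rfl
  · exact (coe_zsmul_ratio d 1 2 0).trans (by simp)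

variable {ξ : EqSheaf k} {n : ℕ} (B₁ : Module.Basis (Fin n) (lineRing k (chart 1)) (lineSec ξ (chart 1)))
  (B₂ : Module.Basis (Fin n) (lineRing k (chart 2)) (lineSec ξ (chart 2)))

theorem repr_lineRes {ι : Type*} [Fintype ι] (h : S ≤ S')
    {B : Module.Basis ι (lineRing k S) (lineSec ξ S)}
    {B' : Module.Basis ι (lineRing k S') (lineSec ξ S')} (hB : ∀ s, lineRes ξ h (B s) = B' s)
    (y : lineSec ξ S) (s : ι) : B'.repr (lineRes ξ h y) s = lineRestr k h (B.repr y s) := by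
  have h1 : lineRes ξ h y = ∑ s, lineRestr k h (B.repr y s) • B' s := by
    conv_lhs => rw [← B.sum_repr y]
    rw [map_sum]
    exact Finset.sum_congr rfl fun s _ => by rw [lineRes_smul, hB]
  rw [h1, Module.Basis.repr_sum_self]

variable {B : Module.Basis (Fin n) (lineRing k (overlap 1 2)) (lineSec ξ (overlap 1 2))}
  (hB₁ : ∀ s, lineRes ξ (chart_le_left 1 2) (B₁ s) = B s)
  (hB₂ : ∀ s, lineRes ξ (chart_le_right 1 2) (B₂ s) = B s)

include hB₁ hB₂

/-- Coordinates of a family over `U₁` and of one over `U₂` are related by the transition matrix. -/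
theorem lineEval_det_eq {r : ℕ} {x₁ : Fin r → lineSec ξ (chart 1)} {x₂ : Fin r → lineSec ξ (chart 2)}
    {P : Matrix (Fin r) (Fin r) (lineRing k (overlap 1 2))}
    (hP : ∀ t, lineRes ξ (chart_le_right 1 2) (x₂ t) =
      ∑ s, P s t • lineRes ξ (chart_le_left 1 2) (x₁ s)) (σ : Fin r → Fin n) :
    lineEval k zero_notMem_chart_two (Matrix.det (.of fun s t => B₂.repr (x₂ t) (σ s))) =
      lineEval k zero_notMem_overlap P.det *
        lineEval k zero_notMem_chart_one (Matrix.det (.of fun s t => B₁.repr (x₁ t) (σ s))) := by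
  rw [← lineEval_lineRestr (chart_le_right 1 2) _ zero_notMem_overlap,
    ← lineEval_lineRestr (chart_le_left 1 2) _ zero_notMem_overlap, ← map_mul,
    RingHom.map_det (lineRestr k (chart_le_right 1 2)),
    RingHom.map_det (lineRestr k (chart_le_left 1 2)), mul_comm, ← Matrix.det_mul]
  congr 2
  ext s t
  have h1 := congrArg (fun y => B.repr y (σ s)) (hP t)
  simp only [map_sum, map_smul, Finsupp.finsetSum_apply, Finsupp.smul_apply, smul_eq_mul] at h1
  rw [repr_lineRes _ hB₂] at h1
  rw [Matrix.mul_apply]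
  refine h1.trans (Finset.sum_congr rfl fun u _ => ?_)
  rw [repr_lineRes _ hB₁, mul_comm]
  rfl

/-- Subsheaves of a trivial bundle on the line have nonpositive degree. -/
theorem lineDegree_le_zero {N : ∀ S, Submodule (lineRing k S) (lineSec ξ S)} {r : ℕ} {d : ℤ}
    (h : LineHasRankDegree ξ N r d) : d ≤ 0 := by
  obtain ⟨b₁, b₂, P, c, a, hc, h1, h2, h3⟩ := h
  have := isDomain_lineRing (k := k) zero_notMem_chart_one
  have hli : LinearIndependent (lineRing k (chart 1))
      (Matrix.of fun s t => B₁.repr (b₁ t : lineSec ξ (chart 1)) s).col := by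
    have := (b₁.linearIndependent.map' (N (chart 1)).subtype (Submodule.ker_subtype _)).map'
      B₁.equivFun.toLinearMap B₁.equivFun.ker
    exact this
  -- A nonzero maximal minor plays the role of a nonzero map from det N to a trivial line bundle.
  obtain ⟨σ, hσ⟩ := exists_minor_ne_zero _ hli
  have h4 := lineEval_det_eq B₁ B₂ hB₁ hB₂ h1 σ
  rw [h3, lineEval_of_toTorus_eq h2] at h4
  exact le_zero_of_lineEval_eq hc hσ h4

/-- A trivial bundle on the line has nonnegative degree. -/
theorem lineDegree_top_nonneg {r : ℕ} {d : ℤ} (h : LineHasRankDegree ξ (fun _ => ⊤) r d) :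
    0 ≤ d := by
  obtain ⟨b₁, b₂, P, c, a, hc, h1, h2, h3⟩ := h
  have := isDomain_lineRing (k := k) zero_notMem_chart_one
  let b₁' := b₁.map Submodule.topEquiv
  let b₂' := b₂.map Submodule.topEquiv
  obtain rfl : r = n := by
    have := Fintype.card_congr (b₁'.indexEquiv B₁)
    simpa using this
  have h4 := lineEval_det_eq B₁ B₂ hB₁ hB₂ h1 id
  rw [h3, lineEval_of_toTorus_eq h2] at h4
  have hdet : ∀ {R M : Type u} [CommRing R] [AddCommGroup M] [Module R M]
      (B b : Module.Basis (Fin r) R M), (B.toMatrix b).det * (b.toMatrix B).det = 1 := by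
    intro R M _ _ _ B b
    rw [← Matrix.det_mul, Module.Basis.toMatrix_mul_toMatrix_flip, Matrix.det_one]
  have h5 := congrArg (lineEval k zero_notMem_chart_one) (hdet B₁ b₁')
  have h6 := congrArg (lineEval k zero_notMem_chart_two) (hdet B₂ b₂')
  rw [map_mul, map_one] at h5 h6
  have h4' : lineEval k zero_notMem_chart_two (B₂.toMatrix b₂').det =
      AddMonoidAlgebra.single (d • ratio 1 2) c *
        lineEval k zero_notMem_chart_one (B₁.toMatrix b₁').det := h4
  have h7 : (AddMonoidAlgebra.single (-d • ratio 1 2) c⁻¹ : TorusRing k) *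
      AddMonoidAlgebra.single (d • ratio 1 2) c = 1 := by
    rw [AddMonoidAlgebra.single_mul_single, neg_smul, neg_add_cancel, inv_mul_cancel₀ hc]
    rfl
  -- The inverse changes of basis satisfy the same relation with -d, so the previous bound gives -d
  -- ≤ 0.
  have h8 : lineEval k zero_notMem_chart_two (b₂'.toMatrix B₂).det =
      AddMonoidAlgebra.single (-d • ratio 1 2) c⁻¹ *
        lineEval k zero_notMem_chart_one (b₁'.toMatrix B₁).det := by
    rw [h4'] at h6
    linear_combination
      (-lineEval k zero_notMem_chart_two (b₂'.toMatrix B₂).det) * h7 +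
      (-lineEval k zero_notMem_chart_two (b₂'.toMatrix B₂).det) *
        (AddMonoidAlgebra.single (-d • ratio 1 2) c⁻¹ * AddMonoidAlgebra.single (d • ratio 1 2) c) * h5 +
      (AddMonoidAlgebra.single (-d • ratio 1 2) c⁻¹ *
        lineEval k zero_notMem_chart_one (b₁'.toMatrix B₁).det) * h6
  have h9 : (b₁'.toMatrix B₁).det ≠ 0 := fun h0 => by
    rw [h0, map_zero, mul_zero] at h5
    exact zero_ne_one h5
  have := le_zero_of_lineEval_eq (inv_ne_zero hc) h9 h8
  omega

theorem isLineSemistable_of_trivial : IsLineSemistable ξ := by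
  intro N _ r r' d d' _ h h'
  have h1 : (d : ℚ) ≤ 0 := by exact_mod_cast lineDegree_le_zero B₁ B₂ hB₁ hB₂ h
  have h2 : (0 : ℚ) ≤ d' := by exact_mod_cast lineDegree_top_nonneg B₁ B₂ hB₁ hB₂ h'
  exact (div_nonpos_of_nonpos_of_nonneg h1 (Nat.cast_nonneg r)).trans
    (div_nonneg h2 (Nat.cast_nonneg r'))

end LineDegree

/-! ## The degree of a Rees bundle -/

section Degree

theorem prod_chi {ι : Type*} (s : Finset ι) (n : ι → charLattice) :
    ∏ i ∈ s, (chi (n i) : TorusRing k) = chi (∑ i ∈ s, n i) := by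
  classical
  induction s using Finset.induction_on with
  | empty => rfl
  | insert i s hi ih =>
    rw [Finset.prod_insert hi, Finset.sum_insert hi, ih, chi, chi, chi,
      AddMonoidAlgebra.single_mul_single, one_mul]

/-- The matrix is the constant matrix `g` with its rows multiplied by the u^{-n s} and its columns
by the u^{n' t}. -/
theorem det_single {r : ℕ} (n n' : Fin r → charLattice) (g : Matrix (Fin r) (Fin r) k) :
    Matrix.det (.of fun s t => (AddMonoidAlgebra.single (n' t - n s) (g s t) : TorusRing k)) =
      AddMonoidAlgebra.single (∑ t, n' t - ∑ s, n s) g.det := by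
  have h1 : (Matrix.of fun s t => (AddMonoidAlgebra.single (n' t - n s) (g s t) : TorusRing k)) =
      .of fun s t => chi (-n s) * (Matrix.of fun s t => chi (n' t) *
        (AddMonoidAlgebra.singleZeroRingHom : k →+* TorusRing k).mapMatrix g s t) s t := by
    ext1 s t
    change AddMonoidAlgebra.single (n' t - n s) (g s t) = AddMonoidAlgebra.single (-n s) 1 *
      (AddMonoidAlgebra.single (n' t) 1 * AddMonoidAlgebra.single 0 (g s t))
    rw [AddMonoidAlgebra.single_mul_single, AddMonoidAlgebra.single_mul_single, one_mul, one_mul,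
      add_zero, sub_eq_neg_add]
  rw [h1, Matrix.det_mul_column, Matrix.det_mul_row, ← RingHom.map_det, prod_chi, prod_chi]
  change AddMonoidAlgebra.single _ 1 * (AddMonoidAlgebra.single _ 1 *
    AddMonoidAlgebra.single 0 g.det) = _
  rw [AddMonoidAlgebra.single_mul_single, AddMonoidAlgebra.single_mul_single, one_mul, one_mul,
      add_zero, Finset.sum_neg_distrib, sub_eq_neg_add]

/-- The transition matrix between two monomial bases. -/
theorem exists_transition {V : Type u} [AddCommGroup V] [Module k V] {S : Idx} {r : ℕ}
    (e e' : Module.Basis (Fin r) k V) (n n' : Fin r → charLattice)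
    (h : ∀ s t, e.repr (e' t) s ≠ 0 → n' t - n s ∈ cone S) :
    ∃ (P : Matrix (Fin r) (Fin r) (chartRing k S)) (c : k), c ≠ 0 ∧
      (∀ t, orbitMono k S (n' t) (e' t) = ∑ s, P s t • orbitMono k S (n s) (e s)) ∧
      toTorus k S P.det = AddMonoidAlgebra.single (∑ t, n' t - ∑ s, n s) c := by
  classical
  have h1 : ∀ s t, ∃ p : chartRing k S,
      p • orbitMono k S (n s) (e s) = orbitMono k S (n' t) (e.repr (e' t) s • e s) ∧
      toTorus k S p = AddMonoidAlgebra.single (n' t - n s) (e.repr (e' t) s) := by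
    intro s t
    by_cases h0 : e.repr (e' t) s = 0
    · refine ⟨0, ?_, ?_⟩
      · rw [h0, zero_smul, zero_smul, map_zero]
      · rw [h0, map_zero, AddMonoidAlgebra.single_zero]
    · refine ⟨AddMonoidAlgebra.single ⟨_, h s t h0⟩ (e.repr (e' t) s), ?_, toTorus_single _ _⟩
      rw [single_smul_orbitMono, sub_add_cancel]
  choose P hP hP' using h1
  refine ⟨.of P, (e.toMatrix e').det, fun h0 => ?_, fun t => ?_, ?_⟩
  · have h2 := congrArg Matrix.det (e.toMatrix_mul_toMatrix_flip e')
    rw [Matrix.det_mul, h0, zero_mul, Matrix.det_one] at h2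
    exact zero_ne_one h2
  · conv_lhs => rw [← e.sum_repr (e' t)]
    rw [map_sum]
    exact Finset.sum_congr rfl fun s _ => (hP s t).symm
  · rw [RingHom.map_det, ← det_single]
    congr 1
    ext1 s t
    exact hP' s t

theorem charLattice_coe_sum {ι : Type*} (s : Finset ι) (n : ι → charLattice) (i : Fin 3) :
    (∑ t ∈ s, n t).1 i = ∑ t ∈ s, (n t).1 i := by
  rw [AddSubgroup.val_finsetSum, Finset.sum_apply]

theorem coe_reesRes {V : MultiFil k} {S S' : Idx} (h : S ≤ S') {x : reesSec V S} {m : charLattice}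
    {w : V.V} (hx : x.1 = orbitMono k S m w) : (reesRes V h x).1 = orbitMono k S' m w := hx

theorem hasRankDegree_rees (V : TriFil k)
    {e₀ e₁ e₂ : Module.Basis (Fin (Module.finrank k V.obj.V)) k V.obj.V}
    {a b c : Fin (Module.finrank k V.obj.V) → ℤ} (h₀ : Adapted e₀ (V.obj.F 0) a)
    (h₁ : Adapted e₁ (V.obj.F 1) b) (h₂ : Adapted e₂ (V.obj.F 2) c) :
    HasRankDegree (reesObj V.obj) (Module.finrank k V.obj.V) (∑ s, (a s + b s + c s)) := by
  choose E d hE using exists_adapted_chart V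
  -- `A i` is the total degree of F_i. By `Adapted.sum_eq` it is the same for every adapted basis,
  -- hence for all charts.
  obtain ⟨A, hA, hAD⟩ : ∃ A : Fin 3 → ℤ, (∀ l i, i ≠ l → ∑ s, d l s i = A i) ∧
      A 0 + A 1 + A 2 = ∑ s, (a s + b s + c s) := by
    refine ⟨![∑ s, a s, ∑ s, b s, ∑ s, c s], fun l i hi => ?_, ?_⟩
    · fin_cases i
      · exact (hE l 0 hi).sum_eq h₀
      · exact (hE l 1 hi).sum_eq h₁
      · exact (hE l 2 hi).sum_eq h₂
    · simp [Finset.sum_add_distrib]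
  set D := ∑ s, (a s + b s + c s)
  -- The exponents of the basis over `U_l` add up to D times the l-th unit vector minus A, so the
  -- determinant from `U_i` to `U_j` is a constant times (u_j / u_i)^D.
  have hsum : ∀ l i, (∑ s, expo l (d l s)).1 i = (if i = l then D else 0) - A i := by
    intro l i
    have h1 : ∀ i, i ≠ l → (∑ s, expo l (d l s)).1 i = -A i := by
      intro i hi
      rw [charLattice_coe_sum, ← hA l i hi, ← Finset.sum_neg_distrib]
      exact Finset.sum_congr rfl fun s _ => expo_apply_of_ne hi _
    have h2 := charLattice_sum (∑ s, expo l (d l s))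
    split_ifs with hi
    · subst hi
      fin_cases i
      · have h3 := h1 1 (by decide); have h4 := h1 2 (by decide); simp only [Fin.zero_eta] at *; omega
      · have h3 := h1 0 (by decide); have h4 := h1 2 (by decide); simp only [Fin.mk_one] at *; omega
      · have h3 := h1 0 (by decide); have h4 := h1 1 (by decide)
        simp only [Fin.reduceFinMk] at *; omega
    · rw [h1 i hi, zero_sub]
  let B : ∀ l, Module.Basis _ (chartRing k (chart l)) (reesSec V.obj (chart l)) := fun l =>
    reesBasis (E l) (d l) (Finset.mem_singleton_self l) fun i hi => hE l i (notMem_chart.1 hi)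
  have hB : ∀ l s, (B l s).1 = orbitMono k (chart l) (expo l (d l s)) (E l s) := fun l s =>
    coe_reesBasis _ _ _ _ s
  refine ⟨B, fun i j => ?_⟩
  obtain ⟨P, x, hx, h1, h2⟩ := exists_transition (S := overlap i j) (E i) (E j)
    (fun s => expo i (d i s)) (fun s => expo j (d j s)) (by
      intro s t hst h hh
      have hi : h ≠ i := fun hi => hh (chart_le_left i j (by rw [hi]; exact Finset.mem_singleton_self i))
      have hj : h ≠ j := fun hj => hh (chart_le_right i j (by rw [hj]; exact Finset.mem_singleton_self j))
      have h3 : d j t h ≤ d i s h := (hE i h hi _ _).1 ((hE j h hj).mem_self t) s hst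
      change 0 ≤ (expo j (d j t)).1 h - (expo i (d i s)).1 h
      rw [expo_apply_of_ne hi, expo_apply_of_ne hj]
      omega)
  refine ⟨P, x, hx, fun t => ?_, ?_⟩
  · change reesRes V.obj (chart_le_right i j) (B j t) =
      ∑ s, P s t • reesRes V.obj (chart_le_left i j) (B i s)
    apply Subtype.ext
    rw [coe_reesRes _ (hB j t), h1, Submodule.coe_sum]
    refine Finset.sum_congr rfl fun s _ => ?_
    rw [Submodule.coe_smul, coe_reesRes _ (hB i s)]
  · rw [h2]
    congr 1
    apply Subtype.ext
    funext h
    rw [coe_zsmul_ratio]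
    change (∑ t, expo j (d j t)).1 h - (∑ t, expo i (d i t)).1 h = _
    rw [hsum, hsum]
    ring

end Degree

/-! ## Opposed triples and semistable bundles -/

section Semistable

/-- One spare step in F_0 allows u_0 / u_l to be factored out of the section. On the line, sections
therefore depend only on classes in Gr_{F_0}. -/
theorem toLine_orbitMono_eq_zero {V : MultiFil k} {S : Idx} (h0 : 0 ∉ S.1) {m : charLattice}
    {w : V.V} (hw : ∀ i ∉ S.1, w ∈ V.F i (-m.1 i)) (hw0 : w ∈ V.F 0 (-m.1 0 + 1)) :
    toLine (reesObj V) S ⟨orbitMono k S m w, orbitMono_mem_reesSec hw⟩ = 0 := by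
  obtain ⟨l, hl⟩ := S.2
  have hl0 : l ≠ 0 := by rintro rfl; exact h0 hl
  have hr : ∀ i ∉ S.1, (ratio l 0).1 i = if i = 0 then 1 else 0 := by
    intro i hi
    have h1 : i ≠ l := by rintro rfl; exact hi hl
    simp [ratio, Pi.single_apply, h1]
  have hc : ratio l 0 ∈ cone S := fun i hi => by rw [hr i hi]; split_ifs <;> decide
  have hm : orbitMono k S (m - ratio l 0) w ∈ reesSec V S := by
    refine orbitMono_mem_reesSec fun i hi => ?_
    change w ∈ V.F i (-(m.1 i - (ratio l 0).1 i))
    rw [hr i hi]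
    split_ifs with h
    · subst h; rwa [neg_sub, sub_eq_neg_add]
    · rw [sub_zero]; exact hw i hi
  apply toLine_eq_zero
  have h1 : (⟨orbitMono k S m w, orbitMono_mem_reesSec hw⟩ : reesSec V S) =
      (mono ⟨_, hc⟩ : chartRing k S) • ⟨_, hm⟩ := by
    apply Subtype.ext
    rw [Submodule.coe_smul]
    refine Eq.trans ?_ (mono_smul_orbitMono _ _ _).symm
    change _ = orbitMono k S (ratio l 0 + (m - ratio l 0)) w
    rw [add_sub_cancel]
  rw [h1]
  refine Submodule.smul_mem_smul (Ideal.subset_span ⟨_, ?_, rfl⟩) Submodule.mem_top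
  change 0 < (ratio l 0).1 0
  rw [hr 0 h0, if_pos rfl]
  exact one_pos

/-- The submodules generated by one section over `U₁` and one over `U₂` that agree up to a unit. -/
theorem exists_isLineSubsheaf {ξ : EqSheaf k} (x₁ : lineSec ξ (chart 1)) (x₂ : lineSec ξ (chart 2))
    {v : lineRing k (overlap 1 2)} (hv : IsUnit v)
    (h : lineRes ξ (chart_le_right 1 2) x₂ = v • lineRes ξ (chart_le_left 1 2) x₁) :
    ∃ N, IsLineSubsheaf ξ N ∧ N (chart 1) = Submodule.span _ {x₁} ∧
      N (chart 2) = Submodule.span _ {x₂} := by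
  let N : ∀ S, Submodule (lineRing k S) (lineSec ξ S) := fun S =>
    (⨆ h : chart 1 ≤ S, Submodule.span _ {lineRes ξ h x₁}) ⊔
      (⨆ h : chart 2 ≤ S, Submodule.span _ {lineRes ξ h x₂})
  have h1 : N (chart 1) = Submodule.span _ {x₁} := by
    have h12 : ¬ chart 2 ≤ chart 1 := by unfold chart; decide
    simp only [N, le_refl, iSup_pos, h12, iSup_false, sup_bot_eq]
    rw [lineRes_refl]
  have h2 : N (chart 2) = Submodule.span _ {x₂} := by
    have h12 : ¬ chart 1 ≤ chart 2 := by unfold chart; decide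
    simp only [N, le_refl, iSup_pos, h12, iSup_false, bot_sup_eq]
    rw [lineRes_refl]
  have h3 : Submodule.span (lineRing k (overlap 1 2)) {lineRes ξ (chart_le_right 1 2) x₂} =
      Submodule.span _ {lineRes ξ (chart_le_left 1 2) x₁} := by
    rw [h]
    exact Submodule.span_singleton_smul_eq hv _
  have h4 : N (overlap 1 2) = Submodule.span _ {lineRes ξ (chart_le_left 1 2) x₁} := by
    simp only [N, chart_le_left 1 2, chart_le_right 1 2, iSup_pos]
    rw [h3, sup_idem]
  have h5 : ∀ {S S' : Idx} (h : S ≤ S') (x : lineSec ξ S), Submodule.span (lineRing k S')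
      (lineRes ξ h '' (Submodule.span (lineRing k S) {x} : Set (lineSec ξ S))) =
      Submodule.span _ {lineRes ξ h x} := by
    intro S S' h x
    refine le_antisymm (Submodule.span_le.2 ?_) (Submodule.span_mono ?_)
    · rintro _ ⟨y, hy, rfl⟩
      obtain ⟨a, rfl⟩ := Submodule.mem_span_singleton.1 hy
      rw [lineRes_smul]
      exact Submodule.smul_mem _ _ (Submodule.mem_span_singleton_self _)
    · rintro _ rfl
      exact ⟨x, Submodule.mem_span_singleton_self x, rfl⟩
  refine ⟨N, (isLineSubsheaf_iff N).2 fun l hl hl0 => ?_, h1, h2⟩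
  have hl' : l = 1 ∨ l = 2 := by revert hl0; fin_cases l <;> simp
  rcases hl' with rfl | rfl
  · rw [h1, h5, h4]
  · rw [h2, h5, h4, ← h3]

/-- Basis elements that match up to a power of u_2 / u_1, a unit on the overlap, glue to a line
subbundle; the power is its degree. -/
theorem exists_lineSubsheaf_of_degree {ξ : EqSheaf k} {ι : Type*}
    (B₁ : Module.Basis ι (lineRing k (chart 1)) (lineSec ξ (chart 1)))
    (B₂ : Module.Basis ι (lineRing k (chart 2)) (lineSec ξ (chart 2))) (s : ι) (d : ℤ)
    (h : lineRes ξ (chart_le_right 1 2) (B₂ s) =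
      Ideal.Quotient.mk (lineIdeal k (overlap 1 2)) (mono (overlapExp d)) • lineRes ξ (chart_le_left 1 2) (B₁ s)) :
    ∃ N, IsLineSubsheaf ξ N ∧ LineHasRankDegree ξ N 1 d := by
  have hu : IsUnit (mono (overlapExp d) : chartRing k (overlap 1 2)) := by
    refine isUnit_mono _ fun i hi => ?_
    have h1 : (d • ratio 1 2).1 i = 0 := by
      rw [notMem_overlap_iff.1 hi, coe_zsmul_ratio]; simp
    change 0 ≤ -(d • ratio 1 2).1 i
    rw [h1, neg_zero]
  obtain ⟨N, hN, h1, h2⟩ := exists_isLineSubsheaf (B₁ s) (B₂ s)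
    (hu.map (Ideal.Quotient.mk (lineIdeal k (overlap 1 2)))) h
  have hinj : Function.Injective fun _ : Fin 1 => s := fun _ _ _ => Subsingleton.elim _ _
  have hr : ∀ {M : Type u} (x : M), Set.range (fun _ : Fin 1 => x) = {x} := fun x =>
    Set.range_const
  refine ⟨N, hN,
    (Module.Basis.span (B₁.linearIndependent.comp _ hinj)).map (LinearEquiv.ofEq _ _
      (by rw [h1, ← hr]; rfl)),
    (Module.Basis.span (B₂.linearIndependent.comp _ hinj)).map (LinearEquiv.ofEq _ _
      (by rw [h2, ← hr]; rfl)),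
    .of fun _ _ => Ideal.Quotient.mk _ (mono (overlapExp d)), 1, mono (overlapExp d), one_ne_zero,
    fun t => ?_, toTorus_mono _, by rw [Matrix.det_unique]; rfl⟩
  simp only [Module.Basis.map_apply, LinearEquiv.coe_ofEq_apply, Module.Basis.span_apply,
    Finset.univ_unique, Finset.sum_singleton, Function.comp_apply]
  exact h

variable {V : TriFil k} {r : ℕ} {e e' : Module.Basis (Fin r) k V.obj.V} {a b c : Fin r → ℤ}

/-- The sections over `U₁` given by a basis adapted to `F₀` and `F₂`. -/
def basisOne (h₀ : Adapted e' (V.obj.F 0) a) (h₂ : Adapted e' (V.obj.F 2) c) :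
    Module.Basis (Fin r) (chartRing k (chart 1)) ((reesObj V.obj).sec (chart 1)) :=
  reesBasis e' (fun s => ![a s, 0, c s]) (l := 1) (Finset.mem_singleton_self 1) fun i hi => by
    have hi : i ≠ 1 := notMem_chart.1 hi
    fin_cases i
    · exact h₀
    · exact absurd rfl hi
    · exact h₂

/-- The sections over `U₂` given by a basis adapted to `F₀` and `F₁`. -/
def basisTwo (h₀ : Adapted e (V.obj.F 0) a) (h₁ : Adapted e (V.obj.F 1) b) :
    Module.Basis (Fin r) (chartRing k (chart 2)) ((reesObj V.obj).sec (chart 2)) :=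
  reesBasis e (fun s => ![a s, b s, 0]) (l := 2) (Finset.mem_singleton_self 2) fun i hi => by
    have hi : i ≠ 2 := notMem_chart.1 hi
    fin_cases i
    · exact h₀
    · exact h₁
    · exact absurd rfl hi

/-- The sections over `U₁ ∩ U₂` given by a basis adapted to `F₀`. -/
def basisOverlap (h₀ : Adapted e' (V.obj.F 0) a) (c : Fin r → ℤ) :
    Module.Basis (Fin r) (chartRing k (overlap 1 2)) ((reesObj V.obj).sec (overlap 1 2)) :=
  reesBasis e' (fun s => ![a s, 0, c s]) (l := 1) (chart_le_left 1 2 (Finset.mem_singleton_self 1))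
    fun i hi => by rw [notMem_overlap_iff.1 hi]; exact h₀

theorem res_basisOne (h₀ : Adapted e' (V.obj.F 0) a) (h₂ : Adapted e' (V.obj.F 2) c) (s : Fin r) :
    (reesRes V.obj (chart_le_left 1 2) (basisOne h₀ h₂ s)).1 =
      orbitMono k (overlap 1 2) (expo 1 ![a s, 0, c s]) (e' s) :=
  coe_reesRes _ (coe_reesBasis e' (fun s => ![a s, 0, c s]) _ _ s)

theorem res_basisTwo (h₀ : Adapted e (V.obj.F 0) a) (h₁ : Adapted e (V.obj.F 1) b) (s : Fin r) :
    (reesRes V.obj (chart_le_right 1 2) (basisTwo h₀ h₁ s)).1 =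
      orbitMono k (overlap 1 2) (expo 2 ![a s, b s, 0]) (e s) :=
  coe_reesRes _ (coe_reesBasis e (fun s => ![a s, b s, 0]) _ _ s)

theorem lineRes_basisOne (h₀ : Adapted e' (V.obj.F 0) a) (h₂ : Adapted e' (V.obj.F 2) c)
    (s : Fin r) : lineRes (reesObj V.obj) (chart_le_left 1 2) (lineBasis (basisOne h₀ h₂) s) =
      lineBasis (basisOverlap h₀ c) s := by
  rw [lineBasis_apply, lineBasis_apply, lineRes_toLine]
  congr 1
  exact Subtype.ext ((res_basisOne h₀ h₂ s).trans
    (coe_reesBasis e' (fun s => ![a s, 0, c s]) _ _ s).symm)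

/-- As `e s` and `e' s` agree modulo the next step of F_0, their difference dies on the line, and
only the quotient of the two monomials remains. The restriction to the line is thus the sum of the
O(a_s + b_s + c_s). -/
theorem lineRes_basisTwo (h₀ : Adapted e (V.obj.F 0) a) (h₁ : Adapted e (V.obj.F 1) b)
    (h₀' : Adapted e' (V.obj.F 0) a) (h₂ : Adapted e' (V.obj.F 2) c)
    (hee : ∀ s, e s - e' s ∈ V.obj.F 0 (a s + 1)) (s : Fin r) :
    lineRes (reesObj V.obj) (chart_le_right 1 2) (lineBasis (basisTwo h₀ h₁) s) =
      Ideal.Quotient.mk (lineIdeal k (overlap 1 2)) (mono (overlapExp (a s + b s + c s))) •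
        lineRes (reesObj V.obj) (chart_le_left 1 2) (lineBasis (basisOne h₀' h₂) s) := by
  rw [lineBasis_apply, lineBasis_apply, lineRes_toLine, lineRes_toLine, mk_smul_toLine,
    ← sub_eq_zero, ← map_sub]
  have hn0 : (expo 2 ![a s, b s, 0]).1 0 = -a s := expo_apply_of_ne (by decide) _
  have h1 : (overlapExp (a s + b s + c s)).1 + expo 1 ![a s, 0, c s] = expo 2 ![a s, b s, 0] := by
    refine charLattice_ext (l := 2) fun i hi => ?_
    change ((a s + b s + c s) • ratio 1 2).1 i + (expo 1 ![a s, 0, c s]).1 i = _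
    rw [coe_zsmul_ratio, expo_apply_of_ne hi]
    fin_cases i
    · rw [expo_apply_of_ne (by decide)]; simp
    · rw [show ((⟨1, by decide⟩ : Fin 3)) = 1 from rfl, expo_apply_self]; simp; ring
    · exact absurd rfl hi
  have hw : ∀ i ∉ (overlap 1 2).1, e s - e' s ∈ V.obj.F i (-(expo 2 ![a s, b s, 0]).1 i) := by
    intro i hi
    rw [notMem_overlap_iff.1 hi, hn0, neg_neg]
    exact (V.property.2 0).1 (by omega : a s ≤ a s + 1) (hee s)
  refine Eq.trans ?_ (toLine_orbitMono_eq_zero zero_notMem_overlap hw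
    (by rw [hn0, neg_neg]; exact hee s))
  congr 1
  change reesRes V.obj (chart_le_right 1 2) (basisTwo h₀ h₁ s) -
    (mono (overlapExp (a s + b s + c s)) : chartRing k (overlap 1 2)) •
      reesRes V.obj (chart_le_left 1 2) (basisOne h₀' h₂ s) = _
  apply Subtype.ext
  rw [Submodule.coe_sub, Submodule.coe_smul, res_basisOne, res_basisTwo, mono_smul_orbitMono, h1]
  exact (map_sub _ _ _).symm

/-- On the line the bundle is a sum of line bundles of degrees a_s + b_s + c_s. Semistability of
slope 0 bounds each degree by 0 while the sum is nonnegative, so all vanish; conversely, if all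
vanish, the restriction is trivial. -/
theorem isSemistableSlopeZero_iff (V : TriFil k) :
    isSemistableSlopeZero k ((triRees k).obj V) ↔ isOpposed k V := by
  obtain ⟨e, e', a, b, c, h₀, h₁, h₀', h₂, hee⟩ := exists_adapted_triple V
  have hres := lineRes_basisTwo h₀ h₁ h₀' h₂ hee
  have hdeg := hasRankDegree_rees V h₀ h₁ h₂
  refine Iff.trans ?_ (opposed_iff_degree h₀ h₁ h₀' h₂ hee).symm
  constructor
  · rintro ⟨hss, r, d, hd, hslope⟩ s
    have hle : ∀ s, a s + b s + c s ≤ 0 := by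
      intro s
      obtain ⟨N, hN, hN1⟩ := exists_lineSubsheaf_of_degree _ _ s _ (hres s)
      have h1 := hss N hN 1 r _ d one_pos hN1 hd.line
      rw [hslope, Nat.cast_one, div_one] at h1
      exact_mod_cast h1
    obtain ⟨b₁, -⟩ := id hd
    have hr : r = Module.finrank k V.obj.V := by
      have := Fintype.card_congr ((b₁ 1).indexEquiv (basisOne h₀' h₂))
      simpa using this
    have hpos : 0 < r := hr ▸ Fin.pos s
    -- The degree 0 in the slope hypothesis is relative to unspecified bases. Viewing the whole
    -- restriction as a subsheaf of itself compares it with the sum of the degrees.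
    have h2 := hss _ (isLineSubsheaf_top (isVectorBundle_rees V).1) r _ d _ hpos hd.line hdeg.line
    rw [hslope] at h2
    have h3 : 0 ≤ ∑ s, (a s + b s + c s) := by
      by_contra! h4
      have h5 : ((∑ s, (a s + b s + c s) : ℤ) : ℚ) < 0 := by exact_mod_cast h4
      have h6 : (0 : ℚ) < (Module.finrank k V.obj.V : ℚ) := by rw [← hr]; exact_mod_cast hpos
      exact absurd h2 (not_le.2 (div_neg_of_neg_of_pos h5 h6))
    have h4 := (Finset.sum_eq_zero_iff_of_nonpos fun s _ => hle s).1
      (le_antisymm (Finset.sum_nonpos fun s _ => hle s) h3)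
    exact h4 s (Finset.mem_univ s)
  · intro hzero
    have h1 : (mono (overlapExp 0) : chartRing k (overlap 1 2)) = 1 := by
      rw [← mono_zero]
      congr 1
      exact Subtype.ext (zero_smul ℤ _)
    have hss : IsLineSemistable (reesObj V.obj) :=
      isLineSemistable_of_trivial _ (lineBasis (basisTwo h₀ h₁)) (lineRes_basisOne h₀' h₂)
        fun s => by rw [hres s, hzero s, lineRes_basisOne h₀' h₂, h1, map_one, one_smul]
    exact ⟨hss, _, _, hdeg, by simp [hzero]⟩

/-- Opposed triples correspond to semistable bundles of slope zero. -/
theorem restrictsToEquivalence_opposed (k : Type u) [Field k] :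
    RestrictsToEquivalence (triEquiv k) (isOpposed k) (strict k) (isSemistableSlopeZero k)
      (cokerFreeOutside k {0}) :=
  restrictsToEquivalence isSemistableSlopeZero_iff
    (fun f hX hX' => iff_of_true (cokerFreeOutside_of_isOpposed f hX hX')
      (strict_of_isOpposed f hX hX'))
    isomorphisms_le_strict (isomorphisms_le_cokerFreeOutside _)

/-- The corresponding map of opposed triples is automatically strict, and the equivalence carries
this back. -/
theorem cokerFreeOutside_of_semistable {ξ η : Fib k} (f : ξ ⟶ η)
    (hξ : isSemistableSlopeZero k ξ) (hη : isSemistableSlopeZero k η) :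
    cokerFreeOutside k {0} f :=
  have h := restrictsToEquivalence_opposed k
  (h.inv_map f hξ hη).1 (strict_of_isOpposed _ (h.inv_obj _ hξ) (h.inv_obj _ hη))

end Semistable

end TriRees

end

/-! ### The three restricted equivalences. -/

theorem mainTheorem1 (k : Type u) [Field k] [IsAlgClosed k] [CharZero k] :
    ∃ (hR : ∀ V : TriRees.TriFil k,
        TriRees.isVectorBundle k (((TriRees.isTriFil k).ι ⋙ TriRees.reesFunctor k).obj V))
      (hI : ∀ ξ : TriRees.Fib k,
        TriRees.isTriFil k (((TriRees.isVectorBundle k).ι ⋙ TriRees.fibreFunctor k).obj ξ))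
      (e : TriRees.TriFil k ≌ TriRees.Fib k),
      e.functor =
        (TriRees.isVectorBundle k).lift ((TriRees.isTriFil k).ι ⋙ TriRees.reesFunctor k) hR ∧
      e.inverse =
        (TriRees.isTriFil k).lift ((TriRees.isVectorBundle k).ι ⋙ TriRees.fibreFunctor k) hI ∧
      -- (a) all triples, strict morphisms
      TriRees.RestrictsToEquivalence e ⊤ (TriRees.strict k)
        ⊤ (TriRees.cokerFreeOutside k Set.univ) ∧
      -- (b) simultaneously split triples, strict morphisms
      TriRees.RestrictsToEquivalence e (TriRees.isSplit k) (TriRees.strict k)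
        (TriRees.isSumOfLineBundles k) (TriRees.cokerFreeOutside k Set.univ) ∧
      -- (c) opposed triples, strict morphisms
      TriRees.RestrictsToEquivalence e (TriRees.isOpposed k) (TriRees.strict k)
        (TriRees.isSemistableSlopeZero k) (TriRees.cokerFreeOutside k {0}) ∧
      ((TriRees.strict k).inverseImage (TriRees.isOpposed k).ι).IsMultiplicative ∧
      ((TriRees.cokerFreeOutside k {0}).inverseImage
        (TriRees.isSemistableSlopeZero k).ι).IsMultiplicative := by
  refine ⟨TriRees.isVectorBundle_rees, fun ξ => TriRees.isTriFil_fibre ξ.property,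
    TriRees.triEquiv k, rfl, rfl,
    TriRees.restrictsToEquivalence (fun _ => Iff.rfl)
      (fun f _ _ => TriRees.cokerFreeOutside_univ_iff f)
      TriRees.isomorphisms_le_strict (TriRees.isomorphisms_le_cokerFreeOutside _),
    TriRees.restrictsToEquivalence TriRees.isSumOfLineBundles_iff
      (fun f _ _ => TriRees.cokerFreeOutside_univ_iff f)
      TriRees.isomorphisms_le_strict (TriRees.isomorphisms_le_cokerFreeOutside _),
    TriRees.restrictsToEquivalence_opposed k, ?_, ?_⟩
  -- Strict maps do not compose in general; here every compatible map is strict, so the strictness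
  -- of the two factors plays no role.
  · exact { id_mem := fun X => TriRees.strict_of_isOpposed _ X.property X.property
            comp_mem := fun {X _ Z} _ _ _ _ =>
              TriRees.strict_of_isOpposed _ X.property Z.property }
  · exact { id_mem := fun X => TriRees.cokerFreeOutside_of_semistable _ X.property X.property
            comp_mem := fun {X _ Z} _ _ _ _ =>
              TriRees.cokerFreeOutside_of_semistable _ X.property Z.property }
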